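/- **Definitions.** Let $D\subseteq\mathbb R^2$ have coordinates $(u,v)$ (on a closed rectangle, derivatives at the sides are one-sided). A map $f:D\to\mathbb R^3$ is $C^{1M}$ if it is $C^1$ and has continuous mixed derivatives $f_{uv}=f_{vu}$. A $C^{1M}$ map $N:D\to S^2$ is *weakly harmonic* if $N_u\neq 0$ and $N_v\neq0$ everywhere on $D$, and $N_{uv}=\nu N$ with a continuous function $\nu$. A *PS-front* with normal field $N$ is a $C^{1M}$ map $r:D\to\mathbb R^3$ with $r_u=N_u\times N$, $r_v=-N_v\times N$ and $r_u,r_v\ne0$ everywhere, where $N$ is weakly harmonic. An *asymptotic complex* is a strongly regular decomposition of a closed disk into finitely many faces parametrized by rectangles $[0,u_k]\times[0,v_k]$, in which $u$-edges are glued isometrically to $u$-edges and $v$-edges to $v$-edges. A *branched PS-front* is a map of an asymptotic complex to $\mathbb R^3$ which, in the coordinates of each face, is continuous on the closed rectangle and a PS-front on its interior. An *$m$-star* is the union of $2m$ planar sectors $\{c\,s_{i}+d\,s_{i+1}: 0\le c<l_{i},\,0\le d<l_{i+1}\}$ ($0\le i<2m$, indices of $s$ and $l$ modulo $2m$) around the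 origin, with unit vectors $s_i$, consecutive angles in $(0,\pi)$ of total $2\pi$, and lengths $l_i>0$; the rays $s_i$ are alternately $u$- and $v$-rays, so $(c,d)$ (in this or the other order) are asymptotic coordinates $(u,v)$ on the sector. A map $\psi$ with normal field $N$ has a *saddle structure of order $m$* at $p$ if a neighbourhood of $p$ is homeomorphic to an $m$-star with $p$ at the centre, such that on each of the $2m$ sectors, sides included, $\psi$ is a PS-front with normal field $N$ in the asymptotic coordinates. The point $p$ is a branch point if $m\ne2$. It is an *immersed $C^{1,1}$ saddle of order $m$* if moreover, in an orthonormal basis of the plane $N(p)^\perp$, the $2m$ asymptotic curves leave $p$ in the directions $s_i$, and near $p$ the map $\psi$ is a homeomorphism onto the graph of a $C^{1,1}$ function over an open piece of the plane $\psi(p)+N(p)^\perp$, with normal $N$. **Lemma (Surgery).** Let $\Omega_0=[0,u_{\max}]\times[0,v_{\max}]$, let $r_0:\Omega_0\to\mathbb R^3$ be a $C^{1M}$ PS-front with normal field $N_0$, let $(u^*,v^*)$ be an interior point of $\Omega_0$, and let $\tilde u,\tilde v>0$. Let $\Omega^*=\{(u,v)\in\Omega_0: u\le u^*\text{ or }v\le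 v^*\}$, the closure of $\Omega_0\setminus[u^*,u_{\max}]\times[v^*,v_{\max}]$, and $$\Omega_1=[0,u_{\max}-u^*]\times[0,\tilde v],\qquad \Omega_2=[0,\tilde u]\times[0,\tilde v],\qquad \Omega_3=[0,\tilde u]\times[0,v_{\max}-v^*].$$ Let $A$ be obtained from the disjoint union of $\Omega^*,\Omega_1,\Omega_2,\Omega_3$ by the attaching maps $$\Omega_1\ni(u,0)\mapsto(u^*+u,v^*)\in\Omega^*,\quad \Omega_3\ni(u,0)\mapsto(u,0)\in\Omega_2,\quad \Omega_3\ni(0,v)\mapsto(u^*,v^*+v)\in\Omega^*,\quad \Omega_1\ni(0,v)\mapsto(0,v)\in\Omega_2 .$$ Then there are PS-fronts $r_i:\Omega_i\to\mathbb R^3$ with normal fields $N_i$ ($i=1,2,3$) such that: 1. $r_2$ is an Amsler patch: with $z=r_0(u^*,v^*)$, $n=N_0(u^*,v^*)$ and some unit vectors $e_u,e_v\perp n$, one has $r_2(u,0)=z+u\,e_u$, $r_2(0,v)=z+v\,e_v$, $N_2(u,0)=\cos u\,n+\sin u\,n\times e_u$, $N_2(0,v)=\cos v\,n-\sin v\,n\times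 e_v$. 2. $r_0|_{\Omega^*},r_1,r_2,r_3$ agree along the attaching maps, and so do $N_0|_{\Omega^*},N_1,N_2,N_3$. Hence they define continuous maps $\psi:A\to\mathbb R^3$ and $N:A\to S^2$. 3. $A$, with the six rectangular faces $\Omega_1,\Omega_2,\Omega_3$ and the three rectangles into which the lines $u=u^*$ and $v=v^*$ cut $\Omega^*$, is an asymptotic complex, and $\psi$ is a branched PS-front on it. 4. $(u^*,v^*)$ is a branch point of order $m=3$: six faces meet there, and $\psi$ (with $N$) has a saddle structure of order $3$ at it. If $N_{0,u}\times N_{0,v}\ne0$ at $(u^*,v^*)$, i.e. $r_0$ is an immersion there, then $(u^*,v^*)$ is an immersed $C^{1,1}$ saddle of order $3$ (a monkey saddle) of $\psi$. -/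

import Mathlib

namespace PSF

open scoped RealInnerProductSpace

/-- Euclidean three-space, the target of the surfaces. -/
abbrev E3 : Type := EuclideanSpace ℝ (Fin 3)

/-- The Euclidean plane. -/
abbrev Plane : Type := EuclideanSpace ℝ (Fin 2)

/-- The cross product of `ℝ³`. -/
noncomputable def cross (a b : E3) : E3 := WithLp.toLp 2 (crossProduct a.ofLp b.ofLp)

/-! ### Functions of class `C^{1M}` and pseudospherical fronts

A domain `D` is a subset of the plane with coordinates `(u, v)`. Partial derivatives are taken
along the slices of `D`, hence they are one-sided at the sides of a closed rectangle. -/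

/-- The partial derivative `∂f/∂u` on `D`. -/
noncomputable def partialU (D : Set (ℝ × ℝ)) (f : ℝ × ℝ → E3) (p : ℝ × ℝ) : E3 :=
  derivWithin (fun t => f (t, p.2)) {t | (t, p.2) ∈ D} p.1

/-- The partial derivative `∂f/∂v` on `D`. -/
noncomputable def partialV (D : Set (ℝ × ℝ)) (f : ℝ × ℝ → E3) (p : ℝ × ℝ) : E3 :=
  derivWithin (fun t => f (p.1, t)) {t | (p.1, t) ∈ D} p.2

/-- `f` has a partial derivative in `u` at every point of `D`. -/
def HasPartialU (D : Set (ℝ × ℝ)) (f : ℝ × ℝ → E3) : Prop :=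
  ∀ p ∈ D, DifferentiableWithinAt ℝ (fun t => f (t, p.2)) {t | (t, p.2) ∈ D} p.1

/-- `f` has a partial derivative in `v` at every point of `D`. -/
def HasPartialV (D : Set (ℝ × ℝ)) (f : ℝ × ℝ → E3) : Prop :=
  ∀ p ∈ D, DifferentiableWithinAt ℝ (fun t => f (p.1, t)) {t | (p.1, t) ∈ D} p.2

/-- `f` is `C^{1M}` on `D`: it is `C¹` and has continuous mixed derivatives `f_{uv} = f_{vu}`. -/
structure IsC1M (D : Set (ℝ × ℝ)) (f : ℝ × ℝ → E3) : Prop where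
  continuousOn : ContinuousOn f D
  hasPartialU : HasPartialU D f
  hasPartialV : HasPartialV D f
  continuousOn_partialU : ContinuousOn (partialU D f) D
  continuousOn_partialV : ContinuousOn (partialV D f) D
  hasPartialV_partialU : HasPartialV D (partialU D f)
  hasPartialU_partialV : HasPartialU D (partialV D f)
  mixed_eq : ∀ p ∈ D, partialV D (partialU D f) p = partialU D (partialV D f) p
  continuousOn_mixed : ContinuousOn (partialV D (partialU D f)) D

/-- `N : D → S²` is weakly (Lorentz) harmonic: it is `C^{1M}`, `N_u` and `N_v` do not vanish, and
`N_{uv} = N_{vu} = ν N` with a continuous function `ν`. -/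
structure IsWeaklyHarmonic (D : Set (ℝ × ℝ)) (N : ℝ × ℝ → E3) : Prop where
  c1m : IsC1M D N
  norm_eq_one : ∀ p ∈ D, ‖N p‖ = 1
  partialU_pos : ∀ p ∈ D, 0 < ⟪partialU D N p, partialU D N p⟫
  partialV_pos : ∀ p ∈ D, 0 < ⟪partialV D N p, partialV D N p⟫
  moutard : ∃ ν : ℝ × ℝ → ℝ, ContinuousOn ν D ∧
    ∀ p ∈ D, partialV D (partialU D N) p = ν p • N p ∧ partialU D (partialV D N) p = ν p • N p

/-- `r : D → ℝ³` is a (`C^{1M}`) PS-front with normal field `N`: the normal field is weakly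
harmonic, and `r` is a weakly regular `C^{1M}` solution of the Lelieuvre equations
`r_u = N_u × N`, `r_v = - N_v × N`. -/
structure IsPSFrontWith (D : Set (ℝ × ℝ)) (r N : ℝ × ℝ → E3) : Prop where
  harmonic : IsWeaklyHarmonic D N
  c1m : IsC1M D r
  lelieuvreU : ∀ p ∈ D, partialU D r p = cross (partialU D N p) (N p)
  lelieuvreV : ∀ p ∈ D, partialV D r p = -cross (partialV D N p) (N p)
  regularU : ∀ p ∈ D, 0 < ⟪partialU D r p, partialU D r p⟫
  regularV : ∀ p ∈ D, 0 < ⟪partialV D r p, partialV D r p⟫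

/-- `r : D → ℝ³` is a PS-front. -/
def IsPSFront (D : Set (ℝ × ℝ)) (r : ℝ × ℝ → E3) : Prop :=
  ∃ N : ℝ × ℝ → E3, IsPSFrontWith D r N

/-- The closed rectangle `[0, a] × [0, b]`. -/
def rect (a b : ℝ) : Set (ℝ × ℝ) := Set.Icc 0 a ×ˢ Set.Icc 0 b

/-- The boundary data of an Amsler patch on `[0, a] × [0, b]` at the point `z` with normal `n`:
the two sides through `(0, 0)` are straight segments leaving `z` with unit directions `eᵤ`, `eᵥ`
orthogonal to `n`. -/
structure HasAmslerData (a b : ℝ) (r N : ℝ × ℝ → E3) (z n eᵤ eᵥ : E3) : Prop where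
  norm_u : ‖eᵤ‖ = 1
  norm_v : ‖eᵥ‖ = 1
  inner_u : ⟪eᵤ, n⟫ = 0
  inner_v : ⟪eᵥ, n⟫ = 0
  normal_u : ∀ u ∈ Set.Icc 0 a, N (u, 0) = Real.cos u • n + Real.sin u • cross n eᵤ
  normal_v : ∀ v ∈ Set.Icc 0 b, N (0, v) = Real.cos v • n - Real.sin v • cross n eᵥ
  curve_u : ∀ u ∈ Set.Icc 0 a, r (u, 0) = z + u • eᵤ
  curve_v : ∀ v ∈ Set.Icc 0 b, r (0, v) = z + v • eᵥ

/-! ### Asymptotic complexes and branched PS-fronts -/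

/-- A family of quadrilaterals in a space `A`: each face is parametrized by a rectangle
`[0, ulen k] × [0, vlen k]`. The parametrization is the inverse of the bijection from the face to
the rectangle. -/
structure QuadFamily (A ι : Type) where
  ulen : ι → ℝ
  vlen : ι → ℝ
  chart : ∀ k, rect (ulen k) (vlen k) → A

namespace QuadFamily

variable {A ι : Type} (Q : QuadFamily A ι)

/-- The (closed) face with index `k`. -/
def face (k : ι) : Set A := Set.range (Q.chart k)

/-- The faces `k` and `l` meet in a single point, which is a vertex of both. -/
def MeetAtVertex (k l : ι) : Prop :=
  ∃ (p : rect (Q.ulen k) (Q.vlen k)) (q : rect (Q.ulen l) (Q.vlen l)),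
    (p.1.1 = 0 ∨ p.1.1 = Q.ulen k) ∧ (p.1.2 = 0 ∨ p.1.2 = Q.vlen k) ∧
    (q.1.1 = 0 ∨ q.1.1 = Q.ulen l) ∧ (q.1.2 = 0 ∨ q.1.2 = Q.vlen l) ∧
    Q.chart k p = Q.chart l q ∧ Q.face k ∩ Q.face l = {Q.chart k p}

/-- The faces `k` and `l` meet in a closed `u`-edge of both, of the same length, and the attaching
map is `u ↦ u` or `u ↦ ulen k - u`. -/
def MeetAtUEdge (k l : ι) : Prop :=
  Q.ulen k = Q.ulen l ∧ ∃ a b : ℝ, (a = 0 ∨ a = Q.vlen k) ∧ (b = 0 ∨ b = Q.vlen l) ∧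
    ((∀ (p : rect (Q.ulen k) (Q.vlen k)) (q : rect (Q.ulen l) (Q.vlen l)),
        p.1.2 = a → q.1.2 = b → q.1.1 = p.1.1 → Q.chart k p = Q.chart l q) ∨
      (∀ (p : rect (Q.ulen k) (Q.vlen k)) (q : rect (Q.ulen l) (Q.vlen l)),
        p.1.2 = a → q.1.2 = b → q.1.1 = Q.ulen k - p.1.1 → Q.chart k p = Q.chart l q)) ∧
    Q.face k ∩ Q.face l = Q.chart k '' {p | p.1.2 = a}

/-- The faces `k` and `l` meet in a closed `v`-edge of both, of the same length, and the attaching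
map is `v ↦ v` or `v ↦ vlen k - v`. -/
def MeetAtVEdge (k l : ι) : Prop :=
  Q.vlen k = Q.vlen l ∧ ∃ a b : ℝ, (a = 0 ∨ a = Q.ulen k) ∧ (b = 0 ∨ b = Q.ulen l) ∧
    ((∀ (p : rect (Q.ulen k) (Q.vlen k)) (q : rect (Q.ulen l) (Q.vlen l)),
        p.1.1 = a → q.1.1 = b → q.1.2 = p.1.2 → Q.chart k p = Q.chart l q) ∨
      (∀ (p : rect (Q.ulen k) (Q.vlen k)) (q : rect (Q.ulen l) (Q.vlen l)),
        p.1.1 = a → q.1.1 = b → q.1.2 = Q.vlen k - p.1.2 → Q.chart k p = Q.chart l q)) ∧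
    Q.face k ∩ Q.face l = Q.chart k '' {p | p.1.1 = a}

/-- A finite family of quadrilaterals is an asymptotic complex on `A`: it is a strongly regular
decomposition of the surface `A` into quads, in which edges are glued to edges of the same type
(`u` or `v`) and of the same length by isometries. By the standing convention the surface is
compact, simply connected and planar, in other words `A` is a closed disk. -/
structure IsAsymptoticComplex [TopologicalSpace A] [Finite ι] : Prop where
  ulen_pos : ∀ k, 0 < Q.ulen k
  vlen_pos : ∀ k, 0 < Q.vlen k
  disk : Nonempty (A ≃ₜ Metric.closedBall (0 : Plane) 1)
  isEmbedding : ∀ k, Topology.IsEmbedding (Q.chart k)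
  cover : ⋃ k, Q.face k = Set.univ
  inter : ∀ k l, k ≠ l → Disjoint (Q.face k) (Q.face l) ∨
    Q.MeetAtVertex k l ∨ Q.MeetAtUEdge k l ∨ Q.MeetAtVEdge k l

/-- `ψ : A → ℝ³` is a branched PS-front: `A` is an asymptotic complex, and in the asymptotic
coordinates of each face `ψ` is continuous on the closed rectangle and a PS-front on its
interior. -/
def IsBranchedPSFront [TopologicalSpace A] [Finite ι] (ψ : A → E3) : Prop :=
  Q.IsAsymptoticComplex ∧ ∀ k, ∃ r : ℝ × ℝ → E3,
    (∀ p : rect (Q.ulen k) (Q.vlen k), ψ (Q.chart k p) = r p) ∧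
    ContinuousOn r (rect (Q.ulen k) (Q.vlen k)) ∧
    IsPSFront (interior (rect (Q.ulen k) (Q.vlen k))) r

end QuadFamily

/-! ### Stars, saddles and branch points -/

/-- The angles `α 0, …, α (2m-1)` and the lengths `l 0, …, l (2m) = l 0` define an `m`-star. -/
structure IsStar (m : ℕ) (α l : ℕ → ℝ) : Prop where
  angle_pos : ∀ i < 2 * m, 0 < α i
  angle_lt : ∀ i < 2 * m, α i < Real.pi
  angle_sum : ∑ i ∈ Finset.range (2 * m), α i = 2 * Real.pi
  length_pos : ∀ i ≤ 2 * m, 0 < l i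
  length_closed : l (2 * m) = l 0

/-- The angle `β i = α 0 + ⋯ + α (i-1)` of the ray with index `i` of a star. -/
noncomputable def rayAngle (α : ℕ → ℝ) (i : ℕ) : ℝ := ∑ j ∈ Finset.range i, α j

/-- The unit vector `s i = (cos (β i), sin (β i))` of the ray with index `i` of a star. -/
noncomputable def rayDir (α : ℕ → ℝ) (i : ℕ) : Plane :=
  !₂[Real.cos (rayAngle α i), Real.sin (rayAngle α i)]

/-- The point of the sector between the rays `i` and `i + 1` that has asymptotic coordinates
`(u, v)`; the rays of even index are `u`-rays and those of odd index are `v`-rays. -/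
noncomputable def sectorPoint (α : ℕ → ℝ) (i : ℕ) (p : ℝ × ℝ) : Plane :=
  if Even i then p.1 • rayDir α i + p.2 • rayDir α (i + 1)
  else p.1 • rayDir α (i + 1) + p.2 • rayDir α i

/-- The range of the asymptotic coordinates in the sector between the rays `i` and `i + 1`. -/
def sectorDomain (l : ℕ → ℝ) (i : ℕ) : Set (ℝ × ℝ) :=
  if Even i then Set.Ico 0 (l i) ×ˢ Set.Ico 0 (l (i + 1))
  else Set.Ico 0 (l (i + 1)) ×ˢ Set.Ico 0 (l i)

/-- The `m`-star `T`, a union of `2m` sectors around the origin of the plane. -/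
def star (m : ℕ) (α l : ℕ → ℝ) : Set Plane :=
  ⋃ i ∈ Finset.range (2 * m), sectorPoint α i '' sectorDomain l i

section Saddle

variable {A : Type} [TopologicalSpace A]

/-- `τ` is a homeomorphism from an open neighbourhood of `p` onto an `m`-star which takes `p` to
its centre, and in the asymptotic coordinates of each of the `2m` sectors `ψ` is a PS-front with
normal field `N` (up to the sides of the sector). -/
structure IsStarChart (ψ N : A → E3) (p : A) (m : ℕ) (α l : ℕ → ℝ)
    (τ : OpenPartialHomeomorph A Plane) : Prop where
  isStar : IsStar m α l
  mem_source : p ∈ τ.source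
  map_center : τ p = 0
  target_eq : τ.target = star m α l
  isPSFrontWith : ∀ i < 2 * m, IsPSFrontWith (sectorDomain l i)
    (fun x => ψ (τ.symm (sectorPoint α i x))) (fun x => N (τ.symm (sectorPoint α i x)))

/-- The asymptotic curves of `ψ` have at `p` the structure of a saddle of order `m`: there are `2m`
sectors around `p`, separated by `2m` asymptotic rays, on each of which `ψ` is a PS-front, with
common normal field `N`. This makes sense also where `ψ` is not an immersion. The point `p` is a
branch point if `m ≠ 2`. -/
def HasSaddleStructureAt (ψ N : A → E3) (p : A) (m : ℕ) : Prop :=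
  ∃ (α l : ℕ → ℝ) (τ : OpenPartialHomeomorph A Plane), IsStarChart ψ N p m α l τ

/-- Near `p` the map `ψ` is a homeomorphism onto the graph of a `C^{1,1}` function `w` over an open
piece of the plane through `ψ p` spanned by `e₁, e₂`, and `N` is the upward normal of the graph. -/
def IsLocalC11Graph (ψ N : A → E3) (p : A) (e₁ e₂ : E3) : Prop :=
  ∃ (Φ : OpenPartialHomeomorph A Plane) (w : Plane → ℝ),
    p ∈ Φ.source ∧ DifferentiableOn ℝ w Φ.target ∧
    (∃ K : NNReal, LipschitzOnWith K (fderiv ℝ w) Φ.target) ∧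
    ∀ q ∈ Φ.source,
      ψ q = ψ p + (Φ q 0) • e₁ + (Φ q 1) • e₂ + w (Φ q) • N p ∧
      ∃ c : ℝ, 0 < c ∧ N q = c • (N p - (fderiv ℝ w (Φ q) !₂[1, 0]) • e₁
        - (fderiv ℝ w (Φ q) !₂[0, 1]) • e₂)

/-- Near `p` the map `ψ` is an immersed `C^{1,1}` saddle of order `m` with normal field `N`: there
is a star chart whose `2m` rays correspond to the asymptotic curves of `ψ` through `p`, the
tangent directions of which are the directions of the rays of the star (in an orthonormal basis
`e₁, e₂` of the tangent plane), and the surface is a `C^{1,1}` graph over the tangent plane. -/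
def IsImmersedSaddleAt (ψ N : A → E3) (p : A) (m : ℕ) : Prop :=
  ∃ (α l : ℕ → ℝ) (τ : OpenPartialHomeomorph A Plane) (e₁ e₂ : E3),
    IsStarChart ψ N p m α l τ ∧ Orthonormal ℝ ![e₁, e₂, N p] ∧
    (∀ i < 2 * m, ∃ c : ℝ, 0 < c ∧
      HasDerivWithinAt (fun t : ℝ => ψ (τ.symm (t • rayDir α i)))
        (c • (Real.cos (rayAngle α i) • e₁ + Real.sin (rayAngle α i) • e₂)) (Set.Ici 0) 0) ∧
    IsLocalC11Graph ψ N p e₁ e₂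

end Saddle

/-! ### Surgery -/

/-- The parameters of a surgery: a rectangle `[0, umax] × [0, vmax]`, a point `(us, vs)` in its
interior, and the lengths `ut, vt > 0` of the two new asymptotic curves. -/
structure SurgeryData where
  umax : ℝ
  vmax : ℝ
  us : ℝ
  vs : ℝ
  ut : ℝ
  vt : ℝ
  us_pos : 0 < us
  us_lt : us < umax
  vs_pos : 0 < vs
  vs_lt : vs < vmax
  ut_pos : 0 < ut
  vt_pos : 0 < vt

namespace SurgeryData

variable (S : SurgeryData)

/-- The rectangle `Ω₀ = [0, umax] × [0, vmax]`. -/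
def Ω₀ : Set (ℝ × ℝ) := rect S.umax S.vmax

/-- The point `(us, vs)`. -/
def pt : ℝ × ℝ := (S.us, S.vs)

/-- The L-shaped domain that is left of `Ω₀` when the quadrant above and to the right of
`(us, vs)` is removed; it is taken closed, since the new patches are glued to the two sides of the
cut. -/
def Ωs : Set (ℝ × ℝ) := {p | p ∈ S.Ω₀ ∧ (p.1 ≤ S.us ∨ p.2 ≤ S.vs)}

/-- The rectangle `Ω₁ = [0, umax - us] × [0, vt]`. -/
def Ω₁ : Set (ℝ × ℝ) := rect (S.umax - S.us) S.vt

/-- The rectangle `Ω₂ = [0, ut] × [0, vt]`. -/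
def Ω₂ : Set (ℝ × ℝ) := rect S.ut S.vt

/-- The rectangle `Ω₃ = [0, ut] × [0, vmax - vs]`. -/
def Ω₃ : Set (ℝ × ℝ) := rect S.ut (S.vmax - S.vs)

/-- The disjoint union of the four pieces. -/
abbrev Pieces : Type := S.Ωs ⊕ S.Ω₁ ⊕ S.Ω₂ ⊕ S.Ω₃

/-- The attaching maps:
`(u, 0) ∈ Ω₁ ↦ (us + u, vs) ∈ Ωs`, `(u, 0) ∈ Ω₃ ↦ (u, 0) ∈ Ω₂`,
`(0, v) ∈ Ω₃ ↦ (us, vs + v) ∈ Ωs`, `(0, v) ∈ Ω₁ ↦ (0, v) ∈ Ω₂`. -/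
inductive Attach : S.Pieces → S.Pieces → Prop
  | chi₁ (p : S.Ω₁) (q : S.Ωs) (hp : p.1.2 = 0) (hq : q.1 = (S.us + p.1.1, S.vs)) :
      Attach (Sum.inr (Sum.inl p)) (Sum.inl q)
  | chi₂ (p : S.Ω₃) (q : S.Ω₂) (hp : p.1.2 = 0) (hq : q.1 = (p.1.1, 0)) :
      Attach (Sum.inr (Sum.inr (Sum.inr p))) (Sum.inr (Sum.inr (Sum.inl q)))
  | chi₃ (p : S.Ω₃) (q : S.Ωs) (hp : p.1.1 = 0) (hq : q.1 = (S.us, S.vs + p.1.2)) :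
      Attach (Sum.inr (Sum.inr (Sum.inr p))) (Sum.inl q)
  | chi₄ (p : S.Ω₁) (q : S.Ω₂) (hp : p.1.1 = 0) (hq : q.1 = (0, p.1.2)) :
      Attach (Sum.inr (Sum.inl p)) (Sum.inr (Sum.inr (Sum.inl q)))

/-- The space obtained by gluing the four pieces with the attaching maps, with the quotient
topology. -/
def Glued : Type := Quot S.Attach

instance : TopologicalSpace S.Glued := inferInstanceAs (TopologicalSpace (Quot S.Attach))

/-- The inclusion of `Ωs` into the glued space. -/
def incs (p : S.Ωs) : S.Glued := Quot.mk _ (Sum.inl p)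

/-- The inclusion of `Ω₁` into the glued space. -/
def inc₁ (p : S.Ω₁) : S.Glued := Quot.mk _ (Sum.inr (Sum.inl p))

/-- The inclusion of `Ω₂` into the glued space. -/
def inc₂ (p : S.Ω₂) : S.Glued := Quot.mk _ (Sum.inr (Sum.inr (Sum.inl p)))

/-- The inclusion of `Ω₃` into the glued space. -/
def inc₃ (p : S.Ω₃) : S.Glued := Quot.mk _ (Sum.inr (Sum.inr (Sum.inr p)))

theorem pt_mem : S.pt ∈ S.Ωs :=
  ⟨⟨⟨S.us_pos.le, S.us_lt.le⟩, ⟨S.vs_pos.le, S.vs_lt.le⟩⟩, Or.inl le_rfl⟩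

/-- The point `(us, vs)` in the glued space. -/
def center : S.Glued := S.incs ⟨S.pt, S.pt_mem⟩

theorem mem_lowerLeft {p : ℝ × ℝ} (h : p ∈ rect S.us S.vs) : p ∈ S.Ωs :=
  ⟨⟨⟨h.1.1, h.1.2.trans S.us_lt.le⟩, ⟨h.2.1, h.2.2.trans S.vs_lt.le⟩⟩, Or.inl h.1.2⟩

theorem mem_lowerRight {p : ℝ × ℝ} (h : p ∈ rect (S.umax - S.us) S.vs) :
    (S.us + p.1, p.2) ∈ S.Ωs :=
  ⟨⟨⟨add_nonneg S.us_pos.le h.1.1, by have := h.1.2; dsimp only at *; linarith⟩,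
    ⟨h.2.1, h.2.2.trans S.vs_lt.le⟩⟩, Or.inr h.2.2⟩

theorem mem_upperLeft {p : ℝ × ℝ} (h : p ∈ rect S.us (S.vmax - S.vs)) :
    (p.1, S.vs + p.2) ∈ S.Ωs :=
  ⟨⟨⟨h.1.1, h.1.2.trans S.us_lt.le⟩,
    ⟨add_nonneg S.vs_pos.le h.2.1, by have := h.2.2; dsimp only at *; linarith⟩⟩, Or.inl h.1.2⟩

/-- The six faces of the glued space: the three rectangles into which the lines `u = us` and
`v = vs` cut `Ωs`, and the patches `Ω₁`, `Ω₂`, `Ω₃`. -/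
def faces : QuadFamily S.Glued (Fin 6) where
  ulen := ![S.us, S.umax - S.us, S.umax - S.us, S.ut, S.ut, S.us]
  vlen := ![S.vs, S.vs, S.vt, S.vt, S.vmax - S.vs, S.vmax - S.vs]
  chart := fun k => match k with
    | 0 => fun p => S.incs ⟨p.1, S.mem_lowerLeft p.2⟩
    | 1 => fun p => S.incs ⟨(S.us + p.1.1, p.1.2), S.mem_lowerRight p.2⟩
    | 2 => fun p => S.inc₁ p
    | 3 => fun p => S.inc₂ p
    | 4 => fun p => S.inc₃ p
    | 5 => fun p => S.incs ⟨(p.1.1, S.vs + p.1.2), S.mem_upperLeft p.2⟩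

end SurgeryData

end PSF

namespace PSF

open Set Filter Topology
open scoped RealInnerProductSpace

section Goursat

variable {E F : Type*} [NormedAddCommGroup E] [NormedSpace ℝ E]
  [NormedAddCommGroup F] [NormedSpace ℝ F]

theorem norm_integral_le_of_exp_bound {f : ℝ → E} {b C k : ℝ} (hk : 0 < k) (hb : 0 ≤ b)
    (hf : ∀ t ∈ Icc 0 b, ‖f t‖ ≤ C * Real.exp (k * t)) (hC : 0 ≤ C) :
    ‖∫ t in (0 : ℝ)..b, f t‖ ≤ C / k * Real.exp (k * b) := by
  have h1 : ‖∫ t in (0 : ℝ)..b, f t‖ ≤ ∫ t in (0 : ℝ)..b, C * Real.exp (k * t) := by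
    refine intervalIntegral.norm_integral_le_of_norm_le hb ?_ ?_
    · exact Eventually.of_forall fun t ht => hf t ⟨ht.1.le, ht.2⟩
    · exact Continuous.intervalIntegrable (by fun_prop) _ _
  have h2 : ∫ t in (0 : ℝ)..b, C * Real.exp (k * t)
      = C / k * Real.exp (k * b) - C / k * Real.exp (k * 0) := by
    refine intervalIntegral.integral_eq_sub_of_hasDerivAt
      (f := fun t => C / k * Real.exp (k * t)) (fun t _ => ?_)
      (Continuous.intervalIntegrable (by fun_prop) _ _)
    have := (((hasDerivAt_id t).const_mul k).exp).const_mul (C / k)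
    exact this.congr_deriv (by simp only [id]; field_simp)
  rw [h2] at h1
  have : 0 ≤ C / k * Real.exp (k * 0) := by positivity
  linarith

/-- Global solvability of the Goursat problem `x_v = f(p, x, y)`, `y_u = g(p, x, y)` with `x` given
on `v = 0` and `y` given on `u = 0`, for Lipschitz right-hand sides. -/
theorem exists_goursat_solution [CompleteSpace E] [CompleteSpace F] {a b K : ℝ}
    (ha : 0 ≤ a) (hb : 0 ≤ b) (hK : 0 ≤ K)
    {f : ℝ × ℝ → E × F → E} {g : ℝ × ℝ → E × F → F}
    (hf : Continuous fun q : (ℝ × ℝ) × (E × F) => f q.1 q.2)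
    (hg : Continuous fun q : (ℝ × ℝ) × (E × F) => g q.1 q.2)
    (hfK : ∀ p ∈ rect a b, ∀ z z', ‖f p z - f p z'‖ ≤ K * ‖z - z'‖)
    (hgK : ∀ p ∈ rect a b, ∀ z z', ‖g p z - g p z'‖ ≤ K * ‖z - z'‖)
    {x₀ : ℝ → E} {y₀ : ℝ → F} (hx₀ : Continuous x₀) (hy₀ : Continuous y₀) :
    ∃ (x : ℝ × ℝ → E) (y : ℝ × ℝ → F), Continuous x ∧ Continuous y ∧
      (∀ u ∈ Icc 0 a, x (u, 0) = x₀ u) ∧ (∀ v ∈ Icc 0 b, y (0, v) = y₀ v) ∧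
      (∀ p ∈ rect a b,
        HasDerivWithinAt (fun t => x (p.1, t)) (f p (x p, y p)) (Icc 0 b) p.2) ∧
      (∀ p ∈ rect a b,
        HasDerivWithinAt (fun t => y (t, p.2)) (g p (x p, y p)) (Icc 0 a) p.1) := by
  set k : ℝ := 2 * K + 1 with hk
  have hk0 : 0 < k := by positivity
  let ext (z : C(Icc 0 a × Icc 0 b, E × F)) (p : ℝ × ℝ) : E × F :=
    Real.exp (k * (p.1 + p.2)) • z (projIcc 0 a ha p.1, projIcc 0 b hb p.2)
  have hext (z) : Continuous (ext z) := by
    have : Continuous (projIcc 0 a ha) := continuous_projIcc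
    have : Continuous (projIcc 0 b hb) := continuous_projIcc
    fun_prop
  let W (z : C(Icc 0 a × Icc 0 b, E × F)) (p : ℝ × ℝ) : E × F :=
    (x₀ p.1 + ∫ t in (0 : ℝ)..p.2, f (p.1, t) (ext z (p.1, t)),
      y₀ p.2 + ∫ s in (0 : ℝ)..p.1, g (s, p.2) (ext z (s, p.2)))
  have hW (z) : Continuous (W z) := by
    have he := hext z
    refine Continuous.prodMk (.add (by fun_prop) ?_) (.add (by fun_prop) ?_)
    · refine intervalIntegral.continuous_parametric_intervalIntegral_of_continuous
        (f := fun (p : ℝ × ℝ) t => f (p.1, t) (ext z (p.1, t))) ?_ continuous_snd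
      exact hf.comp (f := fun q : (ℝ × ℝ) × ℝ => ((q.1.1, q.2), ext z (q.1.1, q.2))) (by fun_prop)
    · refine intervalIntegral.continuous_parametric_intervalIntegral_of_continuous
        (f := fun (p : ℝ × ℝ) s => g (s, p.2) (ext z (s, p.2))) ?_ continuous_fst
      exact hg.comp (f := fun q : (ℝ × ℝ) × ℝ => ((q.2, q.1.2), ext z (q.2, q.1.2))) (by fun_prop)
  let Φ (z : C(Icc 0 a × Icc 0 b, E × F)) : C(Icc 0 a × Icc 0 b, E × F) :=
    ⟨fun p => Real.exp (-(k * (p.1 + p.2))) • W z (p.1, p.2), by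
      have := hW z
      fun_prop⟩
  have hdiff (z z' : C(Icc 0 a × Icc 0 b, E × F)) (p : ℝ × ℝ) :
      ‖ext z p - ext z' p‖ ≤ Real.exp (k * (p.1 + p.2)) * dist z z' := by
    simp only [ext, ← smul_sub, norm_smul, Real.norm_eq_abs, Real.abs_exp]
    gcongr
    rw [← dist_eq_norm]
    exact ContinuousMap.dist_apply_le_dist _
  have hbound (z z' : C(Icc 0 a × Icc 0 b, E × F)) (p : ℝ × ℝ) (hp : p ∈ rect a b) :
      ‖W z p - W z' p‖ ≤ 1 / 2 * dist z z' * Real.exp (k * (p.1 + p.2)) := by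
    have hKk : K / k ≤ 1 / 2 := by
      rw [div_le_div_iff₀ hk0 two_pos]; linarith
    obtain ⟨⟨hu0, hua⟩, ⟨hv0, hvb⟩⟩ := hp
    have he := hext z
    have he' := hext z'
    refine max_le ?_ ?_
    · have h1 : (W z p - W z' p).1 = ∫ t in (0 : ℝ)..p.2,
          (f (p.1, t) (ext z (p.1, t)) - f (p.1, t) (ext z' (p.1, t))) := by
        rw [intervalIntegral.integral_sub]
        · simp [W]
        · exact (hf.comp (f := fun t : ℝ => ((p.1, t), ext z (p.1, t)))
            (by fun_prop)).intervalIntegrable _ _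
        · exact (hf.comp (f := fun t : ℝ => ((p.1, t), ext z' (p.1, t)))
            (by fun_prop)).intervalIntegrable _ _
      rw [h1]
      refine (norm_integral_le_of_exp_bound (C := K * (Real.exp (k * p.1) * dist z z')) hk0 hv0
        (fun t ht => ?_) (by positivity)).trans ?_
      · refine (hfK (p.1, t) ⟨⟨hu0, hua⟩, ⟨ht.1, ht.2.trans hvb⟩⟩ _ _).trans ?_
        rw [mul_assoc]
        gcongr
        refine (hdiff z z' _).trans_eq ?_
        rw [mul_add, Real.exp_add]; ring
      · calc _ = K / k * (dist z z' * Real.exp (k * (p.1 + p.2))) := by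
              rw [mul_add, Real.exp_add]; ring
          _ ≤ 1 / 2 * (dist z z' * Real.exp (k * (p.1 + p.2))) := by gcongr
          _ = _ := by ring
    · have h1 : (W z p - W z' p).2 = ∫ t in (0 : ℝ)..p.1,
          (g (t, p.2) (ext z (t, p.2)) - g (t, p.2) (ext z' (t, p.2))) := by
        rw [intervalIntegral.integral_sub]
        · simp [W]
        · exact (hg.comp (f := fun t : ℝ => ((t, p.2), ext z (t, p.2)))
            (by fun_prop)).intervalIntegrable _ _
        · exact (hg.comp (f := fun t : ℝ => ((t, p.2), ext z' (t, p.2)))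
            (by fun_prop)).intervalIntegrable _ _
      rw [h1]
      refine (norm_integral_le_of_exp_bound (C := K * (Real.exp (k * p.2) * dist z z')) hk0 hu0
        (fun t ht => ?_) (by positivity)).trans ?_
      · refine (hgK (t, p.2) ⟨⟨ht.1, ht.2.trans hua⟩, ⟨hv0, hvb⟩⟩ _ _).trans ?_
        rw [mul_assoc]
        gcongr
        refine (hdiff z z' _).trans_eq ?_
        rw [mul_add, Real.exp_add]; ring
      · calc _ = K / k * (dist z z' * Real.exp (k * (p.1 + p.2))) := by
              rw [mul_add, Real.exp_add]; ring
          _ ≤ 1 / 2 * (dist z z' * Real.exp (k * (p.1 + p.2))) := by gcongr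
          _ = _ := by ring
  have hΦ : ContractingWith (1 / 2 : NNReal) Φ := by
    refine ⟨by norm_num [← NNReal.coe_lt_coe], LipschitzWith.of_dist_le_mul fun z z' => ?_⟩
    rw [ContinuousMap.dist_le (by positivity)]
    intro p
    simp only [Φ, ContinuousMap.coe_mk]
    rw [dist_eq_norm, ← smul_sub, norm_smul, Real.norm_eq_abs, Real.abs_exp]
    have := hbound z z' (p.1, p.2) ⟨p.1.2, p.2.2⟩
    calc _ ≤ Real.exp (-(k * (p.1 + p.2))) *
          (1 / 2 * dist z z' * Real.exp (k * (p.1 + p.2))) := by gcongr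
      _ = 1 / 2 * dist z z' := by
          rw [Real.exp_neg]; field_simp
      _ = _ := by simp
  have : Nonempty C(Icc 0 a × Icc 0 b, E × F) := ⟨0⟩
  obtain ⟨z, hz⟩ : ∃ z, Φ z = z := ⟨_, hΦ.fixedPoint_isFixedPt⟩
  have hzW (p) (hp : p ∈ rect a b) : ext z p = W z p := by
    simp only [ext]
    rw [projIcc_of_mem ha hp.1, projIcc_of_mem hb hp.2]
    conv_lhs => rw [← hz]
    simp only [Φ, ContinuousMap.coe_mk]
    rw [smul_smul, ← Real.exp_add, add_neg_cancel, Real.exp_zero, one_smul]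
  have he := hext z
  refine ⟨fun p => (ext z p).1, fun p => (ext z p).2, by fun_prop, by fun_prop, ?_, ?_, ?_, ?_⟩
  · intro u hu
    simp only
    rw [hzW _ ⟨hu, le_rfl, hb⟩]
    simp [W]
  · intro v hv
    simp only
    rw [hzW _ ⟨⟨le_rfl, ha⟩, hv⟩]
    simp [W]
  · intro p hp
    have hc : Continuous fun t => f (p.1, t) (ext z (p.1, t)) :=
      hf.comp (f := fun t : ℝ => ((p.1, t), ext z (p.1, t))) (by fun_prop)
    have := ((hc.integral_hasStrictDerivAt 0 p.2).hasDerivAt.const_add (x₀ p.1)).hasDerivWithinAt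
      (s := Icc 0 b)
    refine this.congr (fun t ht => ?_) ?_
    · exact congrArg Prod.fst (hzW (p.1, t) ⟨hp.1, ht⟩)
    · exact congrArg Prod.fst (hzW p hp)
  · intro p hp
    have hc : Continuous fun t => g (t, p.2) (ext z (t, p.2)) :=
      hg.comp (f := fun t : ℝ => ((t, p.2), ext z (t, p.2))) (by fun_prop)
    have := ((hc.integral_hasStrictDerivAt 0 p.1).hasDerivAt.const_add (y₀ p.2)).hasDerivWithinAt
      (s := Icc 0 a)
    refine this.congr (fun t ht => ?_) ?_
    · exact congrArg Prod.snd (hzW (t, p.2) ⟨ht, hp.2⟩)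
    · exact congrArg Prod.snd (hzW p hp)

/-- Uniqueness for homogeneous Goursat problems. -/
theorem goursat_eq_zero {a b K : ℝ} (hK : 0 ≤ K)
    {x x' : ℝ × ℝ → E} {y y' : ℝ × ℝ → F}
    (hx : ContinuousOn x (rect a b)) (hy : ContinuousOn y (rect a b))
    (hx0 : ∀ u ∈ Icc 0 a, x (u, 0) = 0) (hy0 : ∀ v ∈ Icc 0 b, y (0, v) = 0)
    (hxd : ∀ p ∈ rect a b, HasDerivWithinAt (fun t => x (p.1, t)) (x' p) (Icc 0 b) p.2)
    (hyd : ∀ p ∈ rect a b, HasDerivWithinAt (fun t => y (t, p.2)) (y' p) (Icc 0 a) p.1)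
    (hxK : ∀ p ∈ rect a b, ‖x' p‖ ≤ K * (‖x p‖ + ‖y p‖))
    (hyK : ∀ p ∈ rect a b, ‖y' p‖ ≤ K * (‖x p‖ + ‖y p‖)) :
    ∀ p ∈ rect a b, x p = 0 ∧ y p = 0 := by
  rcases (rect a b).eq_empty_or_nonempty with he | hne
  · simp [he]
  set k : ℝ := 4 * K + 1 with hk
  have hcpt : IsCompact (rect a b) := isCompact_Icc.prod isCompact_Icc
  obtain ⟨q, hq, hmax⟩ := hcpt.exists_isMaxOn hne
    (f := fun p => Real.exp (-(k * (p.1 + p.2))) * (‖x p‖ + ‖y p‖)) (by fun_prop)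
  set M := Real.exp (-(k * (q.1 + q.2))) * (‖x q‖ + ‖y q‖) with hM
  have hM0 : 0 ≤ M := by positivity
  have hle (p) (hp : p ∈ rect a b) : ‖x p‖ + ‖y p‖ ≤ M * Real.exp (k * (p.1 + p.2)) := by
    have := hmax hp
    simp only [mem_ofPred_eq] at this
    rw [Real.exp_neg, inv_mul_le_iff₀ (Real.exp_pos _)] at this
    linarith
  have hexp (s c : ℝ) : HasDerivAt (fun t => M / 4 * Real.exp (k * (s + t)))
      (k / 4 * (M * Real.exp (k * (s + c)))) c := by
    have := ((((hasDerivAt_id c).const_add s).const_mul k).exp).const_mul (M / 4)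
    exact this.congr_deriv (by simp only [id]; ring)
  have hKk : K ≤ k / 4 := by rw [hk]; linarith
  have h1 (p) (hp : p ∈ rect a b) : ‖x p‖ ≤ M / 4 * Real.exp (k * (p.1 + p.2)) := by
    refine image_norm_le_of_norm_deriv_right_le_deriv_boundary (a := 0) (b := b)
      (f := fun t => x (p.1, t)) (f' := fun t => x' (p.1, t))
      (fun t ht => (hxd (p.1, t) ⟨hp.1, ht⟩).continuousWithinAt)
      (fun t ht => ((hxd (p.1, t) ⟨hp.1, Ico_subset_Icc_self ht⟩).mono_of_mem_nhdsWithin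
        (Icc_mem_nhdsGE_of_mem ht))) ?_ (hexp p.1) ?_ hp.2
    · rw [hx0 _ hp.1, norm_zero]; positivity
    · intro t ht
      have hpt : (p.1, t) ∈ rect a b := ⟨hp.1, Ico_subset_Icc_self ht⟩
      exact (hxK _ hpt).trans (mul_le_mul hKk (hle _ hpt) (by positivity) (by positivity))
  have h2 (p) (hp : p ∈ rect a b) : ‖y p‖ ≤ M / 4 * Real.exp (k * (p.2 + p.1)) := by
    refine image_norm_le_of_norm_deriv_right_le_deriv_boundary (a := 0) (b := a)
      (f := fun t => y (t, p.2)) (f' := fun t => y' (t, p.2))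
      (fun t ht => (hyd (t, p.2) ⟨ht, hp.2⟩).continuousWithinAt)
      (fun t ht => ((hyd (t, p.2) ⟨Ico_subset_Icc_self ht, hp.2⟩).mono_of_mem_nhdsWithin
        (Icc_mem_nhdsGE_of_mem ht))) ?_ (hexp p.2) ?_ hp.1
    · rw [hy0 _ hp.2, norm_zero]; positivity
    · intro t ht
      have hpt : (t, p.2) ∈ rect a b := ⟨Ico_subset_Icc_self ht, hp.2⟩
      have h3 := hle _ hpt
      simp only [add_comm t p.2] at h3
      exact (hyK _ hpt).trans (mul_le_mul hKk h3 (by positivity) (by positivity))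
  have hMle : M ≤ M / 2 := by
    have h3 := h1 q hq
    have h4 := h2 q hq
    rw [add_comm q.2] at h4
    calc M ≤ Real.exp (-(k * (q.1 + q.2))) * (M / 2 * Real.exp (k * (q.1 + q.2))) := by
          rw [hM]; gcongr; linarith
      _ = M / 2 := by rw [Real.exp_neg]; field_simp
  have hM00 : M = 0 := by linarith
  intro p hp
  have := hle p hp
  rw [hM00, zero_mul] at this
  constructor
  · exact norm_eq_zero.1 (by linarith [norm_nonneg (x p), norm_nonneg (y p)])
  · exact norm_eq_zero.1 (by linarith [norm_nonneg (x p), norm_nonneg (y p)])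

/-- Two functions on an interval with the same derivative and the same initial value agree. -/
theorem eqOn_Icc_of_hasDerivWithinAt {a : ℝ} {f g f' : ℝ → E}
    (hf : ∀ t ∈ Icc 0 a, HasDerivWithinAt f (f' t) (Icc 0 a) t)
    (hg : ∀ t ∈ Icc 0 a, HasDerivWithinAt g (f' t) (Icc 0 a) t) (h0 : f 0 = g 0) :
    ∀ t ∈ Icc 0 a, f t = g t := by
  intro t ht
  have := (convex_Icc (0 : ℝ) a).norm_image_sub_le_of_norm_hasDerivWithin_le
    (f := fun t => f t - g t) (f' := fun _ => 0) (C := 0)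
    (fun s hs => by simpa using (hf s hs).fun_sub (hg s hs)) (by simp)
    (left_mem_Icc.2 (ht.1.trans ht.2)) ht
  simp only [h0, sub_self, sub_zero, zero_mul, norm_le_zero_iff] at this
  exact sub_eq_zero.1 this

/-- If `N_v = b` and `a_v = b_u = g`, and `N_u = a` for `v = 0`, then `N_u = a` everywhere. -/
theorem hasDerivWithinAt_fst_of_mixed {A B : ℝ} {N α β γ : ℝ × ℝ → E}
    (hγ : ContinuousOn γ (rect A B))
    (hN : ∀ p ∈ rect A B, HasDerivWithinAt (fun t => N (p.1, t)) (β p) (Icc 0 B) p.2)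
    (hα : ∀ p ∈ rect A B, HasDerivWithinAt (fun t => α (p.1, t)) (γ p) (Icc 0 B) p.2)
    (hβ : ∀ p ∈ rect A B, HasDerivWithinAt (fun t => β (t, p.2)) (γ p) (Icc 0 A) p.1)
    (h0 : ∀ u ∈ Icc 0 A, HasDerivWithinAt (fun t => N (t, 0)) (α (u, 0)) (Icc 0 A) u) :
    ∀ p ∈ rect A B, HasDerivWithinAt (fun t => N (t, p.2)) (α p) (Icc 0 A) p.1 := by
  rintro ⟨u, v⟩ ⟨hu, hv⟩
  simp only at hu hv ⊢
  have hB : 0 ≤ B := hv.1.trans hv.2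
  have hcpt : IsCompact (rect A B) := isCompact_Icc.prod isCompact_Icc
  have huc := hcpt.uniformContinuousOn_of_continuous hγ
  rw [hasDerivWithinAt_iff_isLittleO, Asymptotics.isLittleO_iff]
  intro ε hε
  have hε' : 0 < ε / (2 * (B + 1)) := by positivity
  obtain ⟨δ, hδ, hδγ⟩ := Metric.uniformContinuousOn_iff.1 huc _ hε'
  have h0' := (hasDerivWithinAt_iff_isLittleO.1 (h0 u hu)).def (half_pos hε)
  filter_upwards [h0', self_mem_nhdsWithin, mem_nhdsWithin_of_mem_nhds (Metric.ball_mem_nhds u hδ)]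
    with s hs hsA hsδ
  have hbd : ∀ t ∈ Icc 0 B, ‖β (s, t) - β (u, t) - (s - u) • γ (u, t)‖
      ≤ ε / (2 * (B + 1)) * ‖s - u‖ := by
    intro t ht
    have := (convex_uIcc u s).norm_image_sub_le_of_norm_hasDerivWithin_le
      (f := fun σ => β (σ, t) - (σ - u) • γ (u, t)) (f' := fun σ => γ (σ, t) - γ (u, t))
      (C := ε / (2 * (B + 1))) (x := u) (y := s) (fun σ hσ => ?_) (fun σ hσ => ?_) left_mem_uIcc
      right_mem_uIcc
    · simp only [sub_self, zero_smul, sub_zero] at this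
      rw [sub_right_comm]; exact this
    · have hσA : σ ∈ Icc 0 A := (uIcc_subset_Icc hu hsA) hσ
      refine ((hβ (σ, t) ⟨hσA, ht⟩).mono (uIcc_subset_Icc hu hsA)).sub ?_
      simpa using (((hasDerivAt_id σ).sub_const u).smul_const (γ (u, t))).hasDerivWithinAt
    · have hσA : σ ∈ Icc 0 A := (uIcc_subset_Icc hu hsA) hσ
      rw [← dist_eq_norm]
      refine (hδγ _ ⟨hσA, ht⟩ _ ⟨hu, ht⟩ ?_).le
      rw [Prod.dist_eq, dist_self, max_eq_left dist_nonneg]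
      have h5 := abs_sub_left_of_mem_uIcc hσ
      rw [Metric.mem_ball, Real.dist_eq] at hsδ
      rw [Real.dist_eq]
      linarith
  have := (convex_Icc (0 : ℝ) B).norm_image_sub_le_of_norm_hasDerivWithin_le
    (f := fun t => N (s, t) - N (u, t) - (s - u) • α (u, t))
    (fun t ht => ((hN (s, t) ⟨hsA, ht⟩).sub (hN (u, t) ⟨hu, ht⟩)).sub
      ((hα (u, t) ⟨hu, ht⟩).const_smul (s - u)))
    hbd (left_mem_Icc.2 hB) hv
  simp only [sub_zero, Real.norm_eq_abs, abs_of_nonneg hv.1] at this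
  have h6 : ε / (2 * (B + 1)) * |s - u| * v ≤ ε / 2 * |s - u| := by
    have : ε / (2 * (B + 1)) * v ≤ ε / 2 := by
      rw [div_mul_eq_mul_div, div_le_div_iff₀ (by positivity) two_pos]
      nlinarith [hv.2]
    nlinarith [abs_nonneg (s - u)]
  simp only [Real.norm_eq_abs] at hs ⊢
  have h7 := norm_sub_norm_le (N (s, v) - N (u, v) - (s - u) • α (u, v))
    (N (s, 0) - N (u, 0) - (s - u) • α (u, 0))
  linarith

end Goursat

section CrossProduct

theorem inner_eq_sum (a b : E3) : ⟪a, b⟫ = a 0 * b 0 + a 1 * b 1 + a 2 * b 2 := by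
  simp [PiLp.inner_apply, Fin.sum_univ_three, mul_comm]

theorem cross_apply_zero (a b : E3) : cross a b 0 = a 1 * b 2 - a 2 * b 1 := by
  simp [cross, cross_apply]

theorem cross_apply_one (a b : E3) : cross a b 1 = a 2 * b 0 - a 0 * b 2 := by
  simp [cross, cross_apply]

theorem cross_apply_two (a b : E3) : cross a b 2 = a 0 * b 1 - a 1 * b 0 := by
  simp [cross, cross_apply]

theorem cross_add_left (a b c : E3) : cross (a + b) c = cross a c + cross b c := by
  simp [cross]

theorem cross_add_right (a b c : E3) : cross a (b + c) = cross a b + cross a c := by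
  simp [cross]

theorem cross_smul_left (t : ℝ) (a b : E3) : cross (t • a) b = t • cross a b := by
  simp [cross]

theorem cross_smul_right (t : ℝ) (a b : E3) : cross a (t • b) = t • cross a b := by
  simp [cross]

theorem cross_neg_right (a b : E3) : cross a (-b) = -cross a b := by
  simpa using cross_smul_right (-1) a b

theorem cross_sub_left (a b c : E3) : cross (a - b) c = cross a c - cross b c := by
  simp [cross]

theorem cross_sub_right (a b c : E3) : cross a (b - c) = cross a b - cross a c := by
  simp [cross]

theorem cross_self (a : E3) : cross a a = 0 := by
  simp [cross]

theorem neg_cross (a b : E3) : -cross a b = cross b a := by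
  simp [cross, ← WithLp.toLp_neg]

theorem ext_three {a b : E3} (h0 : a 0 = b 0) (h1 : a 1 = b 1) (h2 : a 2 = b 2) : a = b := by
  ext i
  fin_cases i <;> assumption

theorem cross_cross (a b c : E3) : cross (cross a b) c = ⟪a, c⟫ • b - ⟪b, c⟫ • a := by
  apply ext_three <;>
    simp only [cross_apply_zero, cross_apply_one, cross_apply_two, inner_eq_sum, PiLp.sub_apply,
      PiLp.smul_apply, smul_eq_mul] <;> ring

theorem cross_cross_right (a b c : E3) : cross a (cross b c) = ⟪a, c⟫ • b - ⟪a, b⟫ • c := by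
  apply ext_three <;>
    simp only [cross_apply_zero, cross_apply_one, cross_apply_two, inner_eq_sum, PiLp.sub_apply,
      PiLp.smul_apply, smul_eq_mul] <;> ring

theorem inner_cross_self_left (a b : E3) : ⟪a, cross a b⟫ = 0 := by
  simp only [cross_apply_zero, cross_apply_one, cross_apply_two, inner_eq_sum]; ring

theorem inner_cross_self_right (a b : E3) : ⟪a, cross b a⟫ = 0 := by
  simp only [cross_apply_zero, cross_apply_one, cross_apply_two, inner_eq_sum]; ring

theorem inner_cross_cyclic (a b c : E3) : ⟪a, cross b c⟫ = ⟪cross a b, c⟫ := by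
  simp only [cross_apply_zero, cross_apply_one, cross_apply_two, inner_eq_sum]; ring

theorem inner_cross_cross (a b c d : E3) :
    ⟪cross a b, cross c d⟫ = ⟪a, c⟫ * ⟪b, d⟫ - ⟪a, d⟫ * ⟪b, c⟫ := by
  simp only [cross_apply_zero, cross_apply_one, cross_apply_two, inner_eq_sum]; ring

theorem norm_cross_le (a b : E3) : ‖cross a b‖ ≤ ‖a‖ * ‖b‖ := by
  refine le_of_sq_le_sq ?_ (by positivity)
  have := inner_cross_cross a b a b
  rw [real_inner_self_eq_norm_sq, real_inner_self_eq_norm_sq, real_inner_self_eq_norm_sq,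
    real_inner_comm a b] at this
  nlinarith [sq_nonneg ⟪a, b⟫]

/-- The cross product as a continuous bilinear map. -/
noncomputable def crossL : E3 →L[ℝ] E3 →L[ℝ] E3 :=
  LinearMap.mkContinuous₂ (LinearMap.mk₂ ℝ cross cross_add_left cross_smul_left
    cross_add_right cross_smul_right) 1 (fun a b => by simpa using norm_cross_le a b)

theorem crossL_apply (a b : E3) : crossL a b = cross a b := rfl

theorem _root_.Continuous.cross3 {X : Type*} [TopologicalSpace X] {f g : X → E3}
    (hf : Continuous f) (hg : Continuous g) : Continuous fun x => cross (f x) (g x) := by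
  simp only [← crossL_apply]; fun_prop

theorem _root_.ContinuousOn.cross3 {X : Type*} [TopologicalSpace X] {f g : X → E3} {s : Set X}
    (hf : ContinuousOn f s) (hg : ContinuousOn g s) :
    ContinuousOn (fun x => cross (f x) (g x)) s := by
  simp only [← crossL_apply]; fun_prop

theorem _root_.HasDerivWithinAt.cross3 {f g : ℝ → E3} {f' g' : E3} {s : Set ℝ} {t : ℝ}
    (hf : HasDerivWithinAt f f' s t) (hg : HasDerivWithinAt g g' s t) :
    HasDerivWithinAt (fun t => cross (f t) (g t)) (cross (f t) g' + cross f' (g t)) s t :=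
  crossL.hasDerivWithinAt_of_bilinear hf hg

end CrossProduct

section RadialTruncation

variable {V : Type*} [NormedAddCommGroup V] [NormedSpace ℝ V]

/-- The radial retraction onto the closed ball of radius `R`. -/
noncomputable def radialRetraction (R : ℝ) (x : V) : V := (R / max R ‖x‖) • x

theorem radialRetraction_of_norm_le {R : ℝ} (hR : 0 < R) {x : V} (hx : ‖x‖ ≤ R) :
    radialRetraction R x = x := by
  rw [radialRetraction, max_eq_left hx, div_self hR.ne', one_smul]

theorem norm_radialRetraction_le {R : ℝ} (hR : 0 < R) (x : V) : ‖radialRetraction R x‖ ≤ R := by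
  have hm : 0 < max R ‖x‖ := lt_max_of_lt_left hR
  rw [radialRetraction, norm_smul, Real.norm_eq_abs, abs_of_pos (div_pos hR hm), div_mul_eq_mul_div,
    div_le_iff₀ hm]
  gcongr
  exact le_max_right _ _

theorem continuous_radialRetraction {R : ℝ} (hR : 0 < R) :
    Continuous (radialRetraction R : V → V) := by
  unfold radialRetraction
  refine Continuous.smul (continuous_const.div (by fun_prop) fun x => ?_) continuous_id
  exact (lt_max_of_lt_left hR).ne'

theorem norm_radialRetraction_sub_le {R : ℝ} (hR : 0 < R) (x y : V) :
    ‖radialRetraction R x - radialRetraction R y‖ ≤ 2 * ‖x - y‖ := by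
  have hx : 0 < max R ‖x‖ := lt_max_of_lt_left hR
  have hy : 0 < max R ‖y‖ := lt_max_of_lt_left hR
  have e : radialRetraction R x - radialRetraction R y
      = (R / max R ‖x‖) • (x - y) + (R / max R ‖x‖ - R / max R ‖y‖) • y := by
    simp only [radialRetraction]; module
  have h1 : R / max R ‖x‖ ≤ 1 := (div_le_one hx).2 (le_max_left _ _)
  have h2 : |R / max R ‖x‖ - R / max R ‖y‖| * ‖y‖ ≤ ‖x - y‖ := by
    have e2 : R / max R ‖x‖ - R / max R ‖y‖
        = R / max R ‖x‖ * ((max R ‖y‖ - max R ‖x‖) / max R ‖y‖) := by field_simp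
    rw [e2, abs_mul, abs_of_pos (div_pos hR hx), abs_div, abs_of_pos hy]
    have h3 : |max R ‖y‖ - max R ‖x‖| ≤ ‖x - y‖ := by
      refine (abs_max_sub_max_le_max R ‖y‖ R ‖x‖).trans ?_
      rw [sub_self, abs_zero, max_eq_right (abs_nonneg _), norm_sub_rev]
      exact abs_norm_sub_norm_le y x
    have h4 : ‖y‖ / max R ‖y‖ ≤ 1 := (div_le_one hy).2 (le_max_right _ _)
    calc R / max R ‖x‖ * (|max R ‖y‖ - max R ‖x‖| / max R ‖y‖) * ‖y‖
        = R / max R ‖x‖ * (|max R ‖y‖ - max R ‖x‖| * (‖y‖ / max R ‖y‖)) := by ring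
      _ ≤ 1 * (‖x - y‖ * 1) := by gcongr
      _ = _ := by ring
  rw [e]
  refine (norm_add_le _ _).trans ?_
  rw [norm_smul, norm_smul, Real.norm_eq_abs, Real.norm_eq_abs, abs_of_pos (div_pos hR hx)]
  have : R / max R ‖x‖ * ‖x - y‖ ≤ 1 * ‖x - y‖ := by gcongr
  linarith

end RadialTruncation

section C1M

variable {I J : Set ℝ} {D : Set (ℝ × ℝ)}

theorem slice_fst_prod {p : ℝ × ℝ} (hp : p ∈ I ×ˢ J) : {t | (t, p.2) ∈ I ×ˢ J} = I := by
  ext t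
  simp [hp.2]

theorem slice_snd_prod {p : ℝ × ℝ} (hp : p ∈ I ×ˢ J) : {t | (p.1, t) ∈ I ×ˢ J} = J := by
  ext t
  simp [hp.1]

theorem partialU_eq_of_hasDerivWithinAt (hI : UniqueDiffOn ℝ I) {f : ℝ × ℝ → E3} {p : ℝ × ℝ}
    (hp : p ∈ I ×ˢ J) {c : E3} (h : HasDerivWithinAt (fun t => f (t, p.2)) c I p.1) :
    partialU (I ×ˢ J) f p = c := by
  rw [partialU, slice_fst_prod hp]
  exact h.derivWithin (hI _ hp.1)

theorem partialV_eq_of_hasDerivWithinAt (hJ : UniqueDiffOn ℝ J) {f : ℝ × ℝ → E3} {p : ℝ × ℝ}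
    (hp : p ∈ I ×ˢ J) {c : E3} (h : HasDerivWithinAt (fun t => f (p.1, t)) c J p.2) :
    partialV (I ×ˢ J) f p = c := by
  rw [partialV, slice_snd_prod hp]
  exact h.derivWithin (hJ _ hp.2)

theorem hasDerivWithinAt_partialU {f : ℝ × ℝ → E3} (h : HasPartialU (I ×ˢ J) f) {p : ℝ × ℝ}
    (hp : p ∈ I ×ˢ J) :
    HasDerivWithinAt (fun t => f (t, p.2)) (partialU (I ×ˢ J) f p) I p.1 := by
  have := (h p hp).hasDerivWithinAt
  rw [partialU]
  rwa [slice_fst_prod hp] at this ⊢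

theorem hasDerivWithinAt_partialV {f : ℝ × ℝ → E3} (h : HasPartialV (I ×ˢ J) f) {p : ℝ × ℝ}
    (hp : p ∈ I ×ˢ J) :
    HasDerivWithinAt (fun t => f (p.1, t)) (partialV (I ×ˢ J) f p) J p.2 := by
  have := (h p hp).hasDerivWithinAt
  rw [partialV]
  rwa [slice_snd_prod hp] at this ⊢

/-- The functions `fu`, `fv`, `fuv` are the partial and mixed derivatives of `f` on `I × J`. -/
structure HasPartials (I J : Set ℝ) (f fu fv fuv : ℝ × ℝ → E3) : Prop where
  continuousOn : ContinuousOn f (I ×ˢ J)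
  continuousOn_u : ContinuousOn fu (I ×ˢ J)
  continuousOn_v : ContinuousOn fv (I ×ˢ J)
  continuousOn_uv : ContinuousOn fuv (I ×ˢ J)
  u : ∀ p ∈ I ×ˢ J, HasDerivWithinAt (fun t => f (t, p.2)) (fu p) I p.1
  v : ∀ p ∈ I ×ˢ J, HasDerivWithinAt (fun t => f (p.1, t)) (fv p) J p.2
  uv : ∀ p ∈ I ×ˢ J, HasDerivWithinAt (fun t => fu (p.1, t)) (fuv p) J p.2
  vu : ∀ p ∈ I ×ˢ J, HasDerivWithinAt (fun t => fv (t, p.2)) (fuv p) I p.1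

namespace HasPartials

variable {f fu fv fuv : ℝ × ℝ → E3}

theorem eqOn_partialU (h : HasPartials I J f fu fv fuv) (hI : UniqueDiffOn ℝ I) :
    EqOn (partialU (I ×ˢ J) f) fu (I ×ˢ J) :=
  fun p hp => partialU_eq_of_hasDerivWithinAt hI hp (h.u p hp)

theorem eqOn_partialV (h : HasPartials I J f fu fv fuv) (hJ : UniqueDiffOn ℝ J) :
    EqOn (partialV (I ×ˢ J) f) fv (I ×ˢ J) :=
  fun p hp => partialV_eq_of_hasDerivWithinAt hJ hp (h.v p hp)

theorem hasDerivWithinAt_uv (h : HasPartials I J f fu fv fuv) (hI : UniqueDiffOn ℝ I)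
    {p : ℝ × ℝ} (hp : p ∈ I ×ˢ J) :
    HasDerivWithinAt (fun t => partialU (I ×ˢ J) f (p.1, t)) (fuv p) J p.2 :=
  (h.uv p hp).congr (fun _ ht => h.eqOn_partialU hI ⟨hp.1, ht⟩) (h.eqOn_partialU hI hp)

theorem hasDerivWithinAt_vu (h : HasPartials I J f fu fv fuv) (hJ : UniqueDiffOn ℝ J)
    {p : ℝ × ℝ} (hp : p ∈ I ×ˢ J) :
    HasDerivWithinAt (fun t => partialV (I ×ˢ J) f (t, p.2)) (fuv p) I p.1 :=
  (h.vu p hp).congr (fun _ ht => h.eqOn_partialV hJ ⟨ht, hp.2⟩) (h.eqOn_partialV hJ hp)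

theorem eqOn_partialVU (h : HasPartials I J f fu fv fuv) (hI : UniqueDiffOn ℝ I)
    (hJ : UniqueDiffOn ℝ J) : EqOn (partialV (I ×ˢ J) (partialU (I ×ˢ J) f)) fuv (I ×ˢ J) :=
  fun _ hp => partialV_eq_of_hasDerivWithinAt hJ hp (h.hasDerivWithinAt_uv hI hp)

theorem eqOn_partialUV (h : HasPartials I J f fu fv fuv) (hI : UniqueDiffOn ℝ I)
    (hJ : UniqueDiffOn ℝ J) : EqOn (partialU (I ×ˢ J) (partialV (I ×ˢ J) f)) fuv (I ×ˢ J) :=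
  fun _ hp => partialU_eq_of_hasDerivWithinAt hI hp (h.hasDerivWithinAt_vu hJ hp)

theorem isC1M (h : HasPartials I J f fu fv fuv) (hI : UniqueDiffOn ℝ I) (hJ : UniqueDiffOn ℝ J) :
    IsC1M (I ×ˢ J) f where
  continuousOn := h.continuousOn
  hasPartialU p hp := by
    rw [slice_fst_prod hp]; exact (h.u p hp).differentiableWithinAt
  hasPartialV p hp := by
    rw [slice_snd_prod hp]; exact (h.v p hp).differentiableWithinAt
  continuousOn_partialU := h.continuousOn_u.congr (h.eqOn_partialU hI)
  continuousOn_partialV := h.continuousOn_v.congr (h.eqOn_partialV hJ)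
  hasPartialV_partialU p hp := by
    rw [slice_snd_prod hp]; exact (h.hasDerivWithinAt_uv hI hp).differentiableWithinAt
  hasPartialU_partialV p hp := by
    rw [slice_fst_prod hp]; exact (h.hasDerivWithinAt_vu hJ hp).differentiableWithinAt
  mixed_eq p hp := (h.eqOn_partialVU hI hJ hp).trans (h.eqOn_partialUV hI hJ hp).symm
  continuousOn_mixed := h.continuousOn_uv.congr (h.eqOn_partialVU hI hJ)

end HasPartials

/-- The map `(u, v) ↦ (a + ε u, b + δ v)`. -/
def affineMap (a b ε δ : ℝ) (p : ℝ × ℝ) : ℝ × ℝ := (a + ε * p.1, b + δ * p.2)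

theorem continuous_affineMap (a b ε δ : ℝ) : Continuous (affineMap a b ε δ) := by
  unfold affineMap; fun_prop

theorem IsC1M.hasPartials_comp {f g : ℝ × ℝ → E3} (hf : IsC1M D f) {a b ε δ : ℝ}
    (hmaps : MapsTo (affineMap a b ε δ) (I ×ˢ J) D)
    (hg : ∀ p ∈ I ×ˢ J, g p = f (affineMap a b ε δ p)) :
    HasPartials I J g (fun p => ε • partialU D f (affineMap a b ε δ p))
      (fun p => δ • partialV D f (affineMap a b ε δ p))
      (fun p => (ε * δ) • partialV D (partialU D f) (affineMap a b ε δ p)) := by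
  have hA := (continuous_affineMap a b ε δ).continuousOn (s := I ×ˢ J)
  have compU {F : ℝ × ℝ → E3} (hF : HasPartialU D F) (p : ℝ × ℝ) (hp : p ∈ I ×ˢ J) :
      HasDerivWithinAt (fun t => F (affineMap a b ε δ (t, p.2)))
        (ε • partialU D F (affineMap a b ε δ p)) I p.1 := by
    have h1 := (hF _ (hmaps hp)).hasDerivWithinAt
    have h2 : HasDerivWithinAt (fun t => a + ε * t) ε I p.1 := by
      simpa using (((hasDerivAt_id p.1).const_mul ε).const_add a).hasDerivWithinAt
    exact HasDerivWithinAt.scomp p.1 (h := fun t => a + ε * t) h1 h2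
      fun t ht => (hmaps (show (t, p.2) ∈ I ×ˢ J from ⟨ht, hp.2⟩) :)
  have compV {F : ℝ × ℝ → E3} (hF : HasPartialV D F) (p : ℝ × ℝ) (hp : p ∈ I ×ˢ J) :
      HasDerivWithinAt (fun t => F (affineMap a b ε δ (p.1, t)))
        (δ • partialV D F (affineMap a b ε δ p)) J p.2 := by
    have h1 := (hF _ (hmaps hp)).hasDerivWithinAt
    have h2 : HasDerivWithinAt (fun t => b + δ * t) δ J p.2 := by
      simpa using (((hasDerivAt_id p.2).const_mul δ).const_add b).hasDerivWithinAt
    exact HasDerivWithinAt.scomp p.2 (h := fun t => b + δ * t) h1 h2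
      fun t ht => (hmaps (show (p.1, t) ∈ I ×ˢ J from ⟨hp.1, ht⟩) :)
  refine ⟨(hf.continuousOn.comp hA hmaps).congr hg,
    (hf.continuousOn_partialU.comp hA hmaps).const_smul ε,
    (hf.continuousOn_partialV.comp hA hmaps).const_smul δ,
    (hf.continuousOn_mixed.comp hA hmaps).const_smul (ε * δ), fun p hp => ?_, fun p hp => ?_,
    fun p hp => ?_, fun p hp => ?_⟩
  · exact (compU hf.hasPartialU p hp).congr (fun t ht => hg _ ⟨ht, hp.2⟩) (hg _ hp)
  · exact (compV hf.hasPartialV p hp).congr (fun t ht => hg _ ⟨hp.1, ht⟩) (hg _ hp)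
  · have := (compV hf.hasPartialV_partialU p hp).fun_const_smul ε
    rwa [smul_smul] at this
  · have := (compU hf.hasPartialU_partialV p hp).fun_const_smul δ
    rwa [smul_smul, mul_comm, ← hf.mixed_eq _ (hmaps hp)] at this

/-- PS-fronts are invariant under affine changes of the two asymptotic parameters. -/
theorem IsPSFrontWith.comp_affineMap {r N r' N' : ℝ × ℝ → E3} (h : IsPSFrontWith D r N)
    (hI : UniqueDiffOn ℝ I) (hJ : UniqueDiffOn ℝ J) {a b ε δ : ℝ} (hε : ε ≠ 0) (hδ : δ ≠ 0)
    (hmaps : MapsTo (affineMap a b ε δ) (I ×ˢ J) D)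
    (hr : ∀ p ∈ I ×ˢ J, r' p = r (affineMap a b ε δ p))
    (hN : ∀ p ∈ I ×ˢ J, N' p = N (affineMap a b ε δ p)) :
    IsPSFrontWith (I ×ˢ J) r' N' := by
  have hr' := h.c1m.hasPartials_comp hmaps hr
  have hN' := h.harmonic.c1m.hasPartials_comp hmaps hN
  have pos (t : ℝ) (ht : t ≠ 0) (x : E3) (hx : 0 < ⟪x, x⟫) : 0 < ⟪t • x, t • x⟫ := by
    rw [real_inner_smul_left, real_inner_smul_right]
    have := mul_self_pos.2 ht
    nlinarith
  refine ⟨⟨hN'.isC1M hI hJ, fun p hp => ?_, fun p hp => ?_, fun p hp => ?_, ?_⟩,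
    hr'.isC1M hI hJ, fun p hp => ?_, fun p hp => ?_, fun p hp => ?_, fun p hp => ?_⟩
  · rw [hN p hp]; exact h.harmonic.norm_eq_one _ (hmaps hp)
  · rw [hN'.eqOn_partialU hI hp]; exact pos ε hε _ (h.harmonic.partialU_pos _ (hmaps hp))
  · rw [hN'.eqOn_partialV hJ hp]; exact pos δ hδ _ (h.harmonic.partialV_pos _ (hmaps hp))
  · obtain ⟨ν, hν, hν'⟩ := h.harmonic.moutard
    refine ⟨fun p => ε * δ * ν (affineMap a b ε δ p), continuousOn_const.mul
      (hν.comp (continuous_affineMap a b ε δ).continuousOn hmaps), fun p hp => ?_⟩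
    rw [hN'.eqOn_partialVU hI hJ hp, hN'.eqOn_partialUV hI hJ hp, hN p hp, mul_smul (ε * δ),
      ← (hν' _ (hmaps hp)).1]
    exact ⟨rfl, rfl⟩
  · rw [hr'.eqOn_partialU hI hp, hN'.eqOn_partialU hI hp, hN p hp, cross_smul_left,
      ← h.lelieuvreU _ (hmaps hp)]
  · rw [hr'.eqOn_partialV hJ hp, hN'.eqOn_partialV hJ hp, hN p hp, cross_smul_left,
      ← smul_neg, ← h.lelieuvreV _ (hmaps hp)]
  · rw [hr'.eqOn_partialU hI hp]; exact pos ε hε _ (h.regularU _ (hmaps hp))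
  · rw [hr'.eqOn_partialV hJ hp]; exact pos δ hδ _ (h.regularV _ (hmaps hp))

end C1M

theorem hasDerivWithinAt_inner_self {f : ℝ → E3} {f' : E3} {s : Set ℝ} {t : ℝ}
    (hf : HasDerivWithinAt f f' s t) :
    HasDerivWithinAt (fun t => ⟪f t, f t⟫) (2 * ⟪f t, f'⟫) s t := by
  refine (hf.inner ℝ hf).congr_deriv ?_
  rw [real_inner_comm f' (f t)]; ring

theorem inner_deriv_eq_zero_of_norm_eq_one {a : ℝ} (ha : 0 < a) {f f' : ℝ → E3}
    (hf : ∀ t ∈ Icc 0 a, HasDerivWithinAt f (f' t) (Icc 0 a) t) (h1 : ∀ t ∈ Icc 0 a, ‖f t‖ = 1)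
    {t : ℝ} (ht : t ∈ Icc 0 a) : ⟪f t, f' t⟫ = 0 := by
  have h := hasDerivWithinAt_inner_self (hf t ht)
  have h2 : HasDerivWithinAt (fun t => ⟪f t, f t⟫) 0 (Icc 0 a) t :=
    (hasDerivWithinAt_const t (Icc 0 a) (1 : ℝ)).congr
      (fun s hs => by rw [real_inner_self_eq_norm_sq, h1 s hs, one_pow])
      (by rw [real_inner_self_eq_norm_sq, h1 t ht, one_pow])
  have := (uniqueDiffOn_Icc ha t ht).eq_deriv _ h h2
  linarith

theorem norm_eq_of_inner_deriv_eq_zero {a : ℝ} {f f' : ℝ → E3}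
    (hf : ∀ t ∈ Icc 0 a, HasDerivWithinAt f (f' t) (Icc 0 a) t)
    (h : ∀ t ∈ Icc 0 a, ⟪f t, f' t⟫ = 0) {t : ℝ} (ht : t ∈ Icc 0 a) : ‖f t‖ = ‖f 0‖ := by
  have := eqOn_Icc_of_hasDerivWithinAt (f := fun t => ⟪f t, f t⟫) (g := fun _ => ⟪f 0, f 0⟫)
    (f' := fun _ => 0) (fun t ht => (hasDerivWithinAt_inner_self (hf t ht)).congr_deriv
      (by rw [h t ht, mul_zero])) (fun t _ => hasDerivWithinAt_const t _ _) rfl t ht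
  simp only [real_inner_self_eq_norm_sq] at this
  exact (sq_eq_sq₀ (norm_nonneg _) (norm_nonneg _)).1 this

theorem exists_continuous_extension {V : Type*} [TopologicalSpace V] {a : ℝ} (ha : 0 ≤ a)
    {f : ℝ → V} (hf : ContinuousOn f (Icc 0 a)) :
    ∃ g : ℝ → V, Continuous g ∧ EqOn g f (Icc 0 a) := by
  refine ⟨IccExtend ha ((Icc 0 a).domRestrict f), hf.domRestrict.Icc_extend', fun t ht => ?_⟩
  rw [IccExtend_of_mem ha _ ht]; rfl

theorem exists_norm_le_of_continuousOn {V : Type*} [NormedAddCommGroup V] {s : Set (ℝ × ℝ)}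
    (hs : IsCompact s) {f : ℝ × ℝ → V} (hf : ContinuousOn f s) :
    ∃ C, 0 < C ∧ ∀ p ∈ s, ‖f p‖ ≤ C := by
  obtain ⟨C, hC⟩ := hs.exists_bound_of_continuousOn hf
  exact ⟨max C 1, by positivity, fun p hp => (hC p hp).trans (le_max_left _ _)⟩

theorem isCompact_rect (a b : ℝ) : IsCompact (rect a b) := isCompact_Icc.prod isCompact_Icc

theorem inner_cross_radialRetraction (R : ℝ) (a b : E3) :
    ⟪a, cross b (radialRetraction R a)⟫ = 0 := by
  rw [radialRetraction, cross_smul_right, real_inner_smul_right, inner_cross_self_right, mul_zero]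

/-- The system `η_v = ω × η`, `ω_u = η × ω`. Solutions exist globally, since the norms of `η` and
`ω` are preserved. -/
theorem exists_rotation_fields {A B : ℝ} (hA : 0 ≤ A) (hB : 0 ≤ B) {η₀ ω₀ : ℝ → E3}
    (hη₀ : ContinuousOn η₀ (Icc 0 A)) (hω₀ : ContinuousOn ω₀ (Icc 0 B)) :
    ∃ η ω : ℝ × ℝ → E3, Continuous η ∧ Continuous ω ∧
      (∀ u ∈ Icc 0 A, η (u, 0) = η₀ u) ∧ (∀ v ∈ Icc 0 B, ω (0, v) = ω₀ v) ∧
      (∀ p ∈ rect A B,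
        HasDerivWithinAt (fun t => η (p.1, t)) (cross (ω p) (η p)) (Icc 0 B) p.2) ∧
      (∀ p ∈ rect A B,
        HasDerivWithinAt (fun t => ω (t, p.2)) (cross (η p) (ω p)) (Icc 0 A) p.1) ∧
      (∀ p ∈ rect A B, ‖η p‖ = ‖η₀ p.1‖) ∧ (∀ p ∈ rect A B, ‖ω p‖ = ‖ω₀ p.2‖) := by
  obtain ⟨x₀, hx₀, hx₀e⟩ := exists_continuous_extension hA hη₀
  obtain ⟨y₀, hy₀, hy₀e⟩ := exists_continuous_extension hB hω₀
  obtain ⟨R₁, hR₁⟩ := isCompact_Icc.exists_bound_of_continuousOn hη₀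
  obtain ⟨R₂, hR₂⟩ := isCompact_Icc.exists_bound_of_continuousOn hω₀
  set R := max (max R₁ R₂) 1 with hR
  have hR0 : 0 < R := by positivity
  have hπ : Continuous (radialRetraction R : E3 → E3) := continuous_radialRetraction hR0
  have lip (x y x' y' : E3) :
      ‖cross (radialRetraction R x) (radialRetraction R y)
        - cross (radialRetraction R x') (radialRetraction R y')‖
      ≤ 2 * R * ‖x - x'‖ + 2 * R * ‖y - y'‖ := by
    have e : cross (radialRetraction R x) (radialRetraction R y)
        - cross (radialRetraction R x') (radialRetraction R y')
        = cross (radialRetraction R x - radialRetraction R x') (radialRetraction R y)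
          + cross (radialRetraction R x') (radialRetraction R y - radialRetraction R y') := by
      rw [cross_sub_left, cross_sub_right]; abel
    rw [e]
    refine (norm_add_le _ _).trans (add_le_add ?_ ?_)
    · refine (norm_cross_le _ _).trans ?_
      calc _ ≤ 2 * ‖x - x'‖ * R := by
            gcongr
            exacts [norm_radialRetraction_sub_le hR0 _ _, norm_radialRetraction_le hR0 _]
        _ = _ := by ring
    · refine (norm_cross_le _ _).trans ?_
      calc _ ≤ R * (2 * ‖y - y'‖) := by
            gcongr
            exacts [norm_radialRetraction_le hR0 _, norm_radialRetraction_sub_le hR0 _ _]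
        _ = _ := by ring
  obtain ⟨η, ω, hη, hω, hη0, hω0, hηv, hωu⟩ := exists_goursat_solution (K := 4 * R) hA hB
    (by positivity)
    (f := fun _ z => cross (radialRetraction R z.2) (radialRetraction R z.1))
    (g := fun _ z => cross (radialRetraction R z.1) (radialRetraction R z.2))
    ((hπ.comp (by fun_prop)).cross3 (hπ.comp (by fun_prop)))
    ((hπ.comp (by fun_prop)).cross3 (hπ.comp (by fun_prop)))
    (fun p _ z z' => (lip _ _ _ _).trans (by
      have h1 : ‖z.1 - z'.1‖ ≤ ‖z - z'‖ := norm_fst_le (z - z')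
      have h2 : ‖z.2 - z'.2‖ ≤ ‖z - z'‖ := norm_snd_le (z - z')
      nlinarith))
    (fun p _ z z' => (lip _ _ _ _).trans (by
      have h1 : ‖z.1 - z'.1‖ ≤ ‖z - z'‖ := norm_fst_le (z - z')
      have h2 : ‖z.2 - z'.2‖ ≤ ‖z - z'‖ := norm_snd_le (z - z')
      nlinarith)) hx₀ hy₀
  have nη (p) (hp : p ∈ rect A B) : ‖η p‖ = ‖η₀ p.1‖ := by
    rw [← hx₀e hp.1, ← hη0 p.1 hp.1]
    refine norm_eq_of_inner_deriv_eq_zero (f := fun t => η (p.1, t))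
      (fun t ht => hηv (p.1, t) ⟨hp.1, ht⟩) (fun t ht => ?_) hp.2
    exact inner_cross_radialRetraction _ _ _
  have nω (p) (hp : p ∈ rect A B) : ‖ω p‖ = ‖ω₀ p.2‖ := by
    rw [← hy₀e hp.2, ← hω0 p.2 hp.2]
    refine norm_eq_of_inner_deriv_eq_zero (f := fun t => ω (t, p.2))
      (fun t ht => hωu (t, p.2) ⟨ht, hp.2⟩) (fun t ht => ?_) hp.1
    exact inner_cross_radialRetraction _ _ _
  have eη (p) (hp : p ∈ rect A B) : radialRetraction R (η p) = η p :=
    radialRetraction_of_norm_le hR0 (by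
      rw [nη p hp]
      exact (hR₁ _ hp.1).trans ((le_max_left _ _).trans (le_max_left _ _)))
  have eω (p) (hp : p ∈ rect A B) : radialRetraction R (ω p) = ω p :=
    radialRetraction_of_norm_le hR0 (by
      rw [nω p hp]
      exact (hR₂ _ hp.2).trans ((le_max_right _ _).trans (le_max_left _ _)))
  refine ⟨η, ω, hη, hω, fun u hu => (hη0 u hu).trans (hx₀e hu),
    fun v hv => (hω0 v hv).trans (hy₀e hv), fun p hp => ?_, fun p hp => ?_, nη, nω⟩
  · simpa only [eη p hp, eω p hp] using hηv p hp
  · simpa only [eη p hp, eω p hp] using hωu p hp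

/-- A unit curve on an interval, with continuous derivative. -/
structure IsUnitCurve (a : ℝ) (c c' : ℝ → E3) : Prop where
  hasDeriv : ∀ t ∈ Icc 0 a, HasDerivWithinAt c (c' t) (Icc 0 a) t
  continuousOn_deriv : ContinuousOn c' (Icc 0 a)
  norm_eq_one : ∀ t ∈ Icc 0 a, ‖c t‖ = 1

theorem IsUnitCurve.continuousOn {a : ℝ} {c c' : ℝ → E3} (h : IsUnitCurve a c c') :
    ContinuousOn c (Icc 0 a) := fun t ht => (h.hasDeriv t ht).continuousWithinAt

theorem IsUnitCurve.inner_eq_zero {a : ℝ} (ha : 0 < a) {c c' : ℝ → E3} (h : IsUnitCurve a c c')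
    {t : ℝ} (ht : t ∈ Icc 0 a) : ⟪c t, c' t⟫ = 0 :=
  inner_deriv_eq_zero_of_norm_eq_one ha h.hasDeriv h.norm_eq_one ht

theorem IsUnitCurve.cross_cross {a : ℝ} (ha : 0 < a) {c c' : ℝ → E3} (h : IsUnitCurve a c c')
    {t : ℝ} (ht : t ∈ Icc 0 a) : cross (cross (c t) (c' t)) (c t) = c' t := by
  rw [PSF.cross_cross, real_inner_self_eq_norm_sq, h.norm_eq_one t ht, real_inner_comm,
    h.inner_eq_zero ha ht]
  simp

theorem IsUnitCurve.norm_cross {a : ℝ} (ha : 0 < a) {c c' : ℝ → E3} (h : IsUnitCurve a c c')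
    {t : ℝ} (ht : t ∈ Icc 0 a) : ‖cross (c t) (c' t)‖ = ‖c' t‖ := by
  have := inner_cross_cross (c t) (c' t) (c t) (c' t)
  rw [h.inner_eq_zero ha ht, real_inner_self_eq_norm_sq, real_inner_self_eq_norm_sq,
    real_inner_self_eq_norm_sq, h.norm_eq_one t ht] at this
  refine (sq_eq_sq₀ (norm_nonneg _) (norm_nonneg _)).1 ?_
  linarith

theorem normal_defect_deriv (n η ω b : E3) :
    (-⟪η, ω⟫) • n - (cross η b + cross (cross ω η) n)
      = -(⟪n, ω⟫ • η) - cross η (b - cross ω n) := by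
  apply ext_three <;>
    simp only [cross_apply_zero, cross_apply_one, cross_apply_two, inner_eq_sum, PiLp.sub_apply,
      PiLp.add_apply, PiLp.neg_apply, PiLp.smul_apply, smul_eq_mul] <;> ring

theorem inner_defect_deriv (n η ω b : E3) :
    ⟪n, cross ω η⟫ + ⟪b, η⟫ = ⟪b - cross ω n, η⟫ := by
  simp only [cross_apply_zero, cross_apply_one, cross_apply_two, inner_eq_sum, PiLp.sub_apply]
  ring

/-- The field `N` with `N_u = η × N` and `N_v = ω × N`. -/
theorem exists_normal_field {A B : ℝ} (hA : 0 < A) (hB : 0 < B) {c₁ c₁' c₂ c₂' : ℝ → E3}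
    (h₁ : IsUnitCurve A c₁ c₁') (h₂ : IsUnitCurve B c₂ c₂') (h0 : c₁ 0 = c₂ 0)
    {η ω : ℝ × ℝ → E3} (hη : Continuous η) (hω : Continuous ω)
    (hη0 : ∀ u ∈ Icc 0 A, η (u, 0) = cross (c₁ u) (c₁' u))
    (hω0 : ∀ v ∈ Icc 0 B, ω (0, v) = cross (c₂ v) (c₂' v))
    (hηv : ∀ p ∈ rect A B,
      HasDerivWithinAt (fun t => η (p.1, t)) (cross (ω p) (η p)) (Icc 0 B) p.2)
    (hωu : ∀ p ∈ rect A B,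
      HasDerivWithinAt (fun t => ω (t, p.2)) (cross (η p) (ω p)) (Icc 0 A) p.1) :
    ∃ N : ℝ × ℝ → E3,
      HasPartials (Icc 0 A) (Icc 0 B) N (fun p => cross (η p) (N p)) (fun p => cross (ω p) (N p))
        (fun p => (-⟪η p, ω p⟫) • N p) ∧
      (∀ u ∈ Icc 0 A, N (u, 0) = c₁ u) ∧ (∀ v ∈ Icc 0 B, N (0, v) = c₂ v) ∧
      (∀ p ∈ rect A B, ‖N p‖ = 1 ∧ ⟪N p, η p⟫ = 0 ∧ ⟪N p, ω p⟫ = 0) := by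
  obtain ⟨n₀, hn₀, hn₀e⟩ := exists_continuous_extension hA.le h₁.continuousOn
  obtain ⟨a₀, ha₀, ha₀e⟩ := exists_continuous_extension hA.le h₁.continuousOn_deriv
  obtain ⟨b₀, hb₀, hb₀e⟩ := exists_continuous_extension hB.le h₂.continuousOn_deriv
  set ν : ℝ × ℝ → ℝ := fun p => -⟪η p, ω p⟫ with hν
  have hνc : Continuous ν := by fun_prop
  obtain ⟨C, hC0, hC⟩ := exists_norm_le_of_continuousOn (isCompact_rect A B) hνc.continuousOn
  have lip (p) (hp : p ∈ rect A B) (n n' : E3) : ‖ν p • n - ν p • n'‖ ≤ C * ‖n - n'‖ := by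
    rw [← smul_sub, norm_smul]
    gcongr
    exact hC p hp
  obtain ⟨x, b, hx, hb, hx0, hb0, hxv, hbu⟩ := exists_goursat_solution (K := C + 1)
    (E := E3 × E3) (F := E3) hA.le hB.le (by positivity)
    (f := fun p z => (z.2, ν p • z.1.1)) (g := fun p z => ν p • z.1.1)
    (by fun_prop) (by fun_prop)
    (fun p hp z z' => by
      have h1 : ‖z.1.1 - z'.1.1‖ ≤ ‖z - z'‖ := (norm_fst_le (z.1 - z'.1)).trans (norm_fst_le (z - z'))
      have h2 : ‖z.2 - z'.2‖ ≤ ‖z - z'‖ := norm_snd_le (z - z')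
      refine max_le ?_ ?_
      · refine h2.trans ?_
        nlinarith [norm_nonneg (z - z')]
      · refine (lip p hp _ _).trans ?_
        nlinarith [norm_nonneg (z - z')])
    (fun p hp z z' => by
      have h1 : ‖z.1.1 - z'.1.1‖ ≤ ‖z - z'‖ := (norm_fst_le (z.1 - z'.1)).trans (norm_fst_le (z - z'))
      refine (lip p hp _ _).trans ?_
      nlinarith [norm_nonneg (z - z')])
    (x₀ := fun u => (n₀ u, a₀ u)) (y₀ := b₀) (by fun_prop) hb₀
  set N : ℝ × ℝ → E3 := fun p => (x p).1 with hN
  set α : ℝ × ℝ → E3 := fun p => (x p).2 with hα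
  have hNc : Continuous N := by fun_prop
  have hαc : Continuous α := by fun_prop
  have hNv (p) (hp : p ∈ rect A B) : HasDerivWithinAt (fun t => N (p.1, t)) (b p) (Icc 0 B) p.2 :=
    (hxv p hp).fst
  have hαv (p) (hp : p ∈ rect A B) :
      HasDerivWithinAt (fun t => α (p.1, t)) (ν p • N p) (Icc 0 B) p.2 := (hxv p hp).snd
  have hbu (p) (hp : p ∈ rect A B) :
      HasDerivWithinAt (fun t => b (t, p.2)) (ν p • N p) (Icc 0 A) p.1 := hbu p hp
  have hN0 (u) (hu : u ∈ Icc 0 A) : N (u, 0) = c₁ u := by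
    rw [← hn₀e hu]; exact congrArg Prod.fst (hx0 u hu)
  have hα0 (u) (hu : u ∈ Icc 0 A) : α (u, 0) = c₁' u := by
    rw [← ha₀e hu]; exact congrArg Prod.snd (hx0 u hu)
  have hb0 (v) (hv : v ∈ Icc 0 B) : b (0, v) = c₂' v := by
    rw [← hb₀e hv]; exact hb0 v hv
  have h0A : (0 : ℝ) ∈ Icc 0 A := ⟨le_rfl, hA.le⟩
  have h0B : (0 : ℝ) ∈ Icc 0 B := ⟨le_rfl, hB.le⟩
  have hNu := hasDerivWithinAt_fst_of_mixed (N := N) (α := α) (β := b)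
    (γ := fun p => ν p • N p) (by fun_prop) hNv hαv hbu (fun u hu => by
      rw [hα0 u hu]; exact (h₁.hasDeriv u hu).congr hN0 (hN0 u hu))
  have hN0' : ∀ v ∈ Icc 0 B, N (0, v) = c₂ v :=
    eqOn_Icc_of_hasDerivWithinAt (f := fun v => N (0, v))
      (fun v hv => hNv (0, v) ⟨h0A, hv⟩)
      (fun v hv => by rw [hb0 v hv]; exact h₂.hasDeriv v hv) (by rw [hN0 0 h0A, h0])
  obtain ⟨K₁, hK₁0, hK₁⟩ := exists_norm_le_of_continuousOn (isCompact_rect A B) hη.continuousOn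
  obtain ⟨K₂, hK₂0, hK₂⟩ := exists_norm_le_of_continuousOn (isCompact_rect A B) hω.continuousOn
  have bound (K : ℝ) (e Z : E3) (q : ℝ) (s : ℝ) (hs : 0 ≤ s) (he : ‖e‖ ≤ K) (hK : K ≤ K₁ + K₂) :
      ‖(-(q • e) - cross e Z, ⟪Z, e⟫)‖ ≤ 2 * (K₁ + K₂) * (s + ‖(Z, q)‖) := by
    have h1 : ‖Z‖ ≤ ‖(Z, q)‖ := norm_fst_le (Z, q)
    have h2 : ‖q‖ ≤ ‖(Z, q)‖ := norm_snd_le (Z, q)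
    have h0 := norm_nonneg (Z, q)
    have hK0 : 0 ≤ K := (norm_nonneg _).trans he
    have h3 : K * ‖(Z, q)‖ ≤ (K₁ + K₂) * ‖(Z, q)‖ := by gcongr
    have h4 : 0 ≤ (K₁ + K₂) * s := by positivity
    refine max_le ?_ ?_
    · refine (norm_sub_le _ _).trans ?_
      rw [norm_neg, norm_smul]
      have h5 : ‖q‖ * ‖e‖ ≤ ‖(Z, q)‖ * K := by gcongr
      have h6 : ‖cross e Z‖ ≤ K * ‖(Z, q)‖ := (norm_cross_le _ _).trans (by gcongr)
      linarith
    · have h5 : ‖⟪Z, e⟫‖ ≤ ‖(Z, q)‖ * K := (norm_inner_le_norm _ _).trans (by gcongr)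
      have h6 : 0 ≤ K * ‖(Z, q)‖ := by positivity
      simp only
      linarith
  have key := goursat_eq_zero (a := A) (b := B) (K := 2 * (K₁ + K₂)) (by positivity)
    (x := fun p => (α p - cross (η p) (N p), ⟪N p, η p⟫))
    (x' := fun p => (-(⟪N p, ω p⟫ • η p) - cross (η p) (b p - cross (ω p) (N p)),
      ⟪b p - cross (ω p) (N p), η p⟫))
    (y := fun p => (b p - cross (ω p) (N p), ⟪N p, ω p⟫))
    (y' := fun p => (-(⟪N p, η p⟫ • ω p) - cross (ω p) (α p - cross (η p) (N p)),
      ⟪α p - cross (η p) (N p), ω p⟫))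
    (by have := hη.cross3 hNc; fun_prop) (by have := hω.cross3 hNc; fun_prop)
    (fun u hu => by
      rw [hα0 u hu, hN0 u hu, hη0 u hu, h₁.cross_cross hA hu, sub_self, inner_cross_self_left]
      rfl)
    (fun v hv => by
      rw [hb0 v hv, hN0' v hv, hω0 v hv, h₂.cross_cross hB hv, sub_self, inner_cross_self_left]
      rfl)
    (fun p hp => by
      refine (((hαv p hp).sub ((hηv p hp).cross3 (hNv p hp))).prodMk
        ((hNv p hp).inner ℝ (hηv p hp))).congr_deriv (Prod.ext ?_ ?_)
      · exact normal_defect_deriv _ _ _ _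
      · exact inner_defect_deriv _ _ _ _)
    (fun p hp => by
      refine (((hbu p hp).sub ((hωu p hp).cross3 (hNu p hp))).prodMk
        ((hNu p hp).inner ℝ (hωu p hp))).congr_deriv (Prod.ext ?_ ?_)
      · simp only [hν]
        rw [real_inner_comm (ω p) (η p)]
        exact normal_defect_deriv _ _ _ _
      · exact inner_defect_deriv _ _ _ _)
    (fun p hp => bound K₁ _ _ _ _ (norm_nonneg _) (hK₁ p hp) (by linarith))
    (fun p hp => (bound K₂ (ω p) (α p - cross (η p) (N p)) ⟪N p, η p⟫
      ‖(b p - cross (ω p) (N p), ⟪N p, ω p⟫)‖ (norm_nonneg _) (hK₂ p hp) (by linarith)).trans_eq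
      (by rw [add_comm ‖_‖]))
  have hαe (p) (hp : p ∈ rect A B) : α p = cross (η p) (N p) :=
    sub_eq_zero.1 (congrArg Prod.fst (key p hp).1)
  have hbe (p) (hp : p ∈ rect A B) : b p = cross (ω p) (N p) :=
    sub_eq_zero.1 (congrArg Prod.fst (key p hp).2)
  refine ⟨N, ⟨hNc.continuousOn, (hη.cross3 hNc).continuousOn, (hω.cross3 hNc).continuousOn,
    (hνc.smul hNc).continuousOn, fun p hp => ?_, fun p hp => ?_, fun p hp => ?_, fun p hp => ?_⟩,
    hN0, hN0', fun p hp => ⟨?_, congrArg Prod.snd (key p hp).1, congrArg Prod.snd (key p hp).2⟩⟩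
  · rw [← hαe p hp]; exact hNu p hp
  · rw [← hbe p hp]; exact hNv p hp
  · exact (hαv p hp).congr (fun t ht => (hαe (p.1, t) ⟨hp.1, ht⟩).symm) (hαe p hp).symm
  · exact (hbu p hp).congr (fun t ht => (hbe (t, p.2) ⟨ht, hp.2⟩).symm) (hbe p hp).symm
  · rw [norm_eq_of_inner_deriv_eq_zero (f := fun t => N (p.1, t))
      (fun t ht => hNv (p.1, t) ⟨hp.1, ht⟩) (fun t ht => ?_) hp.2]
    · rw [hN0 _ hp.1, h₁.norm_eq_one _ hp.1]
    · rw [hbe (p.1, t) ⟨hp.1, ht⟩, inner_cross_self_right]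

/-- The Goursat problem for PS-fronts: the two asymptotic curves through a corner, with the normal
along them, can be prescribed. -/
theorem exists_isPSFrontWith_of_curves {A B : ℝ} (hA : 0 < A) (hB : 0 < B)
    {c₁ c₁' c₂ c₂' γ₁ γ₂ : ℝ → E3} (h₁ : IsUnitCurve A c₁ c₁') (h₂ : IsUnitCurve B c₂ c₂')
    (hc₁ : ∀ t ∈ Icc 0 A, c₁' t ≠ 0) (hc₂ : ∀ t ∈ Icc 0 B, c₂' t ≠ 0) (h0 : c₁ 0 = c₂ 0)
    (hγ₁ : ∀ t ∈ Icc 0 A, HasDerivWithinAt γ₁ (cross (c₁' t) (c₁ t)) (Icc 0 A) t)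
    (hγ₂ : ∀ t ∈ Icc 0 B, HasDerivWithinAt γ₂ (-cross (c₂' t) (c₂ t)) (Icc 0 B) t)
    (hγ0 : γ₁ 0 = γ₂ 0) :
    ∃ r N : ℝ × ℝ → E3, IsPSFrontWith (rect A B) r N ∧
      (∀ u ∈ Icc 0 A, r (u, 0) = γ₁ u ∧ N (u, 0) = c₁ u) ∧
      (∀ v ∈ Icc 0 B, r (0, v) = γ₂ v ∧ N (0, v) = c₂ v) := by
  obtain ⟨η, ω, hη, hω, hη0, hω0, hηv, hωu, hηn, hωn⟩ := exists_rotation_fields hA.le hB.le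
    (h₁.continuousOn.cross3 h₁.continuousOn_deriv) (h₂.continuousOn.cross3 h₂.continuousOn_deriv)
  obtain ⟨N, hN, hN0, hN0', hNp⟩ :=
    exists_normal_field hA hB h₁ h₂ h0 hη hω hη0 hω0 hηv hωu
  have hI := uniqueDiffOn_Icc hA
  have hJ := uniqueDiffOn_Icc hB
  have h0A : (0 : ℝ) ∈ Icc 0 A := ⟨le_rfl, hA.le⟩
  have h0B : (0 : ℝ) ∈ Icc 0 B := ⟨le_rfl, hB.le⟩
  set r : ℝ × ℝ → E3 := fun p => γ₁ p.1 + ∫ t in (0 : ℝ)..p.2, ω (p.1, t) with hr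
  have hrv (p) (hp : p ∈ rect A B) : HasDerivWithinAt (fun t => r (p.1, t)) (ω p) (Icc 0 B) p.2 := by
    have hc : Continuous fun t => ω (p.1, t) := by fun_prop
    exact ((hc.integral_hasStrictDerivAt 0 p.2).hasDerivAt.const_add (γ₁ p.1)).hasDerivWithinAt
  have hr0 (u : ℝ) : r (u, 0) = γ₁ u := by simp [hr]
  have hηu' (p) (hp : p ∈ rect A B) :
      HasDerivWithinAt (fun t => -η (p.1, t)) (cross (η p) (ω p)) (Icc 0 B) p.2 :=
    (hηv p hp).fun_neg.congr_deriv (neg_cross _ _)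
  have hru := hasDerivWithinAt_fst_of_mixed (N := r) (α := fun p => -η p) (β := ω)
    (γ := fun p => cross (η p) (ω p)) (hη.cross3 hω).continuousOn hrv hηu' hωu (fun u hu => by
      simp only [hr0]
      rw [hη0 u hu, neg_cross]
      exact hγ₁ u hu)
  have hrc : ContinuousOn r (rect A B) := by
    refine ContinuousOn.add ?_ ?_
    · exact ContinuousOn.comp (t := Icc 0 A) (fun t ht => (hγ₁ t ht).continuousWithinAt)
        continuousOn_fst fun p hp => hp.1
    · refine (intervalIntegral.continuous_parametric_intervalIntegral_of_continuous
        (f := fun (p : ℝ × ℝ) t => ω (p.1, t)) ?_ continuous_snd).continuousOn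
      exact hω.comp (f := fun q : (ℝ × ℝ) × ℝ => (q.1.1, q.2)) (by fun_prop)
  have hrP : HasPartials (Icc 0 A) (Icc 0 B) r (fun p => -η p) ω (fun p => cross (η p) (ω p)) :=
    ⟨hrc, hη.neg.continuousOn, hω.continuousOn, (hη.cross3 hω).continuousOn, hru, hrv, hηu', hωu⟩
  have hr0' : ∀ v ∈ Icc 0 B, r (0, v) = γ₂ v :=
    eqOn_Icc_of_hasDerivWithinAt (f := fun v => r (0, v)) (fun v hv => hrv (0, v) ⟨h0A, hv⟩)
      (fun v hv => by rw [hω0 v hv, ← neg_cross]; exact hγ₂ v hv) (by simp [hr0, hγ0])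
  have posη (p) (hp : p ∈ rect A B) : 0 < ⟪η p, η p⟫ := by
    rw [real_inner_self_eq_norm_sq, hηn p hp, h₁.norm_cross hA hp.1]
    have := norm_pos_iff.2 (hc₁ _ hp.1)
    positivity
  have posω (p) (hp : p ∈ rect A B) : 0 < ⟪ω p, ω p⟫ := by
    rw [real_inner_self_eq_norm_sq, hωn p hp, h₂.norm_cross hB hp.2]
    have := norm_pos_iff.2 (hc₂ _ hp.2)
    positivity
  have hNN (p) (hp : p ∈ rect A B) : ⟪N p, N p⟫ = 1 := by
    rw [real_inner_self_eq_norm_sq, (hNp p hp).1, one_pow]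
  refine ⟨r, N, ⟨⟨hN.isC1M hI hJ, fun p hp => (hNp p hp).1, fun p hp => ?_, fun p hp => ?_,
    ⟨fun p => -⟪η p, ω p⟫, by fun_prop, fun p hp => ?_⟩⟩, hrP.isC1M hI hJ, fun p hp => ?_,
    fun p hp => ?_, fun p hp => ?_, fun p hp => ?_⟩, fun u hu => ⟨hr0 u, hN0 u hu⟩,
    fun v hv => ⟨hr0' v hv, hN0' v hv⟩⟩
  · rw [rect, hN.eqOn_partialU hI hp]
    simp only
    rw [inner_cross_cross, hNN p hp, real_inner_comm, (hNp p hp).2.1]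
    linarith [posη p hp]
  · rw [rect, hN.eqOn_partialV hJ hp]
    simp only
    rw [inner_cross_cross, hNN p hp, real_inner_comm, (hNp p hp).2.2]
    linarith [posω p hp]
  · rw [rect, hN.eqOn_partialVU hI hJ hp, hN.eqOn_partialUV hI hJ hp]
    exact ⟨rfl, rfl⟩
  · rw [rect, hrP.eqOn_partialU hI hp, hN.eqOn_partialU hI hp]
    simp only
    rw [cross_cross, hNN p hp, real_inner_comm, (hNp p hp).2.1]
    simp
  · rw [rect, hrP.eqOn_partialV hJ hp, hN.eqOn_partialV hJ hp]
    simp only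
    rw [cross_cross, hNN p hp, real_inner_comm, (hNp p hp).2.2]
    simp
  · rw [rect, hrP.eqOn_partialU hI hp]
    simp only
    rw [inner_neg_neg]
    exact posη p hp
  · rw [rect, hrP.eqOn_partialV hJ hp]
    exact posω p hp

section Star

/-- The oriented area of the parallelogram spanned by two vectors of the plane. -/
noncomputable def det₂ (x y : Plane) : ℝ := x 0 * y 1 - x 1 * y 0

/-- The point with coordinates `c`, `d` along the rays `i` and `i + 1`. -/
noncomputable def rayPoint (α : ℕ → ℝ) (i : ℕ) (c d : ℝ) : Plane :=
  c • rayDir α i + d • rayDir α (i + 1)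

theorem sectorPoint_of_even (α : ℕ → ℝ) {i : ℕ} (hi : Even i) (p : ℝ × ℝ) :
    sectorPoint α i p = rayPoint α i p.1 p.2 := by
  rw [sectorPoint, if_pos hi, rayPoint]

theorem sectorPoint_of_not_even (α : ℕ → ℝ) {i : ℕ} (hi : ¬Even i) (p : ℝ × ℝ) :
    sectorPoint α i p = rayPoint α i p.2 p.1 := by
  rw [sectorPoint, if_neg hi, rayPoint, add_comm]

theorem sectorDomain_of_even (l : ℕ → ℝ) {i : ℕ} (hi : Even i) :
    sectorDomain l i = Ico 0 (l i) ×ˢ Ico 0 (l (i + 1)) := by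
  rw [sectorDomain, if_pos hi]

theorem sectorDomain_of_not_even (l : ℕ → ℝ) {i : ℕ} (hi : ¬Even i) :
    sectorDomain l i = Ico 0 (l (i + 1)) ×ˢ Ico 0 (l i) := by
  rw [sectorDomain, if_neg hi]

theorem mem_sector_iff {α l : ℕ → ℝ} {i : ℕ} {x : Plane} :
    x ∈ sectorPoint α i '' sectorDomain l i ↔
      ∃ c d, 0 ≤ c ∧ c < l i ∧ 0 ≤ d ∧ d < l (i + 1) ∧ x = rayPoint α i c d := by
  by_cases hi : Even i
  · rw [sectorDomain_of_even l hi]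
    constructor
    · rintro ⟨p, ⟨h1, h2⟩, rfl⟩
      exact ⟨p.1, p.2, h1.1, h1.2, h2.1, h2.2, sectorPoint_of_even α hi p⟩
    · rintro ⟨c, d, h1, h2, h3, h4, rfl⟩
      exact ⟨(c, d), ⟨⟨h1, h2⟩, ⟨h3, h4⟩⟩, sectorPoint_of_even α hi _⟩
  · rw [sectorDomain_of_not_even l hi]
    constructor
    · rintro ⟨p, ⟨h1, h2⟩, rfl⟩
      exact ⟨p.2, p.1, h2.1, h2.2, h1.1, h1.2, sectorPoint_of_not_even α hi p⟩
    · rintro ⟨c, d, h1, h2, h3, h4, rfl⟩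
      exact ⟨(d, c), ⟨⟨h3, h4⟩, ⟨h1, h2⟩⟩, sectorPoint_of_not_even α hi _⟩

theorem rayAngle_succ (α : ℕ → ℝ) (i : ℕ) : rayAngle α (i + 1) = rayAngle α i + α i := by
  rw [rayAngle, Finset.sum_range_succ, rayAngle]

theorem rayDir_apply_zero (α : ℕ → ℝ) (i : ℕ) : rayDir α i 0 = Real.cos (rayAngle α i) := rfl

theorem rayDir_apply_one (α : ℕ → ℝ) (i : ℕ) : rayDir α i 1 = Real.sin (rayAngle α i) := rfl

theorem det₂_rayDir_succ (α : ℕ → ℝ) (i : ℕ) :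
    det₂ (rayDir α i) (rayDir α (i + 1)) = Real.sin (α i) := by
  simp only [det₂, rayDir_apply_zero, rayDir_apply_one, rayAngle_succ, Real.cos_add, Real.sin_add]
  linear_combination Real.sin (α i) * Real.sin_sq_add_cos_sq (rayAngle α i)

theorem det₂_rayDir_left (α : ℕ → ℝ) (i : ℕ) (c d : ℝ) :
    det₂ (rayDir α i) (rayPoint α i c d) = d * Real.sin (α i) := by
  rw [← det₂_rayDir_succ]
  simp only [det₂, rayPoint, PiLp.add_apply, PiLp.smul_apply, smul_eq_mul]
  ring

theorem det₂_rayDir_right (α : ℕ → ℝ) (i : ℕ) (c d : ℝ) :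
    det₂ (rayPoint α i c d) (rayDir α (i + 1)) = c * Real.sin (α i) := by
  rw [← det₂_rayDir_succ]
  simp only [det₂, rayPoint, PiLp.add_apply, PiLp.smul_apply, smul_eq_mul]
  ring

theorem plane_ext {x y : Plane} (h0 : x 0 = y 0) (h1 : x 1 = y 1) : x = y := by
  ext i
  fin_cases i <;> assumption

theorem rayPoint_det₂ {α : ℕ → ℝ} {i : ℕ} (h : Real.sin (α i) ≠ 0) (x : Plane) :
    rayPoint α i (det₂ x (rayDir α (i + 1)) / Real.sin (α i))
      (det₂ (rayDir α i) x / Real.sin (α i)) = x := by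
  have e := det₂_rayDir_succ α i
  simp only [det₂] at e
  apply plane_ext <;>
    simp only [det₂, rayPoint, PiLp.add_apply, PiLp.smul_apply, smul_eq_mul] <;> field_simp
  · linear_combination (x 0) * e
  · linear_combination (x 1) * e

theorem exists_polar (x : Plane) : ∃ ρ φ : ℝ, 0 ≤ ρ ∧ 0 ≤ φ ∧ φ < 2 * Real.pi ∧
    x 0 = ρ * Real.cos φ ∧ x 1 = ρ * Real.sin φ := by
  set z : ℂ := ⟨x 0, x 1⟩ with hz
  have h0 : x 0 = ‖z‖ * Real.cos z.arg := (Complex.norm_mul_cos_arg z).symm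
  have h1 : x 1 = ‖z‖ * Real.sin z.arg := (Complex.norm_mul_sin_arg z).symm
  rcases le_or_gt 0 z.arg with h | h
  · exact ⟨‖z‖, z.arg, norm_nonneg _, h, by linarith [Complex.arg_le_pi z, Real.pi_pos], h0, h1⟩
  · refine ⟨‖z‖, z.arg + 2 * Real.pi, norm_nonneg _, ?_, by linarith, ?_, ?_⟩
    · linarith [Complex.neg_pi_lt_arg z]
    · rwa [Real.cos_add_two_pi]
    · rwa [Real.sin_add_two_pi]

namespace IsStar

variable {m : ℕ} {α l : ℕ → ℝ}

theorem order_pos (h : IsStar m α l) : 0 < m := by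
  rcases Nat.eq_zero_or_pos m with rfl | hm
  · have := h.angle_sum
    simp only [mul_zero, Finset.range_zero, Finset.sum_empty] at this
    linarith [Real.pi_pos]
  · exact hm

theorem rayAngle_two_mul (h : IsStar m α l) : rayAngle α (2 * m) = 2 * Real.pi := h.angle_sum

theorem sin_pos (h : IsStar m α l) {i : ℕ} (hi : i < 2 * m) : 0 < Real.sin (α i) :=
  Real.sin_pos_of_pos_of_lt_pi (h.angle_pos i hi) (h.angle_lt i hi)

theorem rayAngle_mono (h : IsStar m α l) {i j : ℕ} (hij : i ≤ j) (hj : j ≤ 2 * m) :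
    rayAngle α i ≤ rayAngle α j := by
  refine Finset.sum_le_sum_of_subset_of_nonneg (Finset.range_mono hij) fun k hk _ => ?_
  exact (h.angle_pos k ((Finset.mem_range.1 hk).trans_le hj)).le

theorem rayAngle_nonneg (h : IsStar m α l) {i : ℕ} (hi : i ≤ 2 * m) : 0 ≤ rayAngle α i := by
  simpa [rayAngle] using h.rayAngle_mono (Nat.zero_le i) hi

theorem rayAngle_le (h : IsStar m α l) {i : ℕ} (hi : i ≤ 2 * m) : rayAngle α i ≤ 2 * Real.pi := by
  rw [← h.rayAngle_two_mul]; exact h.rayAngle_mono hi le_rfl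

theorem rayDir_succ_mod (h : IsStar m α l) {i : ℕ} (hi : i < 2 * m) :
    rayDir α ((i + 1) % (2 * m)) = rayDir α (i + 1) := by
  rcases Nat.lt_or_ge (i + 1) (2 * m) with h1 | h1
  · rw [Nat.mod_eq_of_lt h1]
  · have : i + 1 = 2 * m := by omega
    rw [this, Nat.mod_self, rayDir, rayDir, h.rayAngle_two_mul]
    simp [rayAngle]

theorem length_succ_mod (h : IsStar m α l) {i : ℕ} (hi : i < 2 * m) :
    l ((i + 1) % (2 * m)) = l (i + 1) := by
  rcases Nat.lt_or_ge (i + 1) (2 * m) with h1 | h1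
  · rw [Nat.mod_eq_of_lt h1]
  · have : i + 1 = 2 * m := by omega
    rw [this, Nat.mod_self, h.length_closed]

theorem exists_rayAngle_le_lt (h : IsStar m α l) {φ : ℝ} (h0 : 0 ≤ φ) (h1 : φ < 2 * Real.pi) :
    ∃ i < 2 * m, rayAngle α i ≤ φ ∧ φ < rayAngle α (i + 1) := by
  have key : ∀ n, φ < rayAngle α n → ∃ i < n, rayAngle α i ≤ φ ∧ φ < rayAngle α (i + 1) := by
    intro n
    induction n with
    | zero => intro hn; simp only [rayAngle, Finset.range_zero, Finset.sum_empty] at hn; linarith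
    | succ n ih =>
      intro hn
      rcases le_or_gt (rayAngle α n) φ with h2 | h2
      · exact ⟨n, Nat.lt_succ_self n, h2, hn⟩
      · obtain ⟨i, hi, h3⟩ := ih h2
        exact ⟨i, hi.trans (Nat.lt_succ_self n), h3⟩
  exact key _ (by rw [h.rayAngle_two_mul]; exact h1)

/-- Every point other than the origin lies in exactly one half-open cone: existence. -/
theorem exists_eq_rayPoint (h : IsStar m α l) {x : Plane} (hx : x ≠ 0) :
    ∃ i < 2 * m, ∃ c d, 0 < c ∧ 0 ≤ d ∧ x = rayPoint α i c d := by
  obtain ⟨ρ, φ, hρ, hφ0, hφ1, h0, h1⟩ := exists_polar x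
  have hρ0 : 0 < ρ := by
    rcases hρ.eq_or_lt with rfl | hρ
    · exact absurd (plane_ext (by simp [h0]) (by simp [h1])) hx
    · exact hρ
  obtain ⟨i, hi, h2, h3⟩ := h.exists_rayAngle_le_lt hφ0 hφ1
  have hs := h.sin_pos hi
  have hα := h.angle_lt i hi
  rw [rayAngle_succ] at h3
  refine ⟨i, hi, _, _, div_pos ?_ hs, div_nonneg ?_ hs.le, (rayPoint_det₂ hs.ne' x).symm⟩
  · have : det₂ x (rayDir α (i + 1)) = ρ * Real.sin (rayAngle α i + α i - φ) := by
      rw [Real.sin_sub, det₂, rayDir_apply_zero, rayDir_apply_one, h0, h1, rayAngle_succ]; ring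
    rw [this]
    exact mul_pos hρ0 (Real.sin_pos_of_pos_of_lt_pi (by linarith) (by linarith))
  · have : det₂ (rayDir α i) x = ρ * Real.sin (φ - rayAngle α i) := by
      rw [Real.sin_sub, det₂, rayDir_apply_zero, rayDir_apply_one, h0, h1]; ring
    rw [this]
    exact mul_nonneg hρ (Real.sin_nonneg_of_nonneg_of_le_pi (by linarith) (by linarith))

theorem rayAngle_le_of_polar (h : IsStar m α l) {i : ℕ} (hi : i < 2 * m) {c d ρ φ : ℝ}
    (hc : 0 < c) (hd : 0 ≤ d) (hρ : 0 ≤ ρ) (hφ0 : 0 ≤ φ) (hφ1 : φ < 2 * Real.pi)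
    (h0 : rayPoint α i c d 0 = ρ * Real.cos φ) (h1 : rayPoint α i c d 1 = ρ * Real.sin φ) :
    rayAngle α i ≤ φ ∧ φ < rayAngle α (i + 1) := by
  have hs := h.sin_pos hi
  have hα0 := h.angle_pos i hi
  have hα := h.angle_lt i hi
  have hβ0 := h.rayAngle_nonneg hi.le
  have hβ1 := h.rayAngle_le (i := i + 1) hi
  rw [rayAngle_succ] at hβ1 ⊢
  have e1 : ρ * Real.sin (rayAngle α i + α i - φ) = c * Real.sin (α i) := by
    rw [← det₂_rayDir_right α i c d, Real.sin_sub, det₂, rayDir_apply_zero, rayDir_apply_one, h0, h1,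
      rayAngle_succ]; ring
  have e2 : ρ * Real.sin (φ - rayAngle α i) = d * Real.sin (α i) := by
    rw [← det₂_rayDir_left α i c d, Real.sin_sub, det₂, rayDir_apply_zero, rayDir_apply_one, h0, h1]
    ring
  have p1 : 0 < Real.sin (rayAngle α i + α i - φ) := by
    by_contra hcon
    nlinarith [mul_pos hc hs, mul_nonneg hρ (neg_nonneg.2 (not_lt.1 hcon))]
  have hρ0 : 0 < ρ := by
    rcases hρ.eq_or_lt with rfl | hρ
    · nlinarith [mul_pos hc hs]
    · exact hρ
  have p2 : 0 ≤ Real.sin (φ - rayAngle α i) := by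
    by_contra hcon
    nlinarith [mul_nonneg hd hs.le, mul_pos hρ0 (neg_pos.2 (not_le.1 hcon))]
  constructor
  · by_contra hcon
    rcases le_or_gt (φ - rayAngle α i) (-Real.pi) with h2 | h2
    · have : Real.sin (rayAngle α i + α i - φ) ≤ 0 := by
        rw [← Real.sin_sub_two_pi]
        exact Real.sin_nonpos_of_nonpos_of_neg_pi_le (by linarith) (by linarith)
      linarith
    · linarith [Real.sin_neg_of_neg_of_neg_pi_lt (x := φ - rayAngle α i) (by linarith) h2]
  · by_contra hcon
    rcases le_or_gt (-Real.pi) (rayAngle α i + α i - φ) with h2 | h2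
    · linarith [Real.sin_nonpos_of_nonpos_of_neg_pi_le (x := rayAngle α i + α i - φ)
        (by linarith) h2]
    · have : Real.sin (φ - rayAngle α i) < 0 := by
        rw [← Real.sin_sub_two_pi]
        exact Real.sin_neg_of_neg_of_neg_pi_lt (by linarith) (by linarith)
      linarith

theorem eq_of_rayPoint_eq_of_pos (h : IsStar m α l) {i j : ℕ} (hi : i < 2 * m) (hj : j < 2 * m)
    {c d c' d' : ℝ} (hc : 0 < c) (hd : 0 ≤ d) (hc' : 0 < c') (hd' : 0 ≤ d')
    (e : rayPoint α i c d = rayPoint α j c' d') : i = j := by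
  obtain ⟨ρ, φ, hρ, hφ0, hφ1, h0, h1⟩ := exists_polar (rayPoint α i c d)
  obtain ⟨a1, a2⟩ := h.rayAngle_le_of_polar hi hc hd hρ hφ0 hφ1 h0 h1
  rw [e] at h0 h1
  obtain ⟨b1, b2⟩ := h.rayAngle_le_of_polar hj hc' hd' hρ hφ0 hφ1 h0 h1
  rcases lt_trichotomy i j with hij | hij | hij
  · linarith [h.rayAngle_mono (i := i + 1) hij hj.le]
  · exact hij
  · linarith [h.rayAngle_mono (i := j + 1) hij hi.le]

theorem rayPoint_zero_left (h : IsStar m α l) {i : ℕ} (hi : i < 2 * m) (d : ℝ) :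
    rayPoint α i 0 d = rayPoint α ((i + 1) % (2 * m)) d 0 := by
  rw [rayPoint, rayPoint, h.rayDir_succ_mod hi]
  simp

theorem coords_eq_of_rayPoint_eq (h : IsStar m α l) {i : ℕ} (hi : i < 2 * m) {c d c' d' : ℝ}
    (e : rayPoint α i c d = rayPoint α i c' d') : c = c' ∧ d = d' := by
  have hs := (h.sin_pos hi).ne'
  constructor
  · have := congrArg (fun x => det₂ x (rayDir α (i + 1))) e
    simp only [det₂_rayDir_right] at this
    exact mul_right_cancel₀ hs this
  · have := congrArg (fun x => det₂ (rayDir α i) x) e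
    simp only [det₂_rayDir_left] at this
    exact mul_right_cancel₀ hs this

theorem succ_mod_lt (h : IsStar m α l) (i : ℕ) : (i + 1) % (2 * m) < 2 * m :=
  Nat.mod_lt _ (by have := h.order_pos; omega)

/-- Two closed sectors of a star meet at the centre, or coincide, or share a ray. -/
theorem rayPoint_eq_cases (h : IsStar m α l) {i j : ℕ} (hi : i < 2 * m) (hj : j < 2 * m)
    {c d c' d' : ℝ} (hc : 0 ≤ c) (hd : 0 ≤ d) (hc' : 0 ≤ c') (hd' : 0 ≤ d')
    (e : rayPoint α i c d = rayPoint α j c' d') :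
    (c = 0 ∧ d = 0 ∧ c' = 0 ∧ d' = 0) ∨ (i = j ∧ c = c' ∧ d = d') ∨
      (j = (i + 1) % (2 * m) ∧ c = 0 ∧ d' = 0 ∧ d = c') ∨
      (i = (j + 1) % (2 * m) ∧ c' = 0 ∧ d = 0 ∧ d' = c) := by
  have zero {k : ℕ} (hk : k < 2 * m) {s t : ℝ} (e : rayPoint α k s t = rayPoint α k 0 0) :
      s = 0 ∧ t = 0 := h.coords_eq_of_rayPoint_eq hk e
  have rz (k k' : ℕ) : rayPoint α k 0 0 = rayPoint α k' 0 0 := by simp [rayPoint]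
  rcases hc.eq_or_lt with rfl | hc0
  · rcases hd.eq_or_lt with rfl | hd0
    · have := zero hj (e.symm.trans (rz i j))
      exact Or.inl ⟨rfl, rfl, this.1, this.2⟩
    rw [h.rayPoint_zero_left hi] at e
    have hi' := h.succ_mod_lt i
    rcases hc'.eq_or_lt with rfl | hc0'
    · rcases hd'.eq_or_lt with rfl | hd0'
      · exact absurd (zero hi' (e.trans (rz _ _))).1 hd0.ne'
      rw [h.rayPoint_zero_left hj] at e
      have e' := h.eq_of_rayPoint_eq_of_pos hi' (h.succ_mod_lt j) hd0 le_rfl hd0' le_rfl e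
      rw [← e'] at e
      have hij : i = j := by
        have := Nat.ModEq.add_right_cancel' 1 (show i + 1 ≡ j + 1 [MOD 2 * m] from e')
        rwa [Nat.ModEq, Nat.mod_eq_of_lt hi, Nat.mod_eq_of_lt hj] at this
      exact Or.inr (Or.inl ⟨hij, rfl, (h.coords_eq_of_rayPoint_eq hi' e).1⟩)
    · have e' := h.eq_of_rayPoint_eq_of_pos hi' hj hd0 le_rfl hc0' hd' e
      rw [e'] at e
      have := h.coords_eq_of_rayPoint_eq hj e
      exact Or.inr (Or.inr (Or.inl ⟨e'.symm, rfl, this.2.symm, this.1⟩))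
  · rcases hc'.eq_or_lt with rfl | hc0'
    · rcases hd'.eq_or_lt with rfl | hd0'
      · exact absurd (zero hi (e.trans (rz _ _))).1 hc0.ne'
      rw [h.rayPoint_zero_left hj] at e
      have e' := h.eq_of_rayPoint_eq_of_pos hi (h.succ_mod_lt j) hc0 hd hd0' le_rfl e
      rw [← e'] at e
      have := h.coords_eq_of_rayPoint_eq hi e
      exact Or.inr (Or.inr (Or.inr ⟨e', rfl, this.2, this.1.symm⟩))
    · have e' := h.eq_of_rayPoint_eq_of_pos hi hj hc0 hd hc0' hd' e
      subst e'
      exact Or.inr (Or.inl ⟨rfl, h.coords_eq_of_rayPoint_eq hi e⟩)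

end IsStar

/-- The closed cone between the rays `i` and `i + 1`. -/
def cone (α : ℕ → ℝ) (i : ℕ) : Set Plane :=
  {x | 0 ≤ det₂ x (rayDir α (i + 1)) ∧ 0 ≤ det₂ (rayDir α i) x}

theorem continuous_det₂_left (y : Plane) : Continuous fun x => det₂ x y := by
  unfold det₂; fun_prop

theorem continuous_det₂_right (y : Plane) : Continuous fun x => det₂ y x := by
  unfold det₂; fun_prop

theorem isClosed_cone (α : ℕ → ℝ) (i : ℕ) : IsClosed (cone α i) :=
  (isClosed_le continuous_const (continuous_det₂_left _)).inter
    (isClosed_le continuous_const (continuous_det₂_right _))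

namespace IsStar

variable {m : ℕ} {α l : ℕ → ℝ}

theorem rayPoint_mem_cone (h : IsStar m α l) {i : ℕ} (hi : i < 2 * m) {c d : ℝ} (hc : 0 ≤ c)
    (hd : 0 ≤ d) : rayPoint α i c d ∈ cone α i := by
  have hs := h.sin_pos hi
  refine ⟨?_, ?_⟩
  · rw [det₂_rayDir_right]; positivity
  · rw [det₂_rayDir_left]; positivity

theorem exists_rayPoint_of_mem_cone (h : IsStar m α l) {i : ℕ} (hi : i < 2 * m) {x : Plane}
    (hx : x ∈ cone α i) : ∃ c d, 0 ≤ c ∧ 0 ≤ d ∧ x = rayPoint α i c d :=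
  have hs := h.sin_pos hi
  ⟨_, _, div_nonneg hx.1 hs.le, div_nonneg hx.2 hs.le, (rayPoint_det₂ hs.ne' x).symm⟩

theorem exists_mem_cone (h : IsStar m α l) (x : Plane) : ∃ i < 2 * m, x ∈ cone α i := by
  by_cases hx : x = 0
  · refine ⟨0, by have := h.order_pos; omega, ?_⟩
    simp [hx, cone, det₂]
  · obtain ⟨i, hi, c, d, hc, hd, rfl⟩ := h.exists_eq_rayPoint hx
    exact ⟨i, hi, h.rayPoint_mem_cone hi hc.le hd⟩

/-- The gauge of a star: in each sector it is the maximum of the normalized coordinates. -/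
theorem exists_gauge (h : IsStar m α l) : ∃ μ : Plane → ℝ, Continuous μ ∧
    ∀ i < 2 * m, ∀ c d, 0 ≤ c → 0 ≤ d → μ (rayPoint α i c d) = max (c / l i) (d / l (i + 1)) := by
  have ex (x : Plane) : ∃ t : ℝ, ∃ i < 2 * m, ∃ c d, 0 ≤ c ∧ 0 ≤ d ∧ x = rayPoint α i c d ∧
      t = max (c / l i) (d / l (i + 1)) := by
    obtain ⟨i, hi, hx⟩ := h.exists_mem_cone x
    obtain ⟨c, d, hc, hd, e⟩ := h.exists_rayPoint_of_mem_cone hi hx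
    exact ⟨_, i, hi, c, d, hc, hd, e, rfl⟩
  choose μ hμ using ex
  have key : ∀ i < 2 * m, ∀ c d, 0 ≤ c → 0 ≤ d →
      μ (rayPoint α i c d) = max (c / l i) (d / l (i + 1)) := by
    intro i hi c d hc hd
    obtain ⟨j, hj, c', d', hc', hd', e, e'⟩ := hμ (rayPoint α i c d)
    rw [e']
    have hli := h.length_pos i hi.le
    have hlj := h.length_pos j hj.le
    have hli' := h.length_pos (i + 1) hi
    have hlj' := h.length_pos (j + 1) hj
    rcases h.rayPoint_eq_cases hi hj hc hd hc' hd' e with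
      ⟨rfl, rfl, rfl, rfl⟩ | ⟨rfl, rfl, rfl⟩ | ⟨hji, rfl, rfl, rfl⟩ | ⟨hij, rfl, rfl, rfl⟩
    · simp
    · rfl
    · rw [hji, h.length_succ_mod hi, zero_div, zero_div, max_comm]
    · rw [hij, h.length_succ_mod hj, zero_div, zero_div, max_comm]
  refine ⟨μ, ?_, key⟩
  refine (locallyFinite_of_finite fun i : Fin (2 * m) => cone α i).continuous ?_
    (fun i => isClosed_cone α i) (fun i => ?_)
  · refine eq_univ_of_forall fun x => ?_
    obtain ⟨i, hi, hx⟩ := h.exists_mem_cone x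
    exact mem_iUnion.2 ⟨⟨i, hi⟩, hx⟩
  · have hs := (h.sin_pos i.2)
    have hc : Continuous fun x => max (det₂ x (rayDir α (i + 1)) / Real.sin (α i) / l i)
        (det₂ (rayDir α i) x / Real.sin (α i) / l (i + 1)) := by
      have := continuous_det₂_left (rayDir α (i + 1))
      have := continuous_det₂_right (rayDir α i)
      fun_prop
    refine hc.continuousOn.congr fun x hx => ?_
    conv_lhs => rw [← rayPoint_det₂ hs.ne' x]
    exact key i i.2 _ _ (div_nonneg hx.1 hs.le) (div_nonneg hx.2 hs.le)

theorem mem_star_iff_gauge (h : IsStar m α l) {μ : Plane → ℝ}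
    (hμ : ∀ i < 2 * m, ∀ c d, 0 ≤ c → 0 ≤ d →
      μ (rayPoint α i c d) = max (c / l i) (d / l (i + 1))) {x : Plane} :
    x ∈ star m α l ↔ μ x < 1 := by
  simp only [star, mem_iUnion, Finset.mem_range, mem_sector_iff]
  constructor
  · rintro ⟨i, hi, c, d, hc, hcl, hd, hdl, rfl⟩
    rw [hμ i hi c d hc hd]
    exact max_lt ((div_lt_one (h.length_pos i hi.le)).2 hcl)
      ((div_lt_one (h.length_pos (i + 1) hi)).2 hdl)
  · intro hx
    obtain ⟨i, hi, hxi⟩ := h.exists_mem_cone x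
    obtain ⟨c, d, hc, hd, rfl⟩ := h.exists_rayPoint_of_mem_cone hi hxi
    rw [hμ i hi c d hc hd, max_lt_iff, div_lt_one (h.length_pos i hi.le),
      div_lt_one (h.length_pos (i + 1) hi)] at hx
    exact ⟨i, hi, c, d, hc, hx.1, hd, hx.2, rfl⟩

theorem isOpen_star (h : IsStar m α l) : IsOpen (star m α l) := by
  obtain ⟨μ, hμc, hμ⟩ := h.exists_gauge
  have : star m α l = {x | μ x < 1} := Set.ext fun x => h.mem_star_iff_gauge hμ
  rw [this]
  exact isOpen_lt hμc continuous_const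

/-- A sector is the intersection of the star with a closed cone. -/
theorem mem_sector_iff_mem_cone (h : IsStar m α l) {i : ℕ} (hi : i < 2 * m) {x : Plane} :
    x ∈ sectorPoint α i '' sectorDomain l i ↔ x ∈ star m α l ∧ x ∈ cone α i := by
  obtain ⟨μ, hμc, hμ⟩ := h.exists_gauge
  rw [h.mem_star_iff_gauge hμ, mem_sector_iff]
  constructor
  · rintro ⟨c, d, hc, hcl, hd, hdl, rfl⟩
    refine ⟨?_, h.rayPoint_mem_cone hi hc hd⟩
    rw [hμ i hi c d hc hd]
    exact max_lt ((div_lt_one (h.length_pos i hi.le)).2 hcl)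
      ((div_lt_one (h.length_pos (i + 1) hi)).2 hdl)
  · rintro ⟨hx, hxc⟩
    obtain ⟨c, d, hc, hd, rfl⟩ := h.exists_rayPoint_of_mem_cone hi hxc
    rw [hμ i hi c d hc hd, max_lt_iff, div_lt_one (h.length_pos i hi.le),
      div_lt_one (h.length_pos (i + 1) hi)] at hx
    exact ⟨c, d, hc, hx.1, hd, hx.2, rfl⟩

theorem zero_mem_star (h : IsStar m α l) : (0 : Plane) ∈ star m α l := by
  have h2 : 0 < 2 * m := by have := h.order_pos; omega
  refine mem_iUnion₂.2 ⟨0, Finset.mem_range.2 h2, mem_sector_iff.2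
    ⟨0, 0, le_rfl, h.length_pos 0 h2.le, le_rfl, h.length_pos 1 h2, ?_⟩⟩
  simp [rayPoint]

end IsStar

end Star

section PiecewiseDifferentiable

variable {V W : Type*} [NormedAddCommGroup V] [NormedSpace ℝ V]
  [NormedAddCommGroup W] [NormedSpace ℝ W]

/-- Mean value inequality for a continuous function on a convex set which is differentiable on each
of finitely many closed pieces. -/
theorem norm_image_sub_le_of_piecewise {κ : Type*} [Finite κ] {s : Set V} (hs : Convex ℝ s)
    {S : κ → Set V} (hS : ∀ i, IsClosed (S i)) (hcov : s ⊆ ⋃ i, S i) {f : V → W}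
    (hf : ContinuousOn f s) {f' : κ → V → V →L[ℝ] W} {C : ℝ}
    (hd : ∀ i, ∀ x ∈ s ∩ S i, HasFDerivWithinAt f (f' i x) (s ∩ S i) x)
    (hC : ∀ i, ∀ x ∈ s ∩ S i, ‖f' i x‖ ≤ C) {x y : V} (hx : x ∈ s) (hy : y ∈ s) :
    ‖f y - f x‖ ≤ C * ‖y - x‖ := by
  set γ : ℝ → V := fun t => x + t • (y - x) with hγ
  have hγc : Continuous γ := by fun_prop
  have hγs : ∀ t ∈ Icc (0 : ℝ) 1, γ t ∈ s := fun t ht => hs.add_smul_sub_mem hx hy ht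
  refine le_of_forall_pos_le_add fun ε hε => ?_
  have key := image_norm_le_of_liminf_right_slope_norm_lt_deriv_boundary (a := 0) (b := 1)
    (f := fun t => f (γ t) - f x) (f' := fun _ => C * ‖y - x‖)
    (B := fun t => (C * ‖y - x‖ + ε) * t) (B' := fun _ => C * ‖y - x‖ + ε)
    ((hf.comp hγc.continuousOn hγs).sub continuousOn_const) ?_ (by simp [hγ])
    (by fun_prop) (fun t _ => by
      simpa using ((hasDerivAt_id t).const_mul (C * ‖y - x‖ + ε)).hasDerivWithinAt)
    (fun t _ _ => by linarith) (right_mem_Icc.2 zero_le_one)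
  · simpa [hγ] using key
  intro t ht r hr
  have ex : ∀ᶠ z in 𝓝[>] t, ∃ i, γ z ∈ s ∩ S i := by
    filter_upwards [Ioo_mem_nhdsGT ht.2] with z hz
    have hzs := hγs z ⟨ht.1.trans hz.1.le, hz.2.le⟩
    obtain ⟨i, hi⟩ := mem_iUnion.1 (hcov hzs)
    exact ⟨i, hzs, hi⟩
  obtain ⟨i, hi⟩ : ∃ i, ∃ᶠ z in 𝓝[>] t, γ z ∈ s ∩ S i := by
    by_contra hcon
    push Not at hcon
    obtain ⟨z, ⟨i, hz⟩, hz'⟩ := (ex.and (eventually_all.2 hcon)).exists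
    exact hz' i hz
  have hγt : Tendsto γ (𝓝[>] t) (𝓝 (γ t)) := hγc.continuousAt.mono_left inf_le_left
  have hti : γ t ∈ s ∩ S i := ⟨hγs t (Ico_subset_Icc_self ht),
    (hS i).mem_of_frequently_of_tendsto (hi.mono fun _ h => h.2) hγt⟩
  set δ := (r - C * ‖y - x‖) / (‖y - x‖ + 1) with hδ
  have hδ0 : 0 < δ := div_pos (by linarith) (by positivity)
  have hδr : (C + δ) * ‖y - x‖ < r := by
    have : δ * (‖y - x‖ + 1) = r - C * ‖y - x‖ := by rw [hδ]; field_simp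
    nlinarith
  have hlo := (hasFDerivWithinAt_iff_isLittleO.1 (hd i _ hti)).def hδ0
  have hev := hγt.eventually (eventually_nhdsWithin_iff.1 hlo)
  refine (hi.and_eventually (hev.and self_mem_nhdsWithin)).mono ?_
  rintro z ⟨hz, hz', hzt⟩
  have hzt : 0 < z - t := sub_pos.2 hzt
  have e : γ z - γ t = (z - t) • (y - x) := by simp only [hγ]; module
  have h1 : ‖f (γ z) - f (γ t)‖ ≤ (C + δ) * ((z - t) * ‖y - x‖) := by
    have h2 := (f' i (γ t)).le_of_opNorm_le (hC i _ hti) (γ z - γ t)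
    have h3 := hz' hz
    have h4 := norm_le_norm_sub_add (f (γ z) - f (γ t)) (f' i (γ t) (γ z - γ t))
    rw [e, norm_smul, Real.norm_eq_abs, abs_of_pos hzt] at h2 h3
    rw [e] at h4
    linarith
  rw [slope_def_field, div_lt_iff₀ hzt]
  have h5 := norm_sub_norm_le (f (γ z) - f x) (f (γ t) - f x)
  rw [sub_sub_sub_cancel_right] at h5
  simp only [Function.comp_apply]
  calc _ ≤ (C + δ) * ((z - t) * ‖y - x‖) := h5.trans h1
    _ = (C + δ) * ‖y - x‖ * (z - t) := by ring
    _ < r * (z - t) := by gcongr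

/-- A function with continuous partial derivatives on a product of two intervals is
differentiable. -/
theorem hasFDerivWithinAt_of_partials {I J : Set ℝ} (hI : OrdConnected I) {f fu fv : ℝ × ℝ → W}
    (hfu : ContinuousOn fu (I ×ˢ J))
    (hu : ∀ p ∈ I ×ˢ J, HasDerivWithinAt (fun t => f (t, p.2)) (fu p) I p.1)
    (hv : ∀ p ∈ I ×ˢ J, HasDerivWithinAt (fun t => f (p.1, t)) (fv p) J p.2)
    {p : ℝ × ℝ} (hp : p ∈ I ×ˢ J) :
    HasFDerivWithinAt f ((ContinuousLinearMap.fst ℝ ℝ ℝ).smulRight (fu p)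
      + (ContinuousLinearMap.snd ℝ ℝ ℝ).smulRight (fv p)) (I ×ˢ J) p := by
  rw [hasFDerivWithinAt_iff_isLittleO, Asymptotics.isLittleO_iff]
  intro ε hε
  obtain ⟨δ, hδ, hδu⟩ := Metric.continuousWithinAt_iff.1 (hfu p hp) (ε / 2) (half_pos hε)
  have hv' := (hasDerivWithinAt_iff_isLittleO.1 (hv p hp)).def (half_pos hε)
  have hsnd : Tendsto Prod.snd (𝓝[I ×ˢ J] p) (𝓝[J] p.2) :=
    tendsto_nhdsWithin_iff.2 ⟨continuous_snd.continuousAt.mono_left inf_le_left,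
      eventually_nhdsWithin_of_forall fun q hq => hq.2⟩
  filter_upwards [hsnd.eventually hv', self_mem_nhdsWithin,
    mem_nhdsWithin_of_mem_nhds (Metric.ball_mem_nhds p hδ)] with q hq hqD hqδ
  have h1 := (convex_uIcc p.1 q.1).norm_image_sub_le_of_norm_hasDerivWithin_le
    (f := fun σ => f (σ, q.2) - (σ - p.1) • fu p) (f' := fun σ => fu (σ, q.2) - fu p)
    (C := ε / 2) (x := p.1) (y := q.1) (fun σ hσ => ?_) (fun σ hσ => ?_) left_mem_uIcc
    right_mem_uIcc
  · have e : f q - f p - ((ContinuousLinearMap.fst ℝ ℝ ℝ).smulRight (fu p)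
        + (ContinuousLinearMap.snd ℝ ℝ ℝ).smulRight (fv p)) (q - p)
        = (f (q.1, q.2) - (q.1 - p.1) • fu p - (f (p.1, q.2) - (p.1 - p.1) • fu p))
          + (f (p.1, q.2) - f (p.1, p.2) - (q.2 - p.2) • fv p) := by
      simp
      abel
    rw [e]
    refine (norm_add_le _ _).trans ?_
    have h2 : ‖q.1 - p.1‖ ≤ ‖q - p‖ := norm_fst_le (q - p)
    have h3 : ‖q.2 - p.2‖ ≤ ‖q - p‖ := norm_snd_le (q - p)
    nlinarith
  · have hσ' := hI.uIcc_subset hp.1 hqD.1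
    refine ((hu (σ, q.2) ⟨hσ' hσ, hqD.2⟩).mono hσ').sub ?_
    simpa using (((hasDerivAt_id σ).sub_const p.1).smul_const (fu p)).hasDerivWithinAt
  · have hσ' := hI.uIcc_subset hp.1 hqD.1
    rw [← dist_eq_norm]
    refine (hδu (x := (σ, q.2)) ⟨hσ' hσ, hqD.2⟩ ?_).le
    have h5 := abs_sub_left_of_mem_uIcc hσ
    rw [Metric.mem_ball, Prod.dist_eq, max_lt_iff, Real.dist_eq, Real.dist_eq] at hqδ
    rw [Prod.dist_eq, max_lt_iff, Real.dist_eq, Real.dist_eq]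
    exact ⟨lt_of_le_of_lt h5 hqδ.1, hqδ.2⟩

end PiecewiseDifferentiable

section Sectors

theorem sectorPoint_add (α : ℕ → ℝ) (i : ℕ) (p q : ℝ × ℝ) :
    sectorPoint α i (p + q) = sectorPoint α i p + sectorPoint α i q := by
  unfold sectorPoint
  split_ifs <;> simp only [Prod.fst_add, Prod.snd_add] <;> module

theorem sectorPoint_smul (α : ℕ → ℝ) (i : ℕ) (t : ℝ) (p : ℝ × ℝ) :
    sectorPoint α i (t • p) = t • sectorPoint α i p := by
  unfold sectorPoint
  split_ifs <;> simp only [Prod.smul_fst, Prod.smul_snd, smul_eq_mul] <;> module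

theorem sectorPoint_zero (α : ℕ → ℝ) (i : ℕ) : sectorPoint α i 0 = 0 := by
  simp [sectorPoint]

theorem exists_sectorPoint_eq {α : ℕ → ℝ} {i : ℕ} (h : Real.sin (α i) ≠ 0) (x : Plane) :
    ∃ p, sectorPoint α i p = x := by
  by_cases hi : Even i
  · exact ⟨(_, _), (sectorPoint_of_even α hi _).trans (rayPoint_det₂ h x)⟩
  · exact ⟨(_, _), (sectorPoint_of_not_even α hi (det₂ (rayDir α i) x / Real.sin (α i),
      det₂ x (rayDir α (i + 1)) / Real.sin (α i))).trans (rayPoint_det₂ h x)⟩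

/-- The linear parametrization of a sector, as an isomorphism. -/
theorem exists_sectorEquiv {m : ℕ} {α l : ℕ → ℝ} (h : IsStar m α l) {i : ℕ} (hi : i < 2 * m) :
    ∃ e : (ℝ × ℝ) ≃L[ℝ] Plane, ∀ p, e p = sectorPoint α i p := by
  let f : (ℝ × ℝ) →ₗ[ℝ] Plane :=
    { toFun := sectorPoint α i
      map_add' := sectorPoint_add α i
      map_smul' := sectorPoint_smul α i }
  have hsurj : Function.Surjective f := exists_sectorPoint_eq (h.sin_pos hi).ne'
  have hinj : Function.Injective f :=
    (LinearMap.injective_iff_surjective_of_finrank_eq_finrank (by simp)).2 hsurj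
  exact ⟨(LinearEquiv.ofBijective f ⟨hinj, hsurj⟩).toContinuousLinearEquiv, fun p => rfl⟩

theorem exists_sectorDomain_eq_prod {m : ℕ} {α l : ℕ → ℝ} (h : IsStar m α l) {i : ℕ}
    (hi : i < 2 * m) : ∃ a b, 0 < a ∧ 0 < b ∧ sectorDomain l i = Ico 0 a ×ˢ Ico 0 b := by
  by_cases he : Even i
  · exact ⟨_, _, h.length_pos i hi.le, h.length_pos (i + 1) hi, sectorDomain_of_even l he⟩
  · exact ⟨_, _, h.length_pos (i + 1) hi, h.length_pos i hi.le, sectorDomain_of_not_even l he⟩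

/-- The differential, on a sector, of a map that is `C^{1M}` in the sector coordinates. -/
theorem exists_sector_deriv {m : ℕ} {α l : ℕ → ℝ} (h : IsStar m α l) {i : ℕ} (hi : i < 2 * m)
    {G : Plane → E3} (hG : IsC1M (sectorDomain l i) fun p => G (sectorPoint α i p)) :
    ∃ A : Plane → Plane →L[ℝ] E3, ContinuousOn A (sectorPoint α i '' sectorDomain l i) ∧
      (∀ x ∈ sectorPoint α i '' sectorDomain l i,
        HasFDerivWithinAt G (A x) (sectorPoint α i '' sectorDomain l i) x) ∧
      ∀ p q, A (sectorPoint α i p) (sectorPoint α i q) =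
        q.1 • partialU (sectorDomain l i) (fun p => G (sectorPoint α i p)) p +
        q.2 • partialV (sectorDomain l i) (fun p => G (sectorPoint α i p)) p := by
  obtain ⟨e, he⟩ := exists_sectorEquiv h hi
  obtain ⟨a, b, ha, hb, hD⟩ := exists_sectorDomain_eq_prod h hi
  set D := sectorDomain l i with hDdef
  have he' : sectorPoint α i = e := (funext he).symm
  rw [he'] at hG ⊢
  have hmaps : MapsTo e.symm (e '' D) D := by
    rintro _ ⟨p, hp, rfl⟩
    simpa using hp
  let L (p : ℝ × ℝ) : (ℝ × ℝ) →L[ℝ] E3 :=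
    (ContinuousLinearMap.fst ℝ ℝ ℝ).smulRight (partialU D (fun p => G (e p)) p)
      + (ContinuousLinearMap.snd ℝ ℝ ℝ).smulRight (partialV D (fun p => G (e p)) p)
  refine ⟨fun x => (L (e.symm x)).comp (e.symm : Plane →L[ℝ] ℝ × ℝ), ?_, ?_, ?_⟩
  · have hc : ContinuousOn L D := by
      refine ContinuousOn.add ?_ ?_
      · exact ((ContinuousLinearMap.smulRightL ℝ (ℝ × ℝ) E3
          (ContinuousLinearMap.fst ℝ ℝ ℝ)).continuous).comp_continuousOn hG.continuousOn_partialU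
      · exact ((ContinuousLinearMap.smulRightL ℝ (ℝ × ℝ) E3
          (ContinuousLinearMap.snd ℝ ℝ ℝ)).continuous).comp_continuousOn hG.continuousOn_partialV
    exact (hc.comp e.symm.continuous.continuousOn hmaps).clm_comp continuousOn_const
  · intro x hx
    have hL : HasFDerivWithinAt (fun p => G (e p)) (L (e.symm x)) D (e.symm x) := by
      have hx' := hmaps hx
      simp only [L]
      rw [hD] at hG hx' ⊢
      exact hasFDerivWithinAt_of_partials ordConnected_Ico hG.continuousOn_partialU
        (fun p hp => hasDerivWithinAt_partialU hG.hasPartialU hp)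
        (fun p hp => hasDerivWithinAt_partialV hG.hasPartialV hp) hx'
    have := HasFDerivWithinAt.comp x hL (e.symm.hasFDerivWithinAt (s := e '' D)) hmaps
    refine this.congr (fun y _ => by simp) (by simp)
  · intro p q
    simp [L]

theorem IsStar.hasFDerivAt_of_sectors {m : ℕ} {α l : ℕ → ℝ} (h : IsStar m α l)
    {W : Type*} [NormedAddCommGroup W] [NormedSpace ℝ W] {f : Plane → W} {f' : Plane →L[ℝ] W}
    {x : Plane} (hx : x ∈ star m α l)
    (hf : ∀ i < 2 * m, x ∈ sectorPoint α i '' sectorDomain l i →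
      HasFDerivWithinAt f f' (sectorPoint α i '' sectorDomain l i) x) : HasFDerivAt f f' x := by
  rw [hasFDerivAt_iff_isLittleO, Asymptotics.isLittleO_iff]
  intro ε hε
  have ev : ∀ i : Fin (2 * m), ∀ᶠ z in 𝓝 x, z ∈ sectorPoint α i '' sectorDomain l i →
      ‖f z - f x - f' (z - x)‖ ≤ ε * ‖z - x‖ := by
    intro i
    by_cases hxi : x ∈ sectorPoint α i '' sectorDomain l i
    · exact eventually_nhdsWithin_iff.1
        ((hasFDerivWithinAt_iff_isLittleO.1 (hf i i.2 hxi)).def hε)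
    · have hxc : x ∉ cone α i := fun hc => hxi ((h.mem_sector_iff_mem_cone i.2).2 ⟨hx, hc⟩)
      filter_upwards [(isClosed_cone α i).isOpen_compl.mem_nhds hxc] with z hz hzi
      exact absurd ((h.mem_sector_iff_mem_cone i.2).1 hzi).2 hz
  filter_upwards [eventually_all.2 ev, h.isOpen_star.mem_nhds hx] with z hz hzs
  obtain ⟨i, hi, hzi⟩ := h.exists_mem_cone z
  exact hz ⟨i, hi⟩ ((h.mem_sector_iff_mem_cone hi).2 ⟨hzs, hzi⟩)

end Sectors

section Graph

/-- The linear map of the plane to space with `(1, 0) ↦ e₁`, `(0, 1) ↦ e₂`. -/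
noncomputable def planeEmb (e₁ e₂ : E3) : Plane →L[ℝ] E3 :=
  (EuclideanSpace.proj 0 : Plane →L[ℝ] ℝ).smulRight e₁
    + (EuclideanSpace.proj 1 : Plane →L[ℝ] ℝ).smulRight e₂

theorem planeEmb_apply (e₁ e₂ : E3) (y : Plane) : planeEmb e₁ e₂ y = y 0 • e₁ + y 1 • e₂ := rfl

/-- The map `x ↦ (⟨e₁, x⟩, ⟨e₂, x⟩)`. -/
noncomputable def planeProj (e₁ e₂ : E3) : E3 →L[ℝ] Plane :=
  ((EuclideanSpace.equiv (Fin 2) ℝ).symm : (Fin 2 → ℝ) →L[ℝ] Plane).comp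
    (ContinuousLinearMap.pi ![innerSL ℝ e₁, innerSL ℝ e₂])

theorem planeProj_apply_zero (e₁ e₂ x : E3) : planeProj e₁ e₂ x 0 = ⟪e₁, x⟫ := rfl

theorem planeProj_apply_one (e₁ e₂ x : E3) : planeProj e₁ e₂ x 1 = ⟪e₂, x⟫ := rfl

variable {e₁ e₂ n : E3}

theorem orthonormal_three_iff :
    Orthonormal ℝ ![e₁, e₂, n] ↔ (⟪e₁, e₁⟫ = 1 ∧ ⟪e₂, e₂⟫ = 1 ∧ ⟪n, n⟫ = 1) ∧
      ⟪e₁, e₂⟫ = 0 ∧ ⟪e₁, n⟫ = 0 ∧ ⟪e₂, n⟫ = 0 := by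
  rw [orthonormal_iff_ite]
  constructor
  · intro h
    exact ⟨⟨by simpa using h 0 0, by simpa using h 1 1, by simpa using h 2 2⟩,
      by simpa using h 0 1, by simpa using h 0 2, by simpa using h 1 2⟩
  · rintro ⟨⟨h1, h2, h3⟩, h4, h5, h6⟩ i j
    rw [real_inner_self_eq_norm_sq, pow_eq_one_iff_of_nonneg (norm_nonneg _) two_ne_zero]
      at h1 h2 h3
    fin_cases i <;> fin_cases j <;>
      simp [h1, h2, h3, h4, h5, h6, real_inner_comm e₁ e₂, real_inner_comm e₁ n,
        real_inner_comm e₂ n]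

theorem Orthonormal.expand (ho : Orthonormal ℝ ![e₁, e₂, n]) (x : E3) :
    x = ⟪e₁, x⟫ • e₁ + ⟪e₂, x⟫ • e₂ + ⟪n, x⟫ • n := by
  have hcard : Fintype.card (Fin 3) = Module.finrank ℝ E3 := by simp
  let b := OrthonormalBasis.mk ho (by
    rw [← coe_basisOfOrthonormalOfCardEqFinrank ho hcard]
    exact (basisOfOrthonormalOfCardEqFinrank ho hcard).span_eq.ge)
  have := (b.sum_repr' x).symm
  simpa [Fin.sum_univ_three, b] using this

theorem planeProj_planeEmb (ho : Orthonormal ℝ ![e₁, e₂, n]) (y : Plane) :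
    planeProj e₁ e₂ (planeEmb e₁ e₂ y) = y := by
  obtain ⟨⟨h1, h2, h3⟩, h4, h5, h6⟩ := orthonormal_three_iff.1 ho
  apply plane_ext
  · rw [planeProj_apply_zero, planeEmb_apply, inner_add_right, real_inner_smul_right,
      real_inner_smul_right, h1, h4]; ring
  · rw [planeProj_apply_one, planeEmb_apply, inner_add_right, real_inner_smul_right,
      real_inner_smul_right, real_inner_comm, h4, h2]; ring

theorem planeEmb_planeProj_add (ho : Orthonormal ℝ ![e₁, e₂, n]) (x : E3) :
    x = planeEmb e₁ e₂ (planeProj e₁ e₂ x) + ⟪n, x⟫ • n := by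
  rw [planeEmb_apply, planeProj_apply_zero, planeProj_apply_one]
  exact Orthonormal.expand ho x

theorem norm_normalized_sub_le {c c' : ℝ} (hc : 1 / 2 < c) (hc' : 1 / 2 < c') {v v' : E3}
    (hv' : ‖v'‖ ≤ 1) (hcc : |c - c'| ≤ ‖v - v'‖) :
    ‖c⁻¹ • v - c'⁻¹ • v'‖ ≤ 6 * ‖v - v'‖ := by
  have e : c⁻¹ • v - c'⁻¹ • v' = c⁻¹ • (v - v') + (c⁻¹ * c'⁻¹ * (c' - c)) • v' := by
    have h0 : c ≠ 0 := by positivity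
    have h0' : c' ≠ 0 := by positivity
    have : c⁻¹ * c'⁻¹ * (c' - c) = c⁻¹ - c'⁻¹ := by field_simp
    rw [this]; module
  have hi : c⁻¹ ≤ 2 := by rw [inv_le_comm₀ (by positivity) two_pos]; linarith
  have hi' : c'⁻¹ ≤ 2 := by rw [inv_le_comm₀ (by positivity) two_pos]; linarith
  have hp : 0 < c⁻¹ := by positivity
  have hp' : 0 < c'⁻¹ := by positivity
  rw [e]
  refine (norm_add_le _ _).trans ?_
  rw [norm_smul, norm_smul, Real.norm_eq_abs, Real.norm_eq_abs, abs_mul, abs_mul, abs_of_pos hp,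
    abs_of_pos hp', abs_sub_comm c' c]
  calc c⁻¹ * ‖v - v'‖ + c⁻¹ * c'⁻¹ * |c - c'| * ‖v'‖
      ≤ 2 * ‖v - v'‖ + 2 * 2 * ‖v - v'‖ * 1 := by gcongr
    _ = _ := by ring

/-- If `F` is close to the embedding of the plane and has a normal field `M` that is Lipschitz, then
its image is the graph of a `C^{1,1}` function. -/
theorem exists_c11_graph {F M : Plane → E3} {ρ K c : ℝ} (hK : 0 ≤ K)
    (ho : Orthonormal ℝ ![e₁, e₂, n])
    (hc : c * ‖planeProj e₁ e₂‖ ≤ 1 / 2)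
    (hF : ∀ x ∈ Metric.ball (0 : Plane) ρ, ∀ y ∈ Metric.ball (0 : Plane) ρ,
      ‖F y - F x - planeEmb e₁ e₂ (y - x)‖ ≤ c * ‖y - x‖)
    (hM : ∀ x ∈ Metric.ball (0 : Plane) ρ, ∀ y ∈ Metric.ball (0 : Plane) ρ,
      ‖M y - M x‖ ≤ K * ‖y - x‖)
    (hM1 : ∀ x ∈ Metric.ball (0 : Plane) ρ, ‖M x‖ = 1)
    (hMn : ∀ x ∈ Metric.ball (0 : Plane) ρ, 1 / 2 < ⟪n, M x⟫)
    (hFM : ∀ x ∈ Metric.ball (0 : Plane) ρ, HasFDerivAt (fun z => ⟪M x, F z⟫) (0 : Plane →L[ℝ] ℝ) x) :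
    ∃ (H : OpenPartialHomeomorph Plane Plane) (w : Plane → ℝ),
      H.source = Metric.ball 0 ρ ∧ DifferentiableOn ℝ w H.target ∧
      (∃ K : NNReal, LipschitzOnWith K (fderiv ℝ w) H.target) ∧
      ∀ x ∈ H.source, F x = F 0 + planeEmb e₁ e₂ (H x) + w (H x) • n ∧
        ∀ y, fderiv ℝ w (H x) y = -(⟪n, M x⟫⁻¹ * ⟪M x, planeEmb e₁ e₂ y⟫) := by
  set ι := planeEmb e₁ e₂ with hι
  set P := planeProj e₁ e₂ with hP
  set B := Metric.ball (0 : Plane) ρ with hB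
  set h : Plane → Plane := fun x => P (F x - F 0) with hh
  have hdiff (x) (hx : x ∈ B) (y) (hy : y ∈ B) : ‖h y - h x - (y - x)‖ ≤ 1 / 2 * ‖y - x‖ := by
    have e : h y - h x - (y - x) = P (F y - F x - ι (y - x)) := by
      rw [map_sub P _ (ι (y - x)), planeProj_planeEmb ho, hh]
      simp only [← map_sub]
      congr 2
      abel
    rw [e]
    calc _ ≤ ‖P‖ * (c * ‖y - x‖) := P.le_opNorm_of_le (hF x hx y hy)
      _ = c * ‖P‖ * ‖y - x‖ := by ring
      _ ≤ _ := by gcongr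
  have happ : ApproximatesLinearOn h (ContinuousLinearEquiv.refl ℝ Plane : Plane →L[ℝ] Plane) B
      (1 / 2 : NNReal) := by
    intro x hx y hy
    simpa using hdiff y hy x hx
  have hc' : Subsingleton Plane ∨ (1 / 2 : NNReal) <
      ‖((ContinuousLinearEquiv.refl ℝ Plane).symm : Plane →L[ℝ] Plane)‖₊⁻¹ := by
    right
    have : ‖((ContinuousLinearEquiv.refl ℝ Plane).symm : Plane →L[ℝ] Plane)‖₊ = 1 := by
      apply NNReal.coe_injective
      exact ContinuousLinearMap.norm_id
    rw [this]
    norm_num [← NNReal.coe_lt_coe]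
  set H := happ.toOpenPartialHomeomorph h B hc' Metric.isOpen_ball with hH
  have hHs : H.source = B := rfl
  have hHc : ∀ x, H x = h x := fun _ => rfl
  have hinv (x) (hx : x ∈ B) (y) (hy : y ∈ B) : ‖y - x‖ ≤ 2 * ‖h y - h x‖ := by
    have h1 := hdiff x hx y hy
    have h2 := norm_le_norm_add_norm_sub (h y - h x) (y - x)
    linarith
  set w : Plane → ℝ := fun y => ⟪n, F (H.symm y) - F 0⟫ with hw
  have hsymm (y) (hy : y ∈ H.target) : H.symm y ∈ B := H.map_target hy
  have hright (y) (hy : y ∈ H.target) : h (H.symm y) = y := H.right_inv hy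
  have hFx (x) (hx : x ∈ B) : F x - F 0 = ι (h x) + w (h x) • n := by
    have : H.symm (h x) = x := H.left_inv hx
    rw [hw]
    simp only
    rw [this]
    exact planeEmb_planeProj_add ho _
  let g (y : Plane) : Plane →L[ℝ] ℝ := -((innerSL ℝ (⟪n, M (H.symm y)⟫⁻¹ • M (H.symm y))).comp ι)
  have hwd (y) (hy : y ∈ H.target) : HasFDerivAt w (g y) y := by
    have hx := hsymm y hy
    set x := H.symm y with hxdef
    have hxn : 0 < ⟪n, M x⟫ := by linarith [hMn x hx]
    have hHcont : Tendsto H.symm (𝓝 y) (𝓝 x) := H.continuousAt_symm hy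
    have hlo := (hasFDerivAt_iff_isLittleO.1 (hFM x hx)).comp_tendsto hHcont
    have hO : ((fun z => z - x) ∘ H.symm) =O[𝓝 y] fun y' => y' - y := by
      refine Asymptotics.IsBigO.of_bound 2 ?_
      filter_upwards [H.open_target.mem_nhds hy] with y' hy'
      have := hinv x hx _ (hsymm y' hy')
      rwa [hright y' hy', hright y hy] at this
    rw [hasFDerivAt_iff_isLittleO]
    refine ((hlo.trans_isBigO hO).const_mul_left ⟪n, M x⟫⁻¹).congr' ?_ EventuallyEq.rfl
    filter_upwards [H.open_target.mem_nhds hy] with y' hy'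
    have e1 := hFx _ (hsymm y' hy')
    have e2 := hFx x hx
    rw [hright y' hy'] at e1
    rw [hright y hy] at e2
    have e3 : F (H.symm y') - F x = ι (y' - y) + (w y' - w y) • n := by
      rw [map_sub, sub_smul]
      rw [← sub_sub_sub_cancel_right _ _ (F 0), e1, e2]
      abel
    simp only [Function.comp_apply, zero_apply, sub_zero]
    rw [← inner_sub_right, e3, inner_add_right, real_inner_smul_right, real_inner_comm n (M x)]
    simp only [g, neg_apply, ContinuousLinearMap.comp_apply, innerSL_apply_apply,
      real_inner_smul_left, ← hxdef]
    field_simp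
    ring
  refine ⟨H, w, hHs, fun y hy => (hwd y hy).differentiableAt.differentiableWithinAt,
    ⟨(12 * K * ‖ι‖).toNNReal, LipschitzOnWith.of_dist_le_mul fun y hy y' hy' => ?_⟩,
    fun x hx => ⟨?_, fun y => ?_⟩⟩
  · rw [(hwd y hy).fderiv, (hwd y' hy').fderiv, dist_eq_norm, dist_eq_norm,
      Real.coe_toNNReal _ (by positivity)]
    have hx := hsymm y hy
    have hx' := hsymm y' hy'
    have h1 : g y - g y' = -((innerSL ℝ (⟪n, M (H.symm y)⟫⁻¹ • M (H.symm y)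
        - ⟪n, M (H.symm y')⟫⁻¹ • M (H.symm y'))).comp ι) := by
      ext z
      simp [g]
      ring
    have h2 := norm_normalized_sub_le (hMn _ hx) (hMn _ hx') (hM1 _ hx').le
      (v := M (H.symm y)) (by
        rw [← inner_sub_right]
        refine (abs_real_inner_le_norm _ _).trans ?_
        have : ‖n‖ = 1 := ho.1 2
        rw [this, one_mul])
    have h3 := hM _ hx' _ hx
    have h4 := hinv _ hx' _ hx
    rw [hright y hy, hright y' hy'] at h4
    rw [h1, norm_neg]
    refine (ContinuousLinearMap.opNorm_comp_le _ _).trans ?_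
    rw [innerSL_apply_norm]
    calc _ ≤ 6 * (K * (2 * ‖y - y'‖)) * ‖ι‖ := by
          gcongr
          refine h2.trans ?_
          gcongr
          exact h3.trans (by gcongr)
      _ = _ := by ring
  · have := hFx x hx
    rw [hHc, add_assoc, ← this]
    abel
  · have : H.symm (H x) = x := H.left_inv hx
    rw [(hwd _ (H.map_source hx)).fderiv]
    simp only [g, neg_apply, ContinuousLinearMap.comp_apply, innerSL_apply_apply,
      real_inner_smul_left, this]

end Graph

section StarChart

variable {A : Type} [TopologicalSpace A] {ψ N : A → E3} {p : A} {m : ℕ} {α l : ℕ → ℝ}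
  {τ : OpenPartialHomeomorph A Plane} {e₁ e₂ : E3}

/-- A front with a star chart in which its differential at the centre is an isometry onto the
tangent plane: the surface is a `C^{1,1}` graph, and the asymptotic curves leave the centre in the
directions of the rays. -/
theorem IsStarChart.isLocalC11Graph (hψ : Continuous ψ) (hN : Continuous N)
    (h : IsStarChart ψ N p m α l τ) (ho : Orthonormal ℝ ![e₁, e₂, N p])
    (hu : ∀ i < 2 * m, partialU (sectorDomain l i) (fun x => ψ (τ.symm (sectorPoint α i x))) 0
      = planeEmb e₁ e₂ (sectorPoint α i (1, 0)))
    (hv : ∀ i < 2 * m, partialV (sectorDomain l i) (fun x => ψ (τ.symm (sectorPoint α i x))) 0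
      = planeEmb e₁ e₂ (sectorPoint α i (0, 1))) :
    IsLocalC11Graph ψ N p e₁ e₂ ∧
      HasFDerivAt (fun x => ψ (τ.symm x)) (planeEmb e₁ e₂) 0 := by
  have hs := h.isStar
  set n := N p with hn
  set ι := planeEmb e₁ e₂ with hι
  set F : Plane → E3 := fun x => ψ (τ.symm x) with hF
  set M : Plane → E3 := fun x => N (τ.symm x) with hM
  have hsymm0 : τ.symm 0 = p := by rw [← h.map_center]; exact τ.left_inv h.mem_source
  have hM0 : M 0 = n := by simp only [hM, hsymm0, hn]
  have hO : IsOpen (star m α l) := hs.isOpen_star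
  have hτc : ContinuousOn τ.symm (star m α l) := by
    rw [← h.target_eq]; exact τ.continuousOn_symm
  have hFc : ContinuousOn F (star m α l) := hψ.comp_continuousOn hτc
  have hMc : ContinuousOn M (star m α l) := hN.comp_continuousOn hτc
  let S (i : ℕ) : Set Plane := sectorPoint α i '' sectorDomain l i
  have h0S (i) (hi : i < 2 * m) : (0 : Plane) ∈ S i :=
    (hs.mem_sector_iff_mem_cone hi).2 ⟨hs.zero_mem_star, by simp [cone, det₂]⟩
  have exA (i : Fin (2 * m)) := exists_sector_deriv hs i.2 (G := F) (h.isPSFrontWith i i.2).c1m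
  have exB (i : Fin (2 * m)) :=
    exists_sector_deriv hs i.2 (G := M) (h.isPSFrontWith i i.2).harmonic.c1m
  choose A hAc hAd hAp using exA
  choose B hBc hBd hBp using exB
  have hA0 (i : Fin (2 * m)) : A i 0 = ι := by
    ext1 x
    obtain ⟨q, rfl⟩ := exists_sectorPoint_eq (hs.sin_pos i.2).ne' x
    have := hAp i 0 q
    rw [sectorPoint_zero, hu i i.2, hv i i.2, ← map_smul, ← map_smul, ← map_add,
      ← sectorPoint_smul, ← sectorPoint_smul, ← sectorPoint_add] at this
    rw [this]
    congr 2
    ext <;> simp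
  have hAM (i : Fin (2 * m)) (x) (hx : x ∈ S i) : (innerSL ℝ (M x)).comp (A i x) = 0 := by
    ext1 y
    obtain ⟨q, rfl⟩ := exists_sectorPoint_eq (hs.sin_pos i.2).ne' y
    obtain ⟨p', hp', rfl⟩ := hx
    have h1 := (h.isPSFrontWith i i.2).lelieuvreU p' hp'
    have h2 := (h.isPSFrontWith i i.2).lelieuvreV p' hp'
    simp only [ContinuousLinearMap.comp_apply, innerSL_apply_apply, hAp, inner_add_right,
      real_inner_smul_right, zero_apply]
    rw [h1, h2, inner_neg_right]
    simp [hM, inner_cross_self_right]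
  have hFM (x) (hx : x ∈ star m α l) : HasFDerivAt (fun z => ⟪M x, F z⟫) (0 : Plane →L[ℝ] ℝ) x := by
    refine hs.hasFDerivAt_of_sectors hx fun i hi hxi => ?_
    have := (innerSL ℝ (M x)).hasFDerivAt.comp_hasFDerivWithinAt x (hAd ⟨i, hi⟩ x hxi)
    rw [hAM ⟨i, hi⟩ x hxi] at this
    exact this
  have hF0 : HasFDerivAt F ι 0 := by
    refine hs.hasFDerivAt_of_sectors hs.zero_mem_star fun i hi hxi => ?_
    rw [← hA0 ⟨i, hi⟩]
    exact hAd ⟨i, hi⟩ 0 hxi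
  refine ⟨?_, hF0⟩
  set c : ℝ := 1 / (2 * (‖planeProj e₁ e₂‖ + 1)) with hc
  have hc0 : 0 < c := by positivity
  have hcP : c * ‖planeProj e₁ e₂‖ ≤ 1 / 2 := by
    rw [hc, div_mul_eq_mul_div, div_le_div_iff₀ (by positivity) two_pos]
    linarith
  obtain ⟨K, hK⟩ : ∃ K : ℝ, ∀ i : Fin (2 * m), ‖B i 0‖ < K := by
    obtain ⟨K, hK⟩ := (finite_range fun i : Fin (2 * m) => ‖B i 0‖).bddAbove
    exact ⟨K + 1, fun i => (hK (mem_range_self i)).trans_lt (lt_add_one K)⟩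
  have hK0 : 0 ≤ K := by
    have : 0 < 2 * m := by have := hs.order_pos; omega
    exact (norm_nonneg _).trans (hK ⟨0, this⟩).le
  have evA (i : Fin (2 * m)) : ∀ᶠ x in 𝓝 (0 : Plane), x ∈ S i → ‖A i x - ι‖ ≤ c := by
    have h1 := (((hAc i) 0 (h0S i i.2)).sub (continuousWithinAt_const (b := ι))).norm
    have h2 := h1.eventually_lt_const (u := c) (by simpa [hA0 i] using hc0)
    filter_upwards [eventually_nhdsWithin_iff.1 h2] with x hx hxS using (hx hxS).le
  have evB (i : Fin (2 * m)) : ∀ᶠ x in 𝓝 (0 : Plane), x ∈ S i → ‖B i x‖ ≤ K := by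
    have h2 := ((hBc i) 0 (h0S i i.2)).norm.eventually_lt_const (hK i)
    filter_upwards [eventually_nhdsWithin_iff.1 h2] with x hx hxS using (hx hxS).le
  have evn : ∀ᶠ x in 𝓝 (0 : Plane), 1 / 2 < ⟪n, M x⟫ := by
    have h1 : ContinuousAt M 0 := hMc.continuousAt (hO.mem_nhds hs.zero_mem_star)
    have h2 : ContinuousAt (fun x => ⟪n, M x⟫) 0 := continuousAt_const.inner h1
    refine h2.eventually_const_lt ?_
    have h3 : ⟪n, n⟫ = 1 := (orthonormal_three_iff.1 ho).1.2.2
    simp only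
    rw [hM0, h3]
    norm_num
  obtain ⟨ρ, hρ, hball⟩ := Metric.eventually_nhds_iff_ball.1
    ((eventually_all.2 evA).and ((eventually_all.2 evB).and (evn.and
      (hO.mem_nhds hs.zero_mem_star))))
  have hbS : Metric.ball (0 : Plane) ρ ⊆ star m α l := fun x hx => (hball x hx).2.2.2
  have hcov : Metric.ball (0 : Plane) ρ ⊆ ⋃ i : Fin (2 * m), cone α i := fun x _ => by
    obtain ⟨i, hi, hx⟩ := hs.exists_mem_cone x
    exact mem_iUnion.2 ⟨⟨i, hi⟩, hx⟩
  have hsub (i : Fin (2 * m)) : Metric.ball (0 : Plane) ρ ∩ cone α i ⊆ S i := fun x hx =>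
    (hs.mem_sector_iff_mem_cone i.2).2 ⟨hbS hx.1, hx.2⟩
  have hFlip (x) (hx : x ∈ Metric.ball (0 : Plane) ρ) (y) (hy : y ∈ Metric.ball (0 : Plane) ρ) :
      ‖F y - F x - ι (y - x)‖ ≤ c * ‖y - x‖ := by
    have := norm_image_sub_le_of_piecewise (convex_ball (0 : Plane) ρ)
      (fun i : Fin (2 * m) => isClosed_cone α i) hcov (f := fun x => F x - ι x)
      ((hFc.mono hbS).sub ι.continuous.continuousOn) (f' := fun i x => A i x - ι) (C := c)
      (fun i x hx => ((hAd i x (hsub i hx)).mono (hsub i)).fun_sub ι.hasFDerivWithinAt)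
      (fun i x hx => (hball x hx.1).1 i (hsub i hx)) hx hy
    rw [map_sub]
    rwa [sub_sub_sub_comm] at this
  have hMlip (x) (hx : x ∈ Metric.ball (0 : Plane) ρ) (y) (hy : y ∈ Metric.ball (0 : Plane) ρ) :
      ‖M y - M x‖ ≤ K * ‖y - x‖ :=
    norm_image_sub_le_of_piecewise (convex_ball (0 : Plane) ρ)
      (fun i : Fin (2 * m) => isClosed_cone α i) hcov (hMc.mono hbS) (f' := B)
      (fun i x hx => (hBd i x (hsub i hx)).mono (hsub i))
      (fun i x hx => (hball x hx.1).2.1 i (hsub i hx)) hx hy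
  have hM1 (x) (hx : x ∈ Metric.ball (0 : Plane) ρ) : ‖M x‖ = 1 := by
    obtain ⟨i, hi, hxc⟩ := hs.exists_mem_cone x
    obtain ⟨q, hq, rfl⟩ := hsub ⟨i, hi⟩ ⟨hx, hxc⟩
    exact (h.isPSFrontWith i hi).harmonic.norm_eq_one q hq
  obtain ⟨H, w, hHs, hwd, ⟨K', hK'⟩, hgraph⟩ := exists_c11_graph hK0 ho hcP hFlip hMlip hM1
    (fun x hx => (hball x hx).2.2.1) (fun x hx => hFM x (hbS hx))
  have htgt : (τ.trans H).target ⊆ H.target := by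
    rw [OpenPartialHomeomorph.trans_target]
    exact inter_subset_left
  refine ⟨τ.trans H, w, ?_, hwd.mono htgt, ⟨K', hK'.mono htgt⟩, fun q hq => ?_⟩
  · rw [OpenPartialHomeomorph.trans_source]
    refine ⟨h.mem_source, ?_⟩
    rw [mem_preimage, h.map_center, hHs]
    exact Metric.mem_ball_self hρ
  · rw [OpenPartialHomeomorph.trans_source] at hq
    obtain ⟨hq1, hq2⟩ := hq
    have hq3 : τ.symm (τ q) = q := τ.left_inv hq1
    obtain ⟨h1, h2⟩ := hgraph (τ q) hq2
    simp only [hF, hq3, hsymm0] at h1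
    have hMq : M (τ q) = N q := by simp only [hM, hq3]
    rw [hHs] at hq2
    have hpos : 0 < ⟪n, N q⟫ := by
      have := (hball _ hq2).2.2.1
      rw [hMq] at this
      linarith
    refine ⟨?_, ⟪n, N q⟫, hpos, ?_⟩
    · rw [h1, planeEmb_apply]
      simp only [OpenPartialHomeomorph.coe_trans, Function.comp_apply]
      abel
    · simp only [OpenPartialHomeomorph.coe_trans, Function.comp_apply]
      rw [h2, h2, hMq, planeEmb_apply, planeEmb_apply]
      conv_lhs => rw [Orthonormal.expand ho (N q)]
      simp only [smul_sub, smul_smul, ← hn]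
      have e (t : ℝ) : ⟪n, N q⟫ * -(⟪n, N q⟫⁻¹ * t) = -t := by
        rw [mul_neg, mul_inv_cancel_left₀ hpos.ne']
      rw [e, e]
      simp [real_inner_comm (N q)]
      abel

end StarChart

namespace SurgeryData

variable (S : SurgeryData)

theorem isCompact_Ωs : IsCompact S.Ωs := by
  have : S.Ωs = S.Ω₀ ∩ ({p | p.1 ≤ S.us} ∪ {p | p.2 ≤ S.vs}) := rfl
  rw [this]
  exact (isCompact_rect _ _).inter_right
    ((isClosed_le continuous_fst continuous_const).union
      (isClosed_le continuous_snd continuous_const))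

instance : CompactSpace S.Ωs := isCompact_iff_compactSpace.1 S.isCompact_Ωs

instance : CompactSpace S.Ω₁ := isCompact_iff_compactSpace.1 (isCompact_rect _ _)

instance : CompactSpace S.Ω₂ := isCompact_iff_compactSpace.1 (isCompact_rect _ _)

instance : CompactSpace S.Ω₃ := isCompact_iff_compactSpace.1 (isCompact_rect _ _)

instance : CompactSpace S.Glued := inferInstanceAs (CompactSpace (Quot S.Attach))

instance : Nonempty S.Glued := ⟨S.center⟩

theorem continuous_incs : Continuous S.incs := continuous_quot_mk.comp continuous_inl

theorem continuous_inc₁ : Continuous S.inc₁ :=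
  continuous_quot_mk.comp (continuous_inr.comp continuous_inl)

theorem continuous_inc₂ : Continuous S.inc₂ :=
  continuous_quot_mk.comp (continuous_inr.comp (continuous_inr.comp continuous_inl))

theorem continuous_inc₃ : Continuous S.inc₃ :=
  continuous_quot_mk.comp (continuous_inr.comp (continuous_inr.comp continuous_inr))

/-- Maps of the four pieces that agree along the attaching maps define a map of the glued space. -/
theorem exists_glued_map {Y : Type*} [TopologicalSpace Y] {fs f₁ f₂ f₃ : ℝ × ℝ → Y}
    (hs : ContinuousOn fs S.Ωs) (h₁ : ContinuousOn f₁ S.Ω₁) (h₂ : ContinuousOn f₂ S.Ω₂)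
    (h₃ : ContinuousOn f₃ S.Ω₃)
    (e₁ : ∀ u ∈ Icc 0 (S.umax - S.us), f₁ (u, 0) = fs (S.us + u, S.vs))
    (e₂ : ∀ u ∈ Icc 0 S.ut, f₃ (u, 0) = f₂ (u, 0))
    (e₃ : ∀ v ∈ Icc 0 (S.vmax - S.vs), f₃ (0, v) = fs (S.us, S.vs + v))
    (e₄ : ∀ v ∈ Icc 0 S.vt, f₁ (0, v) = f₂ (0, v)) :
    ∃ F : S.Glued → Y, Continuous F ∧ (∀ p, F (S.incs p) = fs p) ∧ (∀ p, F (S.inc₁ p) = f₁ p) ∧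
      (∀ p, F (S.inc₂ p) = f₂ p) ∧ (∀ p, F (S.inc₃ p) = f₃ p) := by
  let f : S.Pieces → Y := Sum.elim (fun p => fs p) (Sum.elim (fun p => f₁ p)
    (Sum.elim (fun p => f₂ p) (fun p => f₃ p)))
  have hf : Continuous f :=
    hs.domRestrict.sumElim (h₁.domRestrict.sumElim (h₂.domRestrict.sumElim h₃.domRestrict))
  have hcompat : ∀ x y, S.Attach x y → f x = f y := by
    rintro _ _ (⟨⟨⟨u, v⟩, hp⟩, ⟨q, hq⟩, rfl, rfl⟩ | ⟨⟨⟨u, v⟩, hp⟩, ⟨q, hq⟩, rfl, rfl⟩ |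
      ⟨⟨⟨u, v⟩, hp⟩, ⟨q, hq⟩, rfl, rfl⟩ | ⟨⟨⟨u, v⟩, hp⟩, ⟨q, hq⟩, rfl, rfl⟩)
    · exact e₁ u hp.1
    · exact e₂ u hp.1
    · exact e₃ v hp.2
    · exact e₄ v hp.2
  exact ⟨Quot.lift f hcompat, continuous_quot_lift hcompat hf, fun _ => rfl, fun _ => rfl, fun _ => rfl,
    fun _ => rfl⟩

/-- The lengths of the six asymptotic curves that leave the centre. -/
def len : ℕ → ℝ
  | 0 => S.umax - S.us
  | 1 => S.vt
  | 2 => S.ut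
  | 3 => S.vmax - S.vs
  | 4 => S.us
  | 5 => S.vs
  | _ => S.umax - S.us

theorem len_pos (i : ℕ) : 0 < S.len i := by
  have := S.us_lt
  have := S.vs_lt
  unfold len
  split <;> linarith [S.us_pos, S.vs_pos, S.ut_pos, S.vt_pos]

/-- `x` is the point of the sector `i` around the centre with coordinates `c`, `d` along the sides
`i`, `i + 1` of the sector. -/
def IsSectorPoint (i : ℕ) (c d : ℝ) (x : S.Glued) : Prop :=
  match i with
  | 0 => ∃ p, p.1 = (c, d) ∧ S.inc₁ p = x
  | 1 => ∃ p, p.1 = (d, c) ∧ S.inc₂ p = x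
  | 2 => ∃ p, p.1 = (c, d) ∧ S.inc₃ p = x
  | 3 => ∃ p, p.1 = (S.us - d, S.vs + c) ∧ S.incs p = x
  | 4 => ∃ p, p.1 = (S.us - c, S.vs - d) ∧ S.incs p = x
  | 5 => ∃ p, p.1 = (S.us + d, S.vs - c) ∧ S.incs p = x
  | _ => False

/-- The point `x` of the glued space has coordinates `c`, `d` in the sector `i`. -/
structure InSector (i : ℕ) (c d : ℝ) (x : S.Glued) : Prop where
  left_nonneg : 0 ≤ c
  left_le : c ≤ S.len i
  right_nonneg : 0 ≤ d
  right_le : d ≤ S.len (i + 1)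
  point : S.IsSectorPoint i c d x

variable {S}

theorem exists_inSector {i : ℕ} (hi : i < 6) {c d : ℝ} (hc : 0 ≤ c) (hc' : c ≤ S.len i)
    (hd : 0 ≤ d) (hd' : d ≤ S.len (i + 1)) : ∃ x, S.InSector i c d x := by
  suffices ∃ x, S.IsSectorPoint i c d x from this.imp fun x hx => ⟨hc, hc', hd, hd', hx⟩
  have := S.us_lt
  have := S.vs_lt
  have := S.us_pos
  have := S.vs_pos
  interval_cases i <;> simp only [len] at hc' hd'
  · exact ⟨_, ⟨(c, d), ⟨hc, hc'⟩, ⟨hd, hd'⟩⟩, rfl, rfl⟩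
  · exact ⟨_, ⟨(d, c), ⟨hd, hd'⟩, ⟨hc, hc'⟩⟩, rfl, rfl⟩
  · exact ⟨_, ⟨(c, d), ⟨hc, hc'⟩, ⟨hd, hd'⟩⟩, rfl, rfl⟩
  · refine ⟨_, ⟨(S.us - d, S.vs + c), ⟨⟨?_, ?_⟩, ⟨?_, ?_⟩⟩, Or.inl ?_⟩, rfl, rfl⟩ <;>
      simp only <;> linarith
  · refine ⟨_, ⟨(S.us - c, S.vs - d), ⟨⟨?_, ?_⟩, ⟨?_, ?_⟩⟩, Or.inl ?_⟩, rfl, rfl⟩ <;>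
      simp only <;> linarith
  · refine ⟨_, ⟨(S.us + d, S.vs - c), ⟨⟨?_, ?_⟩, ⟨?_, ?_⟩⟩, Or.inr ?_⟩, rfl, rfl⟩ <;>
      simp only <;> linarith

theorem inSector_inc₁ (p : S.Ω₁) : S.InSector 0 p.1.1 p.1.2 (S.inc₁ p) :=
  ⟨p.2.1.1, p.2.1.2, p.2.2.1, p.2.2.2, p, rfl, rfl⟩

theorem inSector_inc₂ (p : S.Ω₂) : S.InSector 1 p.1.2 p.1.1 (S.inc₂ p) :=
  ⟨p.2.2.1, p.2.2.2, p.2.1.1, p.2.1.2, p, rfl, rfl⟩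

theorem inSector_inc₃ (p : S.Ω₃) : S.InSector 2 p.1.1 p.1.2 (S.inc₃ p) :=
  ⟨p.2.1.1, p.2.1.2, p.2.2.1, p.2.2.2, p, rfl, rfl⟩

theorem inSector_upperLeft (p : S.Ωs) (hu : p.1.1 ≤ S.us) (hv : S.vs ≤ p.1.2) :
    S.InSector 3 (p.1.2 - S.vs) (S.us - p.1.1) (S.incs p) := by
  have h1 := p.2.1.1.1
  have h2 := p.2.1.2.2
  refine ⟨by linarith, ?_, by linarith, ?_, p, by simp, rfl⟩ <;> simp only [len] <;> linarith

theorem inSector_lowerLeft (p : S.Ωs) (hu : p.1.1 ≤ S.us) (hv : p.1.2 ≤ S.vs) :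
    S.InSector 4 (S.us - p.1.1) (S.vs - p.1.2) (S.incs p) := by
  have h1 := p.2.1.1.1
  have h2 := p.2.1.2.1
  refine ⟨by linarith, ?_, by linarith, ?_, p, by simp, rfl⟩ <;> simp only [len] <;> linarith

theorem inSector_lowerRight (p : S.Ωs) (hu : S.us ≤ p.1.1) (hv : p.1.2 ≤ S.vs) :
    S.InSector 5 (S.vs - p.1.2) (p.1.1 - S.us) (S.incs p) := by
  have h1 := p.2.1.1.2
  have h2 := p.2.1.2.1
  refine ⟨by linarith, ?_, by linarith, ?_, p, by simp, rfl⟩ <;> simp only [len] <;> linarith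

theorem exists_inSector_of_glued (x : S.Glued) : ∃ i < 6, ∃ c d, S.InSector i c d x := by
  obtain ⟨p, rfl⟩ := Quot.exists_rep x
  rcases p with p | p | p | p
  · rcases le_total p.1.1 S.us with hu | hu
    · rcases le_total p.1.2 S.vs with hv | hv
      · exact ⟨4, by norm_num, _, _, inSector_lowerLeft p hu hv⟩
      · exact ⟨3, by norm_num, _, _, inSector_upperLeft p hu hv⟩
    · rcases p.2.2 with hu' | hv
      · rcases le_total p.1.2 S.vs with hv | hv
        · exact ⟨4, by norm_num, _, _, inSector_lowerLeft p hu' hv⟩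
        · exact ⟨3, by norm_num, _, _, inSector_upperLeft p hu' hv⟩
      · exact ⟨5, by norm_num, _, _, inSector_lowerRight p hu hv⟩
  · exact ⟨0, by norm_num, _, _, inSector_inc₁ p⟩
  · exact ⟨1, by norm_num, _, _, inSector_inc₂ p⟩
  · exact ⟨2, by norm_num, _, _, inSector_inc₃ p⟩

theorem InSector.unique {i : ℕ} {c d : ℝ} {x y : S.Glued} (hi : i < 6) (hx : S.InSector i c d x)
    (hy : S.InSector i c d y) : x = y := by
  have h1 := hx.point
  have h2 := hy.point
  interval_cases i <;> simp only [IsSectorPoint] at h1 h2 <;>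
    obtain ⟨p, hp, rfl⟩ := h1 <;> obtain ⟨q, hq, rfl⟩ := h2 <;>
    rw [Subtype.ext (hp.trans hq.symm)]

theorem InSector.succ {i : ℕ} {d : ℝ} {x : S.Glued} (hi : i < 6) (h : S.InSector i 0 d x) :
    S.InSector ((i + 1) % 6) d 0 x := by
  have hd := h.right_nonneg
  have hd' := h.right_le
  have hx := h.point
  have := S.us_lt
  have := S.vs_lt
  have := S.us_pos
  have := S.vs_pos
  have := S.ut_pos
  have := S.vt_pos
  interval_cases i <;> simp only [IsSectorPoint] at hx <;> obtain ⟨p, hp, rfl⟩ := hx <;>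
    refine ⟨hd, hd', le_rfl, (S.len_pos _).le, ?_⟩ <;> simp only [len] at hd'
  · exact ⟨⟨(0, d), ⟨le_rfl, by linarith⟩, hd, hd'⟩, rfl,
      (Quot.sound (Attach.chi₄ p _ (by rw [hp]) (by rw [hp]))).symm⟩
  · exact ⟨⟨(d, 0), ⟨hd, hd'⟩, le_rfl, by linarith⟩, rfl,
      Quot.sound (Attach.chi₂ _ p rfl (by rw [hp]))⟩
  · refine ⟨⟨(S.us, S.vs + d), ⟨⟨by simp only; linarith, by simp only; linarith⟩,
      by simp only; linarith, by simp only; linarith⟩, Or.inl le_rfl⟩, by simp,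
      (Quot.sound (Attach.chi₃ p _ (by rw [hp]) (by rw [hp]))).symm⟩
  · exact ⟨p, by rw [hp]; simp, rfl⟩
  · exact ⟨p, by rw [hp]; simp, rfl⟩
  · exact ⟨⟨(d, 0), ⟨hd, hd'⟩, le_rfl, by linarith⟩, rfl,
      Quot.sound (Attach.chi₁ _ p rfl (by rw [hp]; simp))⟩

theorem inSector_center {i : ℕ} (hi : i < 6) : S.InSector i 0 0 S.center := by
  have h4 : S.InSector 4 0 0 S.center := by
    simpa [pt, center] using inSector_lowerLeft (S := S) ⟨S.pt, S.pt_mem⟩ le_rfl le_rfl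
  have h5 := h4.succ (by norm_num)
  have h0 := h5.succ (by norm_num)
  have h1 := h0.succ (by norm_num)
  have h2 := h1.succ (by norm_num)
  have h3 := h2.succ (by norm_num)
  interval_cases i <;> assumption

theorem InSector.eq_center {i : ℕ} (hi : i < 6) {x : S.Glued} (h : S.InSector i 0 0 x) :
    x = S.center := h.unique hi (inSector_center hi)

/-- The piecewise linear map of the glued space onto a closed star; the length on the ray `i` is
scaled by `κ i`. -/
theorem exists_star_map {α l κ : ℕ → ℝ} (h : IsStar 3 α l) (hκ6 : κ 6 = κ 0) :
    ∃ T : S.Glued → Plane, Continuous T ∧ ∀ i < 6, ∀ c d x, S.InSector i c d x →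
      T x = rayPoint α i (κ i * c) (κ (i + 1) * d) := by
  have h6 : rayDir α 6 = rayDir α 0 := (h.rayDir_succ_mod (i := 5) (by norm_num)).symm
  obtain ⟨T, hT, hs, h₁, h₂, h₃⟩ := S.exists_glued_map
    (fs := fun p => (κ 0 * max (p.1 - S.us) 0) • rayDir α 0 +
      (κ 3 * max (p.2 - S.vs) 0) • rayDir α 3 + (κ 4 * max (S.us - p.1) 0) • rayDir α 4 +
      (κ 5 * max (S.vs - p.2) 0) • rayDir α 5)
    (f₁ := fun p => (κ 0 * p.1) • rayDir α 0 + (κ 1 * p.2) • rayDir α 1)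
    (f₂ := fun p => (κ 2 * p.1) • rayDir α 2 + (κ 1 * p.2) • rayDir α 1)
    (f₃ := fun p => (κ 2 * p.1) • rayDir α 2 + (κ 3 * p.2) • rayDir α 3)
    (by fun_prop) (by fun_prop) (by fun_prop) (by fun_prop)
    (fun u hu => by simp [hu.1]) (fun u _ => by simp)
    (fun v hv => by simp [hv.1]) (fun v _ => by simp)
  refine ⟨T, hT, fun i hi c d x hx => ?_⟩
  have hc := hx.left_nonneg
  have hd := hx.right_nonneg
  have hp := hx.point
  interval_cases i <;> simp only [IsSectorPoint] at hp <;> obtain ⟨p, hp, rfl⟩ := hp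
  · rw [h₁, hp, rayPoint]
  · rw [h₂, hp, rayPoint, add_comm]
  · rw [h₃, hp, rayPoint]
  · rw [hs, hp, rayPoint]
    simp [hc, hd]
  · rw [hs, hp, rayPoint]
    simp [hc, hd]
  · rw [hs, hp, rayPoint, h6, hκ6]
    simp [hc, hd]
    abel

end SurgeryData

namespace SurgeryData

variable {S : SurgeryData}

theorem inSector_cases_of_rayPoint_eq {α l κ : ℕ → ℝ} (h : IsStar 3 α l) (hκ : ∀ i, 0 < κ i)
    {i j : ℕ} (hi : i < 6) (hj : j < 6) {c d c' d' : ℝ} {x y : S.Glued}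
    (hx : S.InSector i c d x) (hy : S.InSector j c' d' y)
    (e : rayPoint α i (κ i * c) (κ (i + 1) * d) = rayPoint α j (κ j * c') (κ (j + 1) * d')) :
    (c = 0 ∧ d = 0 ∧ c' = 0 ∧ d' = 0) ∨ (i = j ∧ c = c' ∧ d = d') ∨
      (j = (i + 1) % 6 ∧ c = 0 ∧ d' = 0 ∧ κ (i + 1) * d = κ j * c') ∨
      (i = (j + 1) % 6 ∧ c' = 0 ∧ d = 0 ∧ κ (j + 1) * d' = κ i * c) := by
  have mz (k : ℕ) (t : ℝ) : κ k * t = 0 ↔ t = 0 := by simp [(hκ k).ne']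
  rcases h.rayPoint_eq_cases hi hj (mul_nonneg (hκ _).le hx.left_nonneg)
    (mul_nonneg (hκ _).le hx.right_nonneg) (mul_nonneg (hκ _).le hy.left_nonneg)
    (mul_nonneg (hκ _).le hy.right_nonneg) e with
    ⟨h1, h2, h3, h4⟩ | ⟨rfl, h2, h3⟩ | ⟨h1, h2, h3, h4⟩ | ⟨h1, h2, h3, h4⟩
  · exact Or.inl ⟨(mz _ _).1 h1, (mz _ _).1 h2, (mz _ _).1 h3, (mz _ _).1 h4⟩
  · exact Or.inr (Or.inl ⟨rfl, mul_left_cancel₀ (hκ _).ne' h2, mul_left_cancel₀ (hκ _).ne' h3⟩)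
  · exact Or.inr (Or.inr (Or.inl ⟨h1, (mz _ _).1 h2, (mz _ _).1 h3, h4⟩))
  · exact Or.inr (Or.inr (Or.inr ⟨h1, (mz _ _).1 h2, (mz _ _).1 h3, h4⟩))

theorem scale_succ_mod {κ : ℕ → ℝ} (hκ6 : κ 6 = κ 0) {i : ℕ} (hi : i < 6) :
    κ ((i + 1) % 6) = κ (i + 1) := by
  interval_cases i <;> simp [hκ6]

theorem eq_of_rayPoint_eq {α l κ : ℕ → ℝ} (h : IsStar 3 α l) (hκ : ∀ i, 0 < κ i)
    (hκ6 : κ 6 = κ 0) {i j : ℕ} (hi : i < 6) (hj : j < 6) {c d c' d' : ℝ} {x y : S.Glued}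
    (hx : S.InSector i c d x) (hy : S.InSector j c' d' y)
    (e : rayPoint α i (κ i * c) (κ (i + 1) * d) = rayPoint α j (κ j * c') (κ (j + 1) * d')) :
    x = y := by
  rcases inSector_cases_of_rayPoint_eq h hκ hi hj hx hy e with
    ⟨rfl, rfl, rfl, rfl⟩ | ⟨rfl, rfl, rfl⟩ | ⟨rfl, rfl, rfl, h4⟩ | ⟨rfl, rfl, rfl, h4⟩
  · rw [hx.eq_center hi, hy.eq_center hj]
  · exact hx.unique hi hy
  · rw [scale_succ_mod hκ6 hi] at h4
    rw [mul_left_cancel₀ (hκ _).ne' h4] at hx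
    exact (hx.succ hi).unique hj hy
  · rw [scale_succ_mod hκ6 hj] at h4
    rw [mul_left_cancel₀ (hκ _).ne' h4] at hy
    exact hx.unique hi (hy.succ hj)

section StarMap

variable {α l κ : ℕ → ℝ} {T : S.Glued → Plane}

theorem injective_of_star_map (h : IsStar 3 α l) (hκ : ∀ i, 0 < κ i) (hκ6 : κ 6 = κ 0)
    (hTv : ∀ i < 6, ∀ c d x, S.InSector i c d x → T x = rayPoint α i (κ i * c) (κ (i + 1) * d)) :
    Function.Injective T := by
  intro x y e
  obtain ⟨i, hi, c, d, hx⟩ := exists_inSector_of_glued x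
  obtain ⟨j, hj, c', d', hy⟩ := exists_inSector_of_glued y
  rw [hTv i hi c d x hx, hTv j hj c' d' y hy] at e
  exact eq_of_rayPoint_eq h hκ hκ6 hi hj hx hy e

theorem exists_star_map_eq (h : IsStar 3 α l) (hκ : ∀ i, 0 < κ i)
    (hl : ∀ i ≤ 6, l i = κ i * S.len i)
    (hTv : ∀ i < 6, ∀ c d x, S.InSector i c d x → T x = rayPoint α i (κ i * c) (κ (i + 1) * d))
    {μ : Plane → ℝ} (hμ : ∀ i < 6, ∀ c d, 0 ≤ c → 0 ≤ d →
      μ (rayPoint α i c d) = max (c / l i) (d / l (i + 1))) {y : Plane} (hy : μ y ≤ 1) :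
    ∃ x, T x = y := by
  obtain ⟨i, hi, hyi⟩ := h.exists_mem_cone y
  obtain ⟨c, d, hc, hd, rfl⟩ := h.exists_rayPoint_of_mem_cone hi hyi
  have hk := hκ i
  have hk' := hκ (i + 1)
  rw [hμ i hi c d hc hd, max_le_iff, div_le_one (h.length_pos i (by omega)),
    div_le_one (h.length_pos (i + 1) (by omega)), hl i (by omega), hl (i + 1) (by omega)] at hy
  obtain ⟨x, hx⟩ := exists_inSector (S := S) hi (c := c / κ i) (d := d / κ (i + 1))
    (by positivity) ((div_le_iff₀' hk).2 hy.1) (by positivity) ((div_le_iff₀' hk').2 hy.2)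
  refine ⟨x, ?_⟩
  rw [hTv i hi _ _ x hx, mul_div_cancel₀ _ hk.ne', mul_div_cancel₀ _ hk'.ne']

theorem gauge_star_map_le (hκ : ∀ i, 0 < κ i)
    (hl : ∀ i ≤ 6, l i = κ i * S.len i)
    (hTv : ∀ i < 6, ∀ c d x, S.InSector i c d x → T x = rayPoint α i (κ i * c) (κ (i + 1) * d))
    {μ : Plane → ℝ} (hμ : ∀ i < 6, ∀ c d, 0 ≤ c → 0 ≤ d →
      μ (rayPoint α i c d) = max (c / l i) (d / l (i + 1))) (x : S.Glued) : μ (T x) ≤ 1 := by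
  obtain ⟨i, hi, c, d, hx⟩ := exists_inSector_of_glued x
  have hk := hκ i
  have hk' := hκ (i + 1)
  have h1 := S.len_pos i
  have h2 := S.len_pos (i + 1)
  rw [hTv i hi c d x hx, hμ i hi _ _ (mul_nonneg hk.le hx.left_nonneg)
    (mul_nonneg hk'.le hx.right_nonneg), hl i (by omega), hl (i + 1) (by omega)]
  refine max_le ((div_le_one (by positivity)).2 ?_) ((div_le_one (by positivity)).2 ?_)
  · exact mul_le_mul_of_nonneg_left hx.left_le hk.le
  · exact mul_le_mul_of_nonneg_left hx.right_le hk'.le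

theorem exists_star_chart [T2Space S.Glued] (h : IsStar 3 α l) (hκ : ∀ i, 0 < κ i)
    (hκ6 : κ 6 = κ 0) (hl : ∀ i ≤ 6, l i = κ i * S.len i) :
    ∃ τ : OpenPartialHomeomorph S.Glued Plane, S.center ∈ τ.source ∧ τ S.center = 0 ∧
      τ.target = star 3 α l ∧ ∀ i < 6, ∀ c d x, S.InSector i c d x →
        τ.symm (rayPoint α i (κ i * c) (κ (i + 1) * d)) = x := by
  obtain ⟨T, hT, hTv⟩ := S.exists_star_map h hκ6
  obtain ⟨μ, -, hμ⟩ := h.exists_gauge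
  have hinj := injective_of_star_map h hκ hκ6 hTv
  have hemb : Topology.IsClosedEmbedding T := hT.isClosedEmbedding hinj
  have hstar {y : Plane} (hy : y ∈ star 3 α l) : ∃ x, T x = y :=
    exists_star_map_eq h hκ hl hTv hμ ((h.mem_star_iff_gauge hμ).1 hy).le
  have hright {y : Plane} (hy : y ∈ star 3 α l) : T (Function.invFun T y) = y :=
    Function.invFun_eq (hstar hy)
  have hT0 : T S.center = 0 := by
    rw [hTv 0 (by norm_num) 0 0 _ (inSector_center (by norm_num))]
    simp [rayPoint]
  let τ : OpenPartialHomeomorph S.Glued Plane :=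
    { toFun := T
      invFun := Function.invFun T
      source := T ⁻¹' star 3 α l
      target := star 3 α l
      map_source' := fun x hx => hx
      map_target' := fun y hy => by rw [mem_preimage, hright hy]; exact hy
      left_inv' := fun x _ => Function.leftInverse_invFun hinj x
      right_inv' := fun y hy => hright hy
      open_source := h.isOpen_star.preimage hT
      open_target := h.isOpen_star
      continuousOn_toFun := hT.continuousOn
      continuousOn_invFun := hemb.isInducing.continuousOn_iff.2
        (continuousOn_id.congr fun y hy => hright hy) }
  refine ⟨τ, ?_, hT0, rfl, fun i hi c d x hx => ?_⟩
  · change T S.center ∈ star 3 α l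
    rw [hT0]
    exact h.zero_mem_star
  · rw [← hTv i hi c d x hx]
    exact Function.leftInverse_invFun hinj x

end StarMap

theorem isStar_hexagon (S : SurgeryData) : IsStar 3 (fun _ => Real.pi / 3) S.len where
  angle_pos _ _ := by positivity
  angle_lt _ _ := by linarith [Real.pi_pos]
  angle_sum := by simp; ring
  length_pos i _ := S.len_pos i
  length_closed := rfl

instance instT2Space (S : SurgeryData) : T2Space S.Glued := by
  obtain ⟨T, hT, hTv⟩ := S.exists_star_map (κ := fun _ => 1) S.isStar_hexagon rfl
  exact T2Space.of_injective_continuous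
    (injective_of_star_map S.isStar_hexagon (fun _ => one_pos) rfl hTv) hT

/-- The glued space is a closed disk. -/
theorem nonempty_homeomorph_disk (S : SurgeryData) :
    Nonempty (S.Glued ≃ₜ Metric.closedBall (0 : Plane) 1) := by
  have h := S.isStar_hexagon
  have hκ : ∀ _ : ℕ, (0 : ℝ) < 1 := fun _ => one_pos
  have hl : ∀ i ≤ 6, S.len i = 1 * S.len i := fun i _ => (one_mul _).symm
  obtain ⟨T, hT, hTv⟩ := S.exists_star_map (κ := fun _ => 1) h rfl
  obtain ⟨μ, hμc, hμ⟩ := h.exists_gauge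
  have hinj := injective_of_star_map h hκ rfl hTv
  have hμsmul (t : ℝ) (ht : 0 ≤ t) (y : Plane) : μ (t • y) = t * μ y := by
    obtain ⟨i, hi, hyi⟩ := h.exists_mem_cone y
    obtain ⟨c, d, hc, hd, rfl⟩ := h.exists_rayPoint_of_mem_cone hi hyi
    have e : t • rayPoint (fun _ => Real.pi / 3) i c d
        = rayPoint (fun _ => Real.pi / 3) i (t * c) (t * d) := by
      simp only [rayPoint]; module
    rw [e, hμ i hi _ _ (by positivity) (by positivity), hμ i hi _ _ hc hd, mul_max_of_nonneg _ _ ht,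
      mul_div_assoc, mul_div_assoc]
  have hμ0 : μ 0 = 0 := by simpa using hμsmul 0 le_rfl 0
  have hμpos (y : Plane) (hy : y ≠ 0) : 0 < μ y := by
    obtain ⟨i, hi, c, d, hc, hd, rfl⟩ := h.exists_eq_rayPoint hy
    rw [hμ i hi c d hc.le hd]
    exact lt_max_of_lt_left (div_pos hc (S.len_pos i))
  have hμnn (y : Plane) : 0 ≤ μ y := by
    by_cases hy : y = 0
    · rw [hy, hμ0]
    · exact (hμpos y hy).le
  let R (y : Plane) : Plane := (μ y / ‖y‖) • y
  have hRnorm (y : Plane) : ‖R y‖ = μ y := by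
    by_cases hy : y = 0
    · simp [R, hy, hμ0]
    · have := norm_pos_iff.2 hy
      simp only [R, norm_smul, Real.norm_eq_abs, abs_div, abs_norm, abs_of_nonneg (hμnn y)]
      field_simp
  have hRc : Continuous R := by
    rw [continuous_iff_continuousAt]
    intro y
    by_cases hy : y = 0
    · rw [ContinuousAt, hy]
      have h0 : R 0 = 0 := by simp [R]
      rw [h0, tendsto_zero_iff_norm_tendsto_zero]
      simp only [hRnorm]
      rw [← hμ0]
      exact hμc.continuousAt
    · exact (hμc.continuousAt.div continuous_norm.continuousAt (norm_ne_zero_iff.2 hy)).smul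
        continuousAt_id
  have hRinj : Function.Injective R := by
    intro y z e
    have en : μ y = μ z := by rw [← hRnorm, ← hRnorm, e]
    by_cases hy : y = 0
    · by_contra hne
      have := hμpos z (fun hz => hne (hy.trans hz.symm))
      rw [← en, hy, hμ0] at this
      exact lt_irrefl _ this
    · have hy' := hμpos y hy
      have hz : z ≠ 0 := by
        rintro rfl
        rw [en, hμ0] at hy'
        exact lt_irrefl _ hy'
      have h1 := norm_pos_iff.2 hy
      have h2 := norm_pos_iff.2 hz
      have e2 : ‖z‖ • y = ‖y‖ • z := by
        have e3 := congrArg (fun x => (‖y‖ * ‖z‖ / μ y) • x) e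
        simp only [R, smul_smul, ← en] at e3
        convert e3 using 2 <;> field_simp
      have e4 := congrArg μ e2
      rw [hμsmul _ h2.le, hμsmul _ h1.le, ← en] at e4
      rw [mul_right_cancel₀ hy'.ne' e4] at e2
      exact smul_right_injective _ h1.ne' e2
  have hmem (x : S.Glued) : R (T x) ∈ Metric.closedBall (0 : Plane) 1 := by
    rw [mem_closedBall_zero_iff, hRnorm]
    exact gauge_star_map_le hκ hl hTv hμ x
  let D (x : S.Glued) : Metric.closedBall (0 : Plane) 1 := ⟨R (T x), hmem x⟩
  have hD : Continuous D := (hRc.comp hT).subtype_mk _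
  have hDinj : Function.Injective D := fun x y e => hinj (hRinj (congrArg Subtype.val e))
  have hDsurj : Function.Surjective D := by
    rintro ⟨z, hz⟩
    rw [mem_closedBall_zero_iff] at hz
    have hs : 0 ≤ ‖z‖ / μ z := div_nonneg (norm_nonneg _) (hμnn z)
    obtain ⟨x, hx⟩ := exists_star_map_eq h hκ hl hTv hμ (y := (‖z‖ / μ z) • z) (by
      rw [hμsmul _ hs]
      by_cases hz0 : z = 0
      · simp [hz0]
      · rwa [div_mul_cancel₀ _ (hμpos z hz0).ne'])
    refine ⟨x, Subtype.ext ?_⟩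
    change R (T x) = z
    rw [hx]
    by_cases hz0 : z = 0
    · simp [R, hz0]
    · have h1 := norm_pos_iff.2 hz0
      have h2 := hμpos z hz0
      simp only [R]
      rw [hμsmul _ hs, norm_smul, Real.norm_eq_abs, abs_of_nonneg hs, smul_smul]
      have : ‖z‖ / μ z * μ z / (‖z‖ / μ z * ‖z‖) * (‖z‖ / μ z) = 1 := by field_simp
      rw [this, one_smul]
  exact ⟨hD.homeoOfEquivCompactToT2 (f := Equiv.ofBijective D ⟨hDinj, hDsurj⟩)⟩

end SurgeryData

namespace SurgeryData

variable {S : SurgeryData}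

/-- The index of the sector that is covered by a face. -/
def sectorOfFace (k : Fin 6) : ℕ := (k + 4) % 6

theorem sectorOfFace_lt (k : Fin 6) : sectorOfFace k < 6 := Nat.mod_lt _ (by norm_num)

theorem sectorOfFace_injective : Function.Injective sectorOfFace := by decide

theorem exists_sectorOfFace_eq {i : ℕ} (hi : i < 6) : ∃ k, sectorOfFace k = i := by
  interval_cases i
  exacts [⟨2, rfl⟩, ⟨3, rfl⟩, ⟨4, rfl⟩, ⟨5, rfl⟩, ⟨0, rfl⟩, ⟨1, rfl⟩]

variable (S) in
/-- The sector coordinates of the point of the face `k` with asymptotic coordinates `p`. -/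
def faceCoord (k : Fin 6) (p : ℝ × ℝ) : ℝ × ℝ :=
  match k with
  | 0 => (S.us - p.1, S.vs - p.2)
  | 1 => (S.vs - p.2, p.1)
  | 2 => (p.1, p.2)
  | 3 => (p.2, p.1)
  | 4 => (p.1, p.2)
  | 5 => (p.2, S.us - p.1)

theorem faceCoord_injective (k : Fin 6) : Function.Injective (S.faceCoord k) := by
  rintro ⟨u, v⟩ ⟨u', v'⟩ h
  fin_cases k <;> simp only [faceCoord, Prod.mk.injEq, sub_right_inj] at h ⊢ <;> tauto

theorem inSector_chart (k : Fin 6) (p : rect (S.faces.ulen k) (S.faces.vlen k)) :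
    S.InSector (sectorOfFace k) (S.faceCoord k p).1 (S.faceCoord k p).2 (S.faces.chart k p) := by
  fin_cases k
  · exact inSector_lowerLeft ⟨p.1, S.mem_lowerLeft p.2⟩ p.2.1.2 p.2.2.2
  · have h := inSector_lowerRight ⟨(S.us + p.1.1, p.1.2), S.mem_lowerRight p.2⟩
      (le_add_of_nonneg_right p.2.1.1) p.2.2.2
    simp only [add_sub_cancel_left] at h
    exact h
  · exact inSector_inc₁ p
  · exact inSector_inc₂ p
  · exact inSector_inc₃ p
  · have h := inSector_upperLeft ⟨(p.1.1, S.vs + p.1.2), S.mem_upperLeft p.2⟩ p.2.1.2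
      (le_add_of_nonneg_right p.2.2.1)
    simp only [add_sub_cancel_left] at h
    exact h

theorem continuous_chart (k : Fin 6) : Continuous (S.faces.chart k) := by
  fin_cases k
  · exact S.continuous_incs.comp (continuous_subtype_val.subtype_mk _)
  · exact S.continuous_incs.comp (Continuous.subtype_mk (by fun_prop) _)
  · exact S.continuous_inc₁
  · exact S.continuous_inc₂
  · exact S.continuous_inc₃
  · exact S.continuous_incs.comp (Continuous.subtype_mk (by fun_prop) _)

theorem exists_chart_of_inSector {k : Fin 6} {c d : ℝ} {x : S.Glued}
    (h : S.InSector (sectorOfFace k) c d x) :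
    ∃ p, S.faceCoord k p.1 = (c, d) ∧ S.faces.chart k p = x := by
  suffices ∃ p ∈ rect (S.faces.ulen k) (S.faces.vlen k), S.faceCoord k p = (c, d) by
    obtain ⟨p, hp, e⟩ := this
    refine ⟨⟨p, hp⟩, e, InSector.unique (sectorOfFace_lt k) ?_ h⟩
    have := S.inSector_chart k ⟨p, hp⟩
    rwa [e] at this
  have h1 := h.left_nonneg
  have h2 := h.left_le
  have h3 := h.right_nonneg
  have h4 := h.right_le
  fin_cases k <;> simp only [sectorOfFace, len] at h2 h4
  · exact ⟨(S.us - c, S.vs - d), ⟨⟨sub_nonneg.2 h2, sub_le_self _ h1⟩, sub_nonneg.2 h4,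
      sub_le_self _ h3⟩, by simp [faceCoord]⟩
  · exact ⟨(d, S.vs - c), ⟨⟨h3, h4⟩, sub_nonneg.2 h2, sub_le_self _ h1⟩, by simp [faceCoord]⟩
  · exact ⟨(c, d), ⟨⟨h1, h2⟩, h3, h4⟩, rfl⟩
  · exact ⟨(d, c), ⟨⟨h3, h4⟩, h1, h2⟩, rfl⟩
  · exact ⟨(c, d), ⟨⟨h1, h2⟩, h3, h4⟩, rfl⟩
  · exact ⟨(S.us - d, c), ⟨⟨sub_nonneg.2 h4, sub_le_self _ h3⟩, h1, h2⟩, by simp [faceCoord]⟩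

theorem mem_face_iff {k : Fin 6} {x : S.Glued} :
    x ∈ S.faces.face k ↔ ∃ c d, S.InSector (sectorOfFace k) c d x := by
  constructor
  · rintro ⟨p, rfl⟩
    exact ⟨_, _, S.inSector_chart k p⟩
  · rintro ⟨c, d, h⟩
    obtain ⟨p, -, hp⟩ := exists_chart_of_inSector h
    exact ⟨p, hp⟩

theorem center_mem_face (k : Fin 6) : S.center ∈ S.faces.face k :=
  mem_face_iff.2 ⟨0, 0, inSector_center (sectorOfFace_lt k)⟩

theorem InSector.cases {i j : ℕ} (hi : i < 6) (hj : j < 6) {c d c' d' : ℝ} {x : S.Glued}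
    (hx : S.InSector i c d x) (hy : S.InSector j c' d' x) :
    (c = 0 ∧ d = 0 ∧ c' = 0 ∧ d' = 0) ∨ (i = j ∧ c = c' ∧ d = d') ∨
      (j = (i + 1) % 6 ∧ c = 0 ∧ d' = 0) ∨ (i = (j + 1) % 6 ∧ c' = 0 ∧ d = 0) := by
  obtain ⟨T, -, hTv⟩ := S.exists_star_map (κ := fun _ => 1) S.isStar_hexagon rfl
  have := inSector_cases_of_rayPoint_eq S.isStar_hexagon (κ := fun _ => 1) (fun _ => one_pos) hi hj
    hx hy ((hTv i hi c d x hx).symm.trans (hTv j hj c' d' x hy))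
  tauto

theorem len_succ_mod {i : ℕ} (hi : i < 6) : S.len ((i + 1) % 6) = S.len (i + 1) := by
  interval_cases i <;> rfl

theorem InSector.pred {i : ℕ} {d : ℝ} {x : S.Glued} (hi : i < 6)
    (h : S.InSector ((i + 1) % 6) d 0 x) : S.InSector i 0 d x := by
  obtain ⟨y, hy⟩ := exists_inSector (S := S) hi le_rfl (S.len_pos i).le h.left_nonneg
    (h.left_le.trans_eq (len_succ_mod hi))
  rwa [h.unique (Nat.mod_lt _ (by norm_num)) (hy.succ hi)]

theorem isEmbedding_chart (k : Fin 6) : Topology.IsEmbedding (S.faces.chart k) := by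
  have : CompactSpace (rect (S.faces.ulen k) (S.faces.vlen k)) :=
    isCompact_iff_compactSpace.1 (isCompact_rect _ _)
  refine ((continuous_chart k).isClosedEmbedding fun p q e => ?_).isEmbedding
  have hq := inSector_chart k q
  rw [← e] at hq
  have hk := sectorOfFace_lt k
  refine Subtype.ext (faceCoord_injective (S := S) k (Prod.ext_iff.2 ?_))
  rcases (inSector_chart k p).cases hk hk hq with h | h | h | h
  · exact ⟨h.1.trans h.2.2.1.symm, h.2.1.trans h.2.2.2.symm⟩
  · exact h.2
  all_goals omega

section Adjacent

variable {k l : Fin 6}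

theorem exists_inSector_of_mem_inter (hkl : sectorOfFace l = (sectorOfFace k + 1) % 6)
    {x : S.Glued} (hk : x ∈ S.faces.face k)
    (hl : x ∈ S.faces.face l) : ∃ d, S.InSector (sectorOfFace k) 0 d x := by
  obtain ⟨c, d, h⟩ := mem_face_iff.1 hk
  obtain ⟨c', d', h'⟩ := mem_face_iff.1 hl
  have hk' := sectorOfFace_lt k
  refine ⟨d, ?_⟩
  rcases h.cases hk' (sectorOfFace_lt l) h' with e | e | e | e
  · rwa [e.1] at h
  · omega
  · rwa [e.2.1] at h
  · omega

theorem inter_eq_image_left (hkl : sectorOfFace l = (sectorOfFace k + 1) % 6)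
    {E : ℝ × ℝ → Prop} (hE : ∀ p, (S.faceCoord k p).1 = 0 ↔ E p) :
    S.faces.face k ∩ S.faces.face l = S.faces.chart k '' {p | E p.1} := by
  ext x
  constructor
  · rintro ⟨hk, hl⟩
    obtain ⟨d, hd⟩ := exists_inSector_of_mem_inter hkl hk hl
    obtain ⟨p, hp, rfl⟩ := exists_chart_of_inSector hd
    exact ⟨p, (hE _).1 (by rw [hp]), rfl⟩
  · rintro ⟨p, hp, rfl⟩
    have h := inSector_chart k p
    rw [(hE _).2 hp] at h
    have h := h.succ (sectorOfFace_lt k)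
    rw [← hkl] at h
    exact ⟨⟨p, rfl⟩, mem_face_iff.2 ⟨_, _, h⟩⟩

theorem inter_eq_image_right (hkl : sectorOfFace l = (sectorOfFace k + 1) % 6)
    {E : ℝ × ℝ → Prop} (hE : ∀ p, (S.faceCoord l p).2 = 0 ↔ E p) :
    S.faces.face l ∩ S.faces.face k = S.faces.chart l '' {p | E p.1} := by
  ext x
  constructor
  · rintro ⟨hl, hk⟩
    obtain ⟨d, hd⟩ := exists_inSector_of_mem_inter hkl hk hl
    have hd := hd.succ (sectorOfFace_lt k)
    rw [← hkl] at hd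
    obtain ⟨p, hp, rfl⟩ := exists_chart_of_inSector hd
    exact ⟨p, (hE _).1 (by rw [hp]), rfl⟩
  · rintro ⟨p, hp, rfl⟩
    have h := inSector_chart l p
    rw [(hE _).2 hp, hkl] at h
    exact ⟨⟨p, rfl⟩, mem_face_iff.2 ⟨_, _, h.pred (sectorOfFace_lt k)⟩⟩

theorem chart_eq_chart (hkl : sectorOfFace l = (sectorOfFace k + 1) % 6)
    {p : rect (S.faces.ulen k) (S.faces.vlen k)}
    {q : rect (S.faces.ulen l) (S.faces.vlen l)} (hp : (S.faceCoord k p).1 = 0)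
    (hq : (S.faceCoord l q).2 = 0) (h : (S.faceCoord k p).2 = (S.faceCoord l q).1) :
    S.faces.chart k p = S.faces.chart l q := by
  have h1 := inSector_chart k p
  have h2 := inSector_chart l q
  rw [hp, h] at h1
  rw [hq] at h2
  have h1 := h1.succ (sectorOfFace_lt k)
  rw [← hkl] at h1
  exact h1.unique (sectorOfFace_lt l) h2

theorem meetAtUEdge_of_faceCoord (hkl : sectorOfFace l = (sectorOfFace k + 1) % 6)
    (hlen : S.faces.ulen k = S.faces.ulen l) {a b : ℝ}
    (ha : a = 0 ∨ a = S.faces.vlen k) (hb : b = 0 ∨ b = S.faces.vlen l)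
    (hp : ∀ p, (S.faceCoord k p).1 = 0 ↔ p.2 = a) (hq : ∀ p, (S.faceCoord l p).2 = 0 ↔ p.2 = b)
    (h : ∀ t, (S.faceCoord k (t, a)).2 = (S.faceCoord l (t, b)).1) :
    S.faces.MeetAtUEdge k l ∧ S.faces.MeetAtUEdge l k := by
  have key (p : rect (S.faces.ulen k) (S.faces.vlen k))
      (q : rect (S.faces.ulen l) (S.faces.vlen l)) (h1 : p.1.2 = a) (h2 : q.1.2 = b)
      (h3 : q.1.1 = p.1.1) : S.faces.chart k p = S.faces.chart l q := by
    refine chart_eq_chart hkl ((hp _).2 h1) ((hq _).2 h2) ?_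
    rw [show p.1 = (p.1.1, a) from Prod.ext rfl h1, show q.1 = (p.1.1, b) from Prod.ext h3 h2]
    exact h _
  exact ⟨⟨hlen, a, b, ha, hb, Or.inl key, inter_eq_image_left hkl hp⟩,
    ⟨hlen.symm, b, a, hb, ha, Or.inl fun p q h1 h2 h3 => (key q p h2 h1 h3.symm).symm,
      inter_eq_image_right hkl hq⟩⟩

theorem meetAtVEdge_of_faceCoord (hkl : sectorOfFace l = (sectorOfFace k + 1) % 6)
    (hlen : S.faces.vlen k = S.faces.vlen l) {a b : ℝ}
    (ha : a = 0 ∨ a = S.faces.ulen k) (hb : b = 0 ∨ b = S.faces.ulen l)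
    (hp : ∀ p, (S.faceCoord k p).1 = 0 ↔ p.1 = a) (hq : ∀ p, (S.faceCoord l p).2 = 0 ↔ p.1 = b)
    (h : ∀ t, (S.faceCoord k (a, t)).2 = (S.faceCoord l (b, t)).1) :
    S.faces.MeetAtVEdge k l ∧ S.faces.MeetAtVEdge l k := by
  have key (p : rect (S.faces.ulen k) (S.faces.vlen k))
      (q : rect (S.faces.ulen l) (S.faces.vlen l)) (h1 : p.1.1 = a) (h2 : q.1.1 = b)
      (h3 : q.1.2 = p.1.2) : S.faces.chart k p = S.faces.chart l q := by
    refine chart_eq_chart hkl ((hp _).2 h1) ((hq _).2 h2) ?_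
    rw [show p.1 = (a, p.1.2) from Prod.ext h1 rfl, show q.1 = (b, p.1.2) from Prod.ext h2 h3]
    exact h _
  exact ⟨⟨hlen, a, b, ha, hb, Or.inl key, inter_eq_image_left hkl hp⟩,
    ⟨hlen.symm, b, a, hb, ha, Or.inl fun p q h1 h2 h3 => (key q p h2 h1 h3.symm).symm,
      inter_eq_image_right hkl hq⟩⟩

theorem meet_of_succ (hkl : sectorOfFace l = (sectorOfFace k + 1) % 6) :
    (S.faces.MeetAtUEdge k l ∨ S.faces.MeetAtVEdge k l) ∧
      (S.faces.MeetAtUEdge l k ∨ S.faces.MeetAtVEdge l k) := by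
  suffices h : (S.faces.MeetAtUEdge k l ∧ S.faces.MeetAtUEdge l k) ∨
      (S.faces.MeetAtVEdge k l ∧ S.faces.MeetAtVEdge l k) by tauto
  obtain rfl : l = k + 1 := by revert k l; decide
  fin_cases k
  · exact Or.inr (meetAtVEdge_of_faceCoord hkl rfl (Or.inr rfl) (Or.inl rfl)
      (fun p => sub_eq_zero.trans eq_comm) (fun p => Iff.rfl) (fun t => rfl))
  · exact Or.inl (meetAtUEdge_of_faceCoord hkl rfl (Or.inr rfl) (Or.inl rfl)
      (fun p => sub_eq_zero.trans eq_comm) (fun p => Iff.rfl) (fun t => rfl))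
  · exact Or.inr (meetAtVEdge_of_faceCoord hkl rfl (Or.inl rfl) (Or.inl rfl)
      (fun p => Iff.rfl) (fun p => Iff.rfl) (fun t => rfl))
  · exact Or.inl (meetAtUEdge_of_faceCoord hkl rfl (Or.inl rfl) (Or.inl rfl)
      (fun p => Iff.rfl) (fun p => Iff.rfl) (fun t => rfl))
  · exact Or.inr (meetAtVEdge_of_faceCoord hkl rfl (Or.inl rfl) (Or.inr rfl)
      (fun p => Iff.rfl) (fun p => sub_eq_zero.trans eq_comm) (fun t => rfl))
  · exact Or.inl (meetAtUEdge_of_faceCoord hkl rfl (Or.inl rfl) (Or.inr rfl)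
      (fun p => Iff.rfl) (fun p => sub_eq_zero.trans eq_comm) (fun t => rfl))

end Adjacent

theorem exists_chart_eq_center (k : Fin 6) :
    ∃ p : rect (S.faces.ulen k) (S.faces.vlen k), (p.1.1 = 0 ∨ p.1.1 = S.faces.ulen k) ∧
      (p.1.2 = 0 ∨ p.1.2 = S.faces.vlen k) ∧ S.faces.chart k p = S.center := by
  obtain ⟨p, hp, e⟩ := exists_chart_of_inSector (S := S) (inSector_center (sectorOfFace_lt k))
  refine ⟨p, ?_, ?_, e⟩ <;> fin_cases k <;>
    simp only [faceCoord, Prod.mk.injEq, sub_eq_zero] at hp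
  exacts [Or.inr hp.1.symm, Or.inl hp.2, Or.inl hp.1, Or.inl hp.2, Or.inl hp.1, Or.inr hp.2.symm,
    Or.inr hp.2.symm, Or.inr hp.1.symm, Or.inl hp.2, Or.inl hp.1, Or.inl hp.2, Or.inl hp.1]

theorem meetAtVertex_of_not_adjacent {k l : Fin 6} (hkl : k ≠ l)
    (h1 : sectorOfFace l ≠ (sectorOfFace k + 1) % 6)
    (h2 : sectorOfFace k ≠ (sectorOfFace l + 1) % 6) : S.faces.MeetAtVertex k l := by
  obtain ⟨p, hp, hp', ep⟩ := S.exists_chart_eq_center k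
  obtain ⟨q, hq, hq', eq⟩ := S.exists_chart_eq_center l
  refine ⟨p, q, hp, hp', hq, hq', ep.trans eq.symm, ?_⟩
  rw [ep]
  refine Subset.antisymm ?_ (singleton_subset_iff.2 ⟨center_mem_face k, center_mem_face l⟩)
  rintro x ⟨hk, hl⟩
  obtain ⟨c, d, h⟩ := mem_face_iff.1 hk
  obtain ⟨c', d', h'⟩ := mem_face_iff.1 hl
  rcases h.cases (sectorOfFace_lt k) (sectorOfFace_lt l) h' with e | e | e | e
  · rw [e.1, e.2.1] at h
    exact h.eq_center (sectorOfFace_lt k)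
  · exact absurd (sectorOfFace_injective e.1) hkl
  · exact absurd e.1 h1
  · exact absurd e.1 h2

theorem isAsymptoticComplex_faces (S : SurgeryData) : S.faces.IsAsymptoticComplex where
  ulen_pos k := by
    fin_cases k
    exacts [S.us_pos, sub_pos.2 S.us_lt, sub_pos.2 S.us_lt, S.ut_pos, S.ut_pos, S.us_pos]
  vlen_pos k := by
    fin_cases k
    exacts [S.vs_pos, S.vs_pos, S.vt_pos, S.vt_pos, sub_pos.2 S.vs_lt, sub_pos.2 S.vs_lt]
  disk := S.nonempty_homeomorph_disk
  isEmbedding := isEmbedding_chart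
  cover := by
    refine eq_univ_of_forall fun x => mem_iUnion.2 ?_
    obtain ⟨i, hi, c, d, h⟩ := exists_inSector_of_glued x
    obtain ⟨k, rfl⟩ := exists_sectorOfFace_eq hi
    exact ⟨k, mem_face_iff.2 ⟨c, d, h⟩⟩
  inter k l hkl := by
    right
    by_cases h1 : sectorOfFace l = (sectorOfFace k + 1) % 6
    · exact Or.inr (meet_of_succ h1).1
    · by_cases h2 : sectorOfFace k = (sectorOfFace l + 1) % 6
      · exact Or.inr (meet_of_succ h2).2
      · exact Or.inl (meetAtVertex_of_not_adjacent hkl h1 h2)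

theorem ncard_faces_center (S : SurgeryData) : {k | S.center ∈ S.faces.face k}.ncard = 2 * 3 := by
  have : {k | S.center ∈ S.faces.face k} = univ := eq_univ_of_forall center_mem_face
  rw [this, ncard_univ, Nat.card_eq_fintype_card, Fintype.card_fin]

end SurgeryData

section StraightLine

variable {n e : E3}

/-- The normal field of a straight asymptotic curve of unit torsion. -/
noncomputable def lineNormal (n e : E3) (t : ℝ) : E3 := Real.cos t • n + Real.sin t • cross n e

/-- The derivative of the normal field of a straight asymptotic curve. -/
noncomputable def lineNormalDeriv (n e : E3) (t : ℝ) : E3 :=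
  -Real.sin t • n + Real.cos t • cross n e

theorem lineNormal_zero (n e : E3) : lineNormal n e 0 = n := by simp [lineNormal]

theorem lineNormal_neg (n e : E3) (t : ℝ) :
    lineNormal n (-e) t = Real.cos t • n - Real.sin t • cross n e := by
  rw [lineNormal, cross_neg_right, smul_neg, sub_eq_add_neg]

theorem norm_cross_of_unit (hn : ‖n‖ = 1) (he : ‖e‖ = 1) (hne : ⟪e, n⟫ = 0) :
    ⟪cross n e, cross n e⟫ = 1 := by
  rw [inner_cross_cross, real_inner_self_eq_norm_sq, real_inner_self_eq_norm_sq, hn, he, hne]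
  norm_num

theorem norm_combo_eq_one (hn : ‖n‖ = 1) (he : ‖e‖ = 1) (hne : ⟪e, n⟫ = 0) {x y : ℝ}
    (h : x ^ 2 + y ^ 2 = 1) : ‖x • n + y • cross n e‖ = 1 := by
  rw [← sq_eq_sq₀ (norm_nonneg _) zero_le_one, ← real_inner_self_eq_norm_sq, inner_add_left,
    inner_add_right, inner_add_right]
  have h1 : ⟪n, n⟫ = 1 := by rw [real_inner_self_eq_norm_sq, hn, one_pow]
  have h2 : ⟪cross n e, n⟫ = 0 := by rw [real_inner_comm, inner_cross_self_left]
  simp only [real_inner_smul_left, real_inner_smul_right, norm_cross_of_unit hn he hne,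
    inner_cross_self_left, h1, h2]
  linarith

theorem isUnitCurve_lineNormal (hn : ‖n‖ = 1) (he : ‖e‖ = 1) (hne : ⟪e, n⟫ = 0) (a : ℝ) :
    IsUnitCurve a (lineNormal n e) (lineNormalDeriv n e) where
  hasDeriv t _ := (((Real.hasDerivAt_cos t).smul_const n).add
    ((Real.hasDerivAt_sin t).smul_const (cross n e))).hasDerivWithinAt
  continuousOn_deriv := by unfold lineNormalDeriv; fun_prop
  norm_eq_one t _ := norm_combo_eq_one hn he hne (Real.cos_sq_add_sin_sq t)

theorem lineNormalDeriv_ne_zero (hn : ‖n‖ = 1) (he : ‖e‖ = 1) (hne : ⟪e, n⟫ = 0) (t : ℝ) :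
    lineNormalDeriv n e t ≠ 0 := by
  rw [← norm_ne_zero_iff, lineNormalDeriv, norm_combo_eq_one hn he hne]
  · exact one_ne_zero
  · rw [neg_sq]; exact Real.sin_sq_add_cos_sq t

theorem cross_lineNormalDeriv (hn : ‖n‖ = 1) (hne : ⟪e, n⟫ = 0) (t : ℝ) :
    cross (lineNormalDeriv n e t) (lineNormal n e t) = e := by
  have h1 : cross n (cross n e) = -e := by
    rw [cross_cross_right, real_inner_self_eq_norm_sq, hn, real_inner_comm, hne]; simp
  have h2 : cross (cross n e) n = e := by rw [← neg_cross, h1, neg_neg]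
  simp only [lineNormalDeriv, lineNormal, cross_add_left, cross_add_right, cross_smul_left,
    cross_smul_right, cross_self, h1, h2]
  simp only [smul_zero, smul_neg, neg_smul, zero_add, add_zero, neg_neg, smul_smul, ← add_smul]
  rw [← sq, ← sq, Real.cos_sq_add_sin_sq, one_smul]

theorem hasDerivWithinAt_line (z e : E3) (s : Set ℝ) (t : ℝ) :
    HasDerivWithinAt (fun t : ℝ => z + t • e) e s t := by
  simpa using (((hasDerivAt_id t).smul_const e).const_add z).hasDerivWithinAt

end StraightLine

section Edges

variable {a b : ℝ} {r N : ℝ × ℝ → E3}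

theorem partialU_rect_zero (ha : 0 < a) (hb : 0 < b) {γ : ℝ → E3} {c : E3}
    (h : ∀ u ∈ Icc 0 a, r (u, 0) = γ u) (hγ : HasDerivWithinAt γ c (Icc 0 a) 0) :
    partialU (rect a b) r 0 = c :=
  partialU_eq_of_hasDerivWithinAt (uniqueDiffOn_Icc ha)
    ⟨left_mem_Icc.2 ha.le, left_mem_Icc.2 hb.le⟩
    (hγ.congr (fun t ht => h t ht) (h 0 (left_mem_Icc.2 ha.le)))

theorem partialV_rect_zero (ha : 0 < a) (hb : 0 < b) {γ : ℝ → E3} {c : E3}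
    (h : ∀ v ∈ Icc 0 b, r (0, v) = γ v) (hγ : HasDerivWithinAt γ c (Icc 0 b) 0) :
    partialV (rect a b) r 0 = c :=
  partialV_eq_of_hasDerivWithinAt (uniqueDiffOn_Icc hb)
    ⟨left_mem_Icc.2 ha.le, left_mem_Icc.2 hb.le⟩
    (hγ.congr (fun t ht => h t ht) (h 0 (left_mem_Icc.2 hb.le)))

theorem IsPSFrontWith.isUnitCurve_u (h : IsPSFrontWith (rect a b) r N) (hb : 0 ≤ b) :
    IsUnitCurve a (fun u => N (u, 0)) (fun u => partialU (rect a b) N (u, 0)) where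
  hasDeriv t ht :=
    hasDerivWithinAt_partialU h.harmonic.c1m.hasPartialU (p := (t, 0)) ⟨ht, left_mem_Icc.2 hb⟩
  continuousOn_deriv := h.harmonic.c1m.continuousOn_partialU.comp (by fun_prop)
    fun _ ht => ⟨ht, left_mem_Icc.2 hb⟩
  norm_eq_one t ht := h.harmonic.norm_eq_one _ ⟨ht, left_mem_Icc.2 hb⟩

theorem IsPSFrontWith.isUnitCurve_v (h : IsPSFrontWith (rect a b) r N) (ha : 0 ≤ a) :
    IsUnitCurve b (fun v => N (0, v)) (fun v => partialV (rect a b) N (0, v)) where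
  hasDeriv t ht :=
    hasDerivWithinAt_partialV h.harmonic.c1m.hasPartialV (p := (0, t)) ⟨left_mem_Icc.2 ha, ht⟩
  continuousOn_deriv := h.harmonic.c1m.continuousOn_partialV.comp (by fun_prop)
    fun _ ht => ⟨left_mem_Icc.2 ha, ht⟩
  norm_eq_one t ht := h.harmonic.norm_eq_one _ ⟨left_mem_Icc.2 ha, ht⟩

theorem IsPSFrontWith.hasDerivWithinAt_u (h : IsPSFrontWith (rect a b) r N) (hb : 0 ≤ b) {t : ℝ}
    (ht : t ∈ Icc 0 a) : HasDerivWithinAt (fun u => r (u, 0))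
      (cross (partialU (rect a b) N (t, 0)) (N (t, 0))) (Icc 0 a) t := by
  have hp : (t, (0 : ℝ)) ∈ rect a b := ⟨ht, left_mem_Icc.2 hb⟩
  rw [← h.lelieuvreU _ hp]
  exact hasDerivWithinAt_partialU h.c1m.hasPartialU hp

theorem IsPSFrontWith.hasDerivWithinAt_v (h : IsPSFrontWith (rect a b) r N) (ha : 0 ≤ a) {t : ℝ}
    (ht : t ∈ Icc 0 b) : HasDerivWithinAt (fun v => r (0, v))
      (-cross (partialV (rect a b) N (0, t)) (N (0, t))) (Icc 0 b) t := by
  have hp : ((0 : ℝ), t) ∈ rect a b := ⟨left_mem_Icc.2 ha, ht⟩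
  rw [← h.lelieuvreV _ hp]
  exact hasDerivWithinAt_partialV h.c1m.hasPartialV hp

end Edges

theorem ne_zero_of_inner_self_pos {x : E3} (h : 0 < ⟪x, x⟫) : x ≠ 0 := by
  rintro rfl
  simp at h

namespace SurgeryData

variable {S : SurgeryData} {r₀ N₀ : ℝ × ℝ → E3}

theorem pt_mem_Ω₀ (S : SurgeryData) : S.pt ∈ S.Ω₀ := S.pt_mem.1

/-- The fronts `r₁`, `r₂`, `r₃` can replace the removed quadrant of the front `r₀`. -/
structure IsSurgery (S : SurgeryData) (r₀ N₀ : ℝ × ℝ → E3) (eᵤ eᵥ : E3)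
    (r₁ r₂ r₃ N₁ N₂ N₃ : ℝ × ℝ → E3) : Prop where
  front₀ : IsPSFrontWith S.Ω₀ r₀ N₀
  front₁ : IsPSFrontWith S.Ω₁ r₁ N₁
  front₂ : IsPSFrontWith S.Ω₂ r₂ N₂
  front₃ : IsPSFrontWith S.Ω₃ r₃ N₃
  amsler : HasAmslerData S.ut S.vt r₂ N₂ (r₀ S.pt) (N₀ S.pt) eᵤ eᵥ
  glue₁ : ∀ u ∈ Icc 0 (S.umax - S.us),
    r₁ (u, 0) = r₀ (S.us + u, S.vs) ∧ N₁ (u, 0) = N₀ (S.us + u, S.vs)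
  glue₂ : ∀ u ∈ Icc 0 S.ut, r₃ (u, 0) = r₂ (u, 0) ∧ N₃ (u, 0) = N₂ (u, 0)
  glue₃ : ∀ v ∈ Icc 0 (S.vmax - S.vs),
    r₃ (0, v) = r₀ (S.us, S.vs + v) ∧ N₃ (0, v) = N₀ (S.us, S.vs + v)
  glue₄ : ∀ v ∈ Icc 0 S.vt, r₁ (0, v) = r₂ (0, v) ∧ N₁ (0, v) = N₂ (0, v)
  partialU₁ : partialU S.Ω₁ r₁ 0 = partialU S.Ω₀ r₀ S.pt
  partialV₁ : partialV S.Ω₁ r₁ 0 = eᵥ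
  partialU₂ : partialU S.Ω₂ r₂ 0 = eᵤ
  partialV₂ : partialV S.Ω₂ r₂ 0 = eᵥ
  partialU₃ : partialU S.Ω₃ r₃ 0 = eᵤ
  partialV₃ : partialV S.Ω₃ r₃ 0 = partialV S.Ω₀ r₀ S.pt

theorem exists_isSurgery (h₀ : IsPSFrontWith S.Ω₀ r₀ N₀) {eᵤ eᵥ : E3} (hu : ‖eᵤ‖ = 1)
    (hv : ‖eᵥ‖ = 1) (hun : ⟪eᵤ, N₀ S.pt⟫ = 0) (hvn : ⟪eᵥ, N₀ S.pt⟫ = 0) :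
    ∃ r₁ r₂ r₃ N₁ N₂ N₃, S.IsSurgery r₀ N₀ eᵤ eᵥ r₁ r₂ r₃ N₁ N₂ N₃ := by
  have hA : 0 < S.umax - S.us := sub_pos.2 S.us_lt
  have hB : 0 < S.vmax - S.vs := sub_pos.2 S.vs_lt
  set z := r₀ S.pt with hz
  set n := N₀ S.pt with hn'
  have hn : ‖n‖ = 1 := h₀.harmonic.norm_eq_one _ S.pt_mem_Ω₀
  have hv' : ‖-eᵥ‖ = 1 := by rwa [norm_neg]
  have hvn' : ⟪-eᵥ, n⟫ = 0 := by rw [inner_neg_left, hvn, neg_zero]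
  set r := fun p => r₀ (affineMap S.us S.vs 1 1 p) with hr
  set N := fun p => N₀ (affineMap S.us S.vs 1 1 p) with hN
  have hmaps : MapsTo (affineMap S.us S.vs 1 1) (rect (S.umax - S.us) (S.vmax - S.vs)) S.Ω₀ := by
    rintro ⟨u, v⟩ ⟨⟨h1, h2⟩, h3, h4⟩
    have := S.us_pos
    have := S.vs_pos
    dsimp only at *
    exact ⟨⟨by simp only [affineMap]; linarith, by simp only [affineMap]; linarith⟩,
      by simp only [affineMap]; linarith, by simp only [affineMap]; linarith⟩
  have hf : IsPSFrontWith (rect (S.umax - S.us) (S.vmax - S.vs)) r N :=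
    h₀.comp_affineMap (uniqueDiffOn_Icc hA) (uniqueDiffOn_Icc hB) one_ne_zero one_ne_zero hmaps
      (fun _ _ => rfl) (fun _ _ => rfl)
  have hpart := h₀.c1m.hasPartials_comp hmaps (g := r) fun _ _ => rfl
  have h00 : (0 : ℝ × ℝ) ∈ rect (S.umax - S.us) (S.vmax - S.vs) :=
    ⟨left_mem_Icc.2 hA.le, left_mem_Icc.2 hB.le⟩
  have hpt : affineMap S.us S.vs 1 1 0 = S.pt := by simp [affineMap, pt]
  have eU (u : ℝ) : affineMap S.us S.vs 1 1 (u, 0) = (S.us + u, S.vs) := by simp [affineMap]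
  have eV (v : ℝ) : affineMap S.us S.vs 1 1 (0, v) = (S.us, S.vs + v) := by simp [affineMap]
  have hr0 : r (0, 0) = z := by simp only [hr, eU, hz, pt, add_zero]
  have hN0 : N (0, 0) = n := by simp only [hN, eU, hn', pt, add_zero]
  have lineU (a : ℝ) := isUnitCurve_lineNormal hn hu hun a
  have lineV (a : ℝ) := isUnitCurve_lineNormal hn hv' hvn' a
  have lineU' (a t : ℝ) : HasDerivWithinAt (fun t : ℝ => z + t • eᵤ)
      (cross (lineNormalDeriv n eᵤ t) (lineNormal n eᵤ t)) (Icc 0 a) t := by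
    rw [cross_lineNormalDeriv hn hun]
    exact hasDerivWithinAt_line z eᵤ _ t
  have lineV' (a t : ℝ) : HasDerivWithinAt (fun t : ℝ => z + t • eᵥ)
      (-cross (lineNormalDeriv n (-eᵥ) t) (lineNormal n (-eᵥ) t)) (Icc 0 a) t := by
    rw [cross_lineNormalDeriv hn hvn', neg_neg]
    exact hasDerivWithinAt_line z eᵥ _ t
  obtain ⟨r₁, N₁, f₁, u₁, v₁⟩ := exists_isPSFrontWith_of_curves hA S.vt_pos
    (hf.isUnitCurve_u hB.le) (lineV S.vt)
    (fun t ht => ne_zero_of_inner_self_pos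
      (hf.harmonic.partialU_pos _ ⟨ht, left_mem_Icc.2 hB.le⟩))
    (fun t _ => lineNormalDeriv_ne_zero hn hv' hvn' t)
    (by rw [lineNormal_zero, hN0])
    (fun t ht => hf.hasDerivWithinAt_u hB.le ht) (fun t _ => lineV' _ t) (by simp [hr0])
  obtain ⟨r₂, N₂, f₂, u₂, v₂⟩ := exists_isPSFrontWith_of_curves S.ut_pos S.vt_pos
    (lineU S.ut) (lineV S.vt) (fun t _ => lineNormalDeriv_ne_zero hn hu hun t)
    (fun t _ => lineNormalDeriv_ne_zero hn hv' hvn' t)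
    (by rw [lineNormal_zero, lineNormal_zero])
    (fun t _ => lineU' _ t) (fun t _ => lineV' _ t) (by simp)
  obtain ⟨r₃, N₃, f₃, u₃, v₃⟩ := exists_isPSFrontWith_of_curves S.ut_pos hB
    (lineU S.ut) (hf.isUnitCurve_v hA.le) (fun t _ => lineNormalDeriv_ne_zero hn hu hun t)
    (fun t ht => ne_zero_of_inner_self_pos
      (hf.harmonic.partialV_pos _ ⟨left_mem_Icc.2 hA.le, ht⟩))
    (by rw [lineNormal_zero, hN0])
    (fun t _ => lineU' _ t) (fun t ht => hf.hasDerivWithinAt_v hA.le ht) (by simp [hr0])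
  have dU : HasDerivWithinAt (fun u => r (u, 0)) (partialU S.Ω₀ r₀ S.pt)
      (Icc 0 (S.umax - S.us)) 0 := by
    simpa [hpt] using hpart.u 0 h00
  have dV : HasDerivWithinAt (fun v => r (0, v)) (partialV S.Ω₀ r₀ S.pt)
      (Icc 0 (S.vmax - S.vs)) 0 := by
    simpa [hpt] using hpart.v 0 h00
  refine ⟨r₁, r₂, r₃, N₁, N₂, N₃, h₀, f₁, f₂, f₃, ⟨hu, hv, hun, hvn, fun t ht => (u₂ t ht).2,
    fun t ht => ?_, fun t ht => (u₂ t ht).1, fun t ht => (v₂ t ht).1⟩, fun t ht => ?_,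
    fun t ht => ?_, fun t ht => ?_, fun t ht => ?_,
    partialU_rect_zero hA S.vt_pos (fun t ht => (u₁ t ht).1) dU,
    partialV_rect_zero hA S.vt_pos (fun t ht => (v₁ t ht).1) (hasDerivWithinAt_line z eᵥ _ 0),
    partialU_rect_zero S.ut_pos S.vt_pos (fun t ht => (u₂ t ht).1) (hasDerivWithinAt_line z eᵤ _ 0),
    partialV_rect_zero S.ut_pos S.vt_pos (fun t ht => (v₂ t ht).1) (hasDerivWithinAt_line z eᵥ _ 0),
    partialU_rect_zero S.ut_pos hB (fun t ht => (u₃ t ht).1) (hasDerivWithinAt_line z eᵤ _ 0),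
    partialV_rect_zero S.ut_pos hB (fun t ht => (v₃ t ht).1) dV⟩
  · rw [(v₂ t ht).2, lineNormal_neg]
  · rw [← eU]; exact u₁ t ht
  · rw [(u₃ t ht).1, (u₃ t ht).2, (u₂ t ht).1, (u₂ t ht).2]; exact ⟨rfl, rfl⟩
  · rw [← eV]; exact v₃ t ht
  · rw [(v₁ t ht).1, (v₁ t ht).2, (v₂ t ht).1, (v₂ t ht).2]; exact ⟨rfl, rfl⟩

end SurgeryData

section Frame

variable {f g n : E3}

theorem exists_orthonormal_frame (hf : ‖f‖ = 1) (hg : ‖g‖ = 1) (hn : ‖n‖ = 1) (hfn : ⟪f, n⟫ = 0)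
    (hgn : ⟪g, n⟫ = 0) : ∃ (e : E3) (θ : ℝ), 0 < θ ∧ θ < Real.pi ∧ Orthonormal ℝ ![f, e, n] ∧
      (cross f g ≠ 0 → g = Real.cos θ • f + Real.sin θ • e) := by
  have hff : ⟪f, f⟫ = 1 := by rw [real_inner_self_eq_norm_sq, hf, one_pow]
  have hgg : ⟪g, g⟫ = 1 := by rw [real_inner_self_eq_norm_sq, hg, one_pow]
  have hnn : ⟪n, n⟫ = 1 := by rw [real_inner_self_eq_norm_sq, hn, one_pow]
  by_cases hfg : cross f g = 0
  · refine ⟨cross n f, Real.pi / 2, by positivity, by linarith [Real.pi_pos], ?_,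
      fun h => absurd hfg h⟩
    rw [orthonormal_three_iff]
    refine ⟨⟨hff, norm_cross_of_unit hn hf hfn, hnn⟩, inner_cross_self_right _ _, hfn, ?_⟩
    rw [real_inner_comm, inner_cross_self_left]
  · have hpos : 0 < ⟪cross f g, cross f g⟫ := real_inner_self_pos.2 hfg
    rw [inner_cross_cross, hff, hgg, real_inner_comm f g] at hpos
    set c := ⟪f, g⟫ with hc
    have hc1 : c < 1 := by nlinarith
    have hc2 : -1 < c := by nlinarith
    have hs : 0 < Real.sin (Real.arccos c) := by
      rw [Real.sin_arccos]
      exact Real.sqrt_pos.2 (by nlinarith)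
    have hcos : Real.cos (Real.arccos c) = c := Real.cos_arccos hc2.le hc1.le
    have hsq := Real.sin_sq_add_cos_sq (Real.arccos c)
    rw [hcos] at hsq
    set s := Real.sin (Real.arccos c) with hs'
    refine ⟨s⁻¹ • (g - c • f), Real.arccos c, Real.arccos_pos.2 hc1, ?_, ?_, fun _ => ?_⟩
    · refine lt_of_le_of_ne (Real.arccos_le_pi _) fun h => ?_
      rw [h, Real.cos_pi] at hcos
      linarith
    · rw [orthonormal_three_iff]
      have e1 : ⟪f, g - c • f⟫ = 0 := by
        rw [inner_sub_right, real_inner_smul_right, hff, ← hc]; ring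
      have e2 : ⟪g - c • f, g - c • f⟫ = s ^ 2 := by
        rw [inner_sub_left, real_inner_smul_left, e1, inner_sub_right, real_inner_smul_right, hgg,
          real_inner_comm, ← hc]
        linarith
      refine ⟨⟨hff, ?_, hnn⟩, ?_, hfn, ?_⟩
      · rw [real_inner_smul_left, real_inner_smul_right, e2]
        field_simp
      · rw [real_inner_smul_right, e1, mul_zero]
      · rw [real_inner_smul_left, inner_sub_left, real_inner_smul_left, hfn, hgn]
        ring
    · rw [hcos, smul_smul, mul_inv_cancel₀ hs.ne', one_smul, add_sub_cancel]

end Frame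

section Saddle

variable {D : Set (ℝ × ℝ)} {r N r' N' : ℝ × ℝ → E3} {a b ε δ A B : ℝ}

theorem IsPSFrontWith.comp_sector (h : IsPSFrontWith D r N) (hA : 0 < A) (hB : 0 < B) (hε : ε ≠ 0)
    (hδ : δ ≠ 0) (hx : ∀ x ∈ Ico 0 A ×ˢ Ico 0 B, affineMap a b ε δ x ∈ D ∧
      r' x = r (affineMap a b ε δ x) ∧ N' x = N (affineMap a b ε δ x)) :
    IsPSFrontWith (Ico 0 A ×ˢ Ico 0 B) r' N' ∧
      partialU (Ico 0 A ×ˢ Ico 0 B) r' 0 = ε • partialU D r (a, b) ∧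
      partialV (Ico 0 A ×ˢ Ico 0 B) r' 0 = δ • partialV D r (a, b) := by
  have hI := uniqueDiffOn_Ico (0 : ℝ) A
  have hJ := uniqueDiffOn_Ico (0 : ℝ) B
  have h0 : (0 : ℝ × ℝ) ∈ Ico 0 A ×ˢ Ico 0 B := ⟨⟨le_rfl, hA⟩, le_rfl, hB⟩
  have hm : MapsTo (affineMap a b ε δ) (Ico 0 A ×ˢ Ico 0 B) D := fun x h => (hx x h).1
  have hp := h.c1m.hasPartials_comp hm fun x h => (hx x h).2.1
  have e0 : affineMap a b ε δ 0 = (a, b) := by simp [affineMap]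
  refine ⟨h.comp_affineMap hI hJ hε hδ hm (fun x h => (hx x h).2.1) fun x h => (hx x h).2.2, ?_, ?_⟩
  · rw [← e0]; exact hp.eqOn_partialU hI h0
  · rw [← e0]; exact hp.eqOn_partialV hJ h0

theorem IsPSFrontWith.isPSFront_interior (h : IsPSFrontWith D r N)
    (hm : MapsTo (affineMap a b 1 1) (rect A B) D) :
    ContinuousOn (fun p => r (affineMap a b 1 1 p)) (rect A B) ∧
      IsPSFront (interior (rect A B)) fun p => r (affineMap a b 1 1 p) := by
  refine ⟨h.c1m.continuousOn.comp (continuous_affineMap _ _ _ _).continuousOn hm,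
    fun p => N (affineMap a b 1 1 p), ?_⟩
  have hm' := hm.mono_left (interior_subset (s := rect A B))
  rw [rect, interior_prod_eq, interior_Icc, interior_Icc] at hm' ⊢
  exact h.comp_affineMap (uniqueDiffOn_Ioo _ _) (uniqueDiffOn_Ioo _ _) one_ne_zero one_ne_zero hm'
    (fun _ _ => rfl) fun _ _ => rfl

end Saddle

/-- The angles of the star of the surgery: the quadrant of angle `θ` is divided into three. -/
noncomputable def starAngle (θ : ℝ) : ℕ → ℝ
  | 3 => Real.pi - θ
  | 4 => θ
  | 5 => Real.pi - θ
  | _ => θ / 3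

/-- The speeds along the rays of the star of the surgery. -/
def starScale (a b : ℝ) : ℕ → ℝ
  | 0 => a
  | 3 => b
  | 4 => a
  | 5 => b
  | 6 => a
  | _ => 1

theorem starScale_pos {a b : ℝ} (ha : 0 < a) (hb : 0 < b) (i : ℕ) : 0 < starScale a b i := by
  unfold starScale
  split <;> first | assumption | exact one_pos

theorem isStar_starAngle {θ a b : ℝ} (h0 : 0 < θ) (h1 : θ < Real.pi) (ha : 0 < a) (hb : 0 < b)
    (S : SurgeryData) : IsStar 3 (starAngle θ) (fun i => starScale a b i * S.len i) where
  angle_pos i _ := by unfold starAngle; split <;> linarith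
  angle_lt i _ := by unfold starAngle; split <;> linarith
  angle_sum := by simp [Finset.sum_range_succ, starAngle]; ring
  length_pos i _ := mul_pos (starScale_pos ha hb i) (S.len_pos i)
  length_closed := rfl

theorem planeEmb_rayDir (e₁ e₂ : E3) (α : ℕ → ℝ) (i : ℕ) : planeEmb e₁ e₂ (rayDir α i) =
    Real.cos (rayAngle α i) • e₁ + Real.sin (rayAngle α i) • e₂ := by
  simp [planeEmb_apply, rayDir]

namespace SurgeryData

variable {S : SurgeryData} {r₀ r₁ r₂ r₃ N₀ N₁ N₂ N₃ : ℝ × ℝ → E3} {eᵤ eᵥ : E3}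
  {ψ N : S.Glued → E3}

/-- `ψ` and `N` are the maps given on the four pieces by the fronts `rᵢ` and their normals. -/
structure IsGluedFront (r₀ r₁ r₂ r₃ N₀ N₁ N₂ N₃ : ℝ × ℝ → E3) (ψ N : S.Glued → E3) : Prop where
  continuous_map : Continuous ψ
  continuous_normal : Continuous N
  incs : ∀ p : S.Ωs, ψ (S.incs p) = r₀ p ∧ N (S.incs p) = N₀ p
  inc₁ : ∀ p : S.Ω₁, ψ (S.inc₁ p) = r₁ p ∧ N (S.inc₁ p) = N₁ p
  inc₂ : ∀ p : S.Ω₂, ψ (S.inc₂ p) = r₂ p ∧ N (S.inc₂ p) = N₂ p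
  inc₃ : ∀ p : S.Ω₃, ψ (S.inc₃ p) = r₃ p ∧ N (S.inc₃ p) = N₃ p

theorem IsSurgery.exists_isGluedFront (h : S.IsSurgery r₀ N₀ eᵤ eᵥ r₁ r₂ r₃ N₁ N₂ N₃) :
    ∃ ψ N : S.Glued → E3, IsGluedFront r₀ r₁ r₂ r₃ N₀ N₁ N₂ N₃ ψ N := by
  obtain ⟨ψ, hψ, hs, h₁, h₂, h₃⟩ := S.exists_glued_map
    (h.front₀.c1m.continuousOn.mono fun _ h => h.1) h.front₁.c1m.continuousOn
    h.front₂.c1m.continuousOn h.front₃.c1m.continuousOn (fun u hu => (h.glue₁ u hu).1)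
    (fun u hu => (h.glue₂ u hu).1) (fun v hv => (h.glue₃ v hv).1) (fun v hv => (h.glue₄ v hv).1)
  obtain ⟨N, hN, hs', h₁', h₂', h₃'⟩ := S.exists_glued_map
    (h.front₀.harmonic.c1m.continuousOn.mono fun _ h => h.1) h.front₁.harmonic.c1m.continuousOn
    h.front₂.harmonic.c1m.continuousOn h.front₃.harmonic.c1m.continuousOn
    (fun u hu => (h.glue₁ u hu).2) (fun u hu => (h.glue₂ u hu).2) (fun v hv => (h.glue₃ v hv).2)
    (fun v hv => (h.glue₄ v hv).2)
  exact ⟨ψ, N, hψ, hN, fun p => ⟨hs p, hs' p⟩, fun p => ⟨h₁ p, h₁' p⟩, fun p => ⟨h₂ p, h₂' p⟩,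
    fun p => ⟨h₃ p, h₃' p⟩⟩

theorem IsSurgery.isBranchedPSFront (h : S.IsSurgery r₀ N₀ eᵤ eᵥ r₁ r₂ r₃ N₁ N₂ N₃)
    (hg : IsGluedFront r₀ r₁ r₂ r₃ N₀ N₁ N₂ N₃ ψ N) : S.faces.IsBranchedPSFront ψ := by
  refine ⟨S.isAsymptoticComplex_faces, fun k => ?_⟩
  have id00 (p : ℝ × ℝ) : affineMap 0 0 1 1 p = p := by simp [affineMap]
  have m0 (A B : ℝ) : MapsTo (affineMap 0 0 1 1) (rect A B) (rect A B) := fun p hp => by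
    rwa [id00]
  fin_cases k
  · exact ⟨_, fun p => by rw [id00]; exact (hg.incs _).1, h.front₀.isPSFront_interior fun p hp => by
      rw [id00]; exact (S.mem_lowerLeft hp).1⟩
  · have e (p : ℝ × ℝ) : affineMap S.us 0 1 1 p = (S.us + p.1, p.2) := by simp [affineMap]
    exact ⟨_, fun p => by rw [e]; exact (hg.incs _).1, h.front₀.isPSFront_interior fun p hp => by
      rw [e]; exact (S.mem_lowerRight hp).1⟩
  · exact ⟨_, fun p => by rw [id00]; exact (hg.inc₁ _).1, h.front₁.isPSFront_interior (m0 _ _)⟩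
  · exact ⟨_, fun p => by rw [id00]; exact (hg.inc₂ _).1, h.front₂.isPSFront_interior (m0 _ _)⟩
  · exact ⟨_, fun p => by rw [id00]; exact (hg.inc₃ _).1, h.front₃.isPSFront_interior (m0 _ _)⟩
  · have e (p : ℝ × ℝ) : affineMap 0 S.vs 1 1 p = (p.1, S.vs + p.2) := by simp [affineMap]
    exact ⟨_, fun p => by rw [e]; exact (hg.incs _).1, h.front₀.isPSFront_interior fun p hp => by
      rw [e]; exact (S.mem_upperLeft hp).1⟩

variable (S) in
/-- The derivatives at the centre of the asymptotic curves that leave it, in the parameters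
of the pieces. -/
noncomputable def tangent (r₀ : ℝ × ℝ → E3) (eᵤ eᵥ : E3) : ℕ → E3
  | 0 => partialU S.Ω₀ r₀ S.pt
  | 1 => eᵥ
  | 2 => eᵤ
  | 3 => partialV S.Ω₀ r₀ S.pt
  | 4 => -partialU S.Ω₀ r₀ S.pt
  | 5 => -partialV S.Ω₀ r₀ S.pt
  | _ => partialU S.Ω₀ r₀ S.pt

section Chart

variable {α l κ : ℕ → ℝ} {τ : OpenPartialHomeomorph S.Glued Plane}

theorem inSector_symm_rayPoint (hκ : ∀ i, 0 < κ i) (hl : ∀ i ≤ 6, l i = κ i * S.len i)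
    (hτ : ∀ i < 6, ∀ c d x, S.InSector i c d x →
      τ.symm (rayPoint α i (κ i * c) (κ (i + 1) * d)) = x) {i : ℕ} (hi : i < 6) {c d : ℝ}
    (hc : c ∈ Ico 0 (l i)) (hd : d ∈ Ico 0 (l (i + 1))) :
    S.InSector i (c / κ i) (d / κ (i + 1)) (τ.symm (rayPoint α i c d)) := by
  have hk := hκ i
  have hk' := hκ (i + 1)
  rw [hl i (by omega)] at hc
  rw [hl (i + 1) (by omega)] at hd
  obtain ⟨x, hx⟩ := exists_inSector (S := S) hi (div_nonneg hc.1 hk.le)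
    ((div_le_iff₀' hk).2 hc.2.le) (div_nonneg hd.1 hk'.le) ((div_le_iff₀' hk').2 hd.2.le)
  have := hτ i hi _ _ x hx
  rw [mul_div_cancel₀ _ hk.ne', mul_div_cancel₀ _ hk'.ne'] at this
  rwa [this]

theorem IsSurgery.isPSFrontWith_sector (h : S.IsSurgery r₀ N₀ eᵤ eᵥ r₁ r₂ r₃ N₁ N₂ N₃)
    (hg : IsGluedFront r₀ r₁ r₂ r₃ N₀ N₁ N₂ N₃ ψ N) (hκ : ∀ i, 0 < κ i)
    (hl : ∀ i ≤ 6, l i = κ i * S.len i)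
    (hτ : ∀ i < 6, ∀ c d x, S.InSector i c d x →
      τ.symm (rayPoint α i (κ i * c) (κ (i + 1) * d)) = x) {i : ℕ} (hi : i < 6) :
    IsPSFrontWith (sectorDomain l i) (fun x => ψ (τ.symm (sectorPoint α i x)))
        (fun x => N (τ.symm (sectorPoint α i x))) ∧
      partialU (sectorDomain l i) (fun x => ψ (τ.symm (sectorPoint α i x))) 0 =
        (κ (if Even i then i else i + 1))⁻¹ •
          S.tangent r₀ eᵤ eᵥ (if Even i then i else i + 1) ∧
      partialV (sectorDomain l i) (fun x => ψ (τ.symm (sectorPoint α i x))) 0 =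
        (κ (if Even i then i + 1 else i))⁻¹ •
          S.tangent r₀ eᵤ eᵥ (if Even i then i + 1 else i) := by
  have hl0 (j : ℕ) (hj : j ≤ 6) : 0 < l j := by
    rw [hl j hj]; exact mul_pos (hκ j) (S.len_pos j)
  have hne (j : ℕ) : (κ j)⁻¹ ≠ 0 := inv_ne_zero (hκ j).ne'
  have hne' (j : ℕ) : -(κ j)⁻¹ ≠ 0 := neg_ne_zero.2 (hne j)
  have even (j : ℕ) (hj : j < 6) (he : Even j) (x : ℝ × ℝ)
      (hx : x ∈ Ico 0 (l j) ×ˢ Ico 0 (l (j + 1))) :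
      S.InSector j (x.1 / κ j) (x.2 / κ (j + 1)) (τ.symm (sectorPoint α j x)) := by
    rw [sectorPoint_of_even α he]
    exact inSector_symm_rayPoint hκ hl hτ hj hx.1 hx.2
  have odd (j : ℕ) (hj : j < 6) (he : ¬Even j) (x : ℝ × ℝ)
      (hx : x ∈ Ico 0 (l (j + 1)) ×ˢ Ico 0 (l j)) :
      S.InSector j (x.2 / κ j) (x.1 / κ (j + 1)) (τ.symm (sectorPoint α j x)) := by
    rw [sectorPoint_of_not_even α he]
    exact inSector_symm_rayPoint hκ hl hτ hj hx.2 hx.1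
  by_cases he : Even i
  · simp only [sectorDomain_of_even l he, if_pos he]
    have key := even i hi he
    interval_cases i
    · obtain ⟨g1, g2, g3⟩ := h.front₁.comp_sector (hl0 0 (by omega)) (hl0 1 (by omega)) (hne 0)
        (hne 1) (a := 0) (b := 0) (r' := fun x => ψ (τ.symm (sectorPoint α 0 x)))
        (N' := fun x => N (τ.symm (sectorPoint α 0 x))) fun x hx => by
          obtain ⟨p, hp, e⟩ := (key x hx).point
          have e' : affineMap 0 0 (κ 0)⁻¹ (κ 1)⁻¹ x = p.1 := by
            rw [hp]; simp [affineMap, div_eq_inv_mul]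
          rw [e', ← e]
          exact ⟨p.2, hg.inc₁ p⟩
      exact ⟨g1, g2.trans (congrArg _ h.partialU₁), g3.trans (congrArg _ h.partialV₁)⟩
    · exact absurd he (by decide)
    · obtain ⟨g1, g2, g3⟩ := h.front₃.comp_sector (hl0 2 (by omega)) (hl0 3 (by omega)) (hne 2)
        (hne 3) (a := 0) (b := 0) (r' := fun x => ψ (τ.symm (sectorPoint α 2 x)))
        (N' := fun x => N (τ.symm (sectorPoint α 2 x))) fun x hx => by
          obtain ⟨p, hp, e⟩ := (key x hx).point
          have e' : affineMap 0 0 (κ 2)⁻¹ (κ 3)⁻¹ x = p.1 := by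
            rw [hp]; simp [affineMap, div_eq_inv_mul]
          rw [e', ← e]
          exact ⟨p.2, hg.inc₃ p⟩
      exact ⟨g1, g2.trans (congrArg _ h.partialU₃), g3.trans (congrArg _ h.partialV₃)⟩
    · exact absurd he (by decide)
    · obtain ⟨g1, g2, g3⟩ := h.front₀.comp_sector (hl0 4 (by omega)) (hl0 5 (by omega)) (hne' 4)
        (hne' 5) (a := S.us) (b := S.vs) (r' := fun x => ψ (τ.symm (sectorPoint α 4 x)))
        (N' := fun x => N (τ.symm (sectorPoint α 4 x))) fun x hx => by
          obtain ⟨p, hp, e⟩ := (key x hx).point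
          have e' : affineMap S.us S.vs (-(κ 4)⁻¹) (-(κ 5)⁻¹) x = p.1 := by
            rw [hp]; simp [affineMap, div_eq_inv_mul, sub_eq_add_neg]
          rw [e', ← e]
          exact ⟨p.2.1, hg.incs p⟩
      exact ⟨g1, g2.trans ((neg_smul _ _).trans (smul_neg _ _).symm),
        g3.trans ((neg_smul _ _).trans (smul_neg _ _).symm)⟩
    · exact absurd he (by decide)
  · simp only [sectorDomain_of_not_even l he, if_neg he]
    have key := odd i hi he
    interval_cases i
    · exact absurd (by decide) he
    · obtain ⟨g1, g2, g3⟩ := h.front₂.comp_sector (hl0 2 (by omega)) (hl0 1 (by omega)) (hne 2)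
        (hne 1) (a := 0) (b := 0) (r' := fun x => ψ (τ.symm (sectorPoint α 1 x)))
        (N' := fun x => N (τ.symm (sectorPoint α 1 x))) fun x hx => by
          obtain ⟨p, hp, e⟩ := (key x hx).point
          have e' : affineMap 0 0 (κ 2)⁻¹ (κ 1)⁻¹ x = p.1 := by
            rw [hp]; simp [affineMap, div_eq_inv_mul]
          rw [e', ← e]
          exact ⟨p.2, hg.inc₂ p⟩
      exact ⟨g1, g2.trans (congrArg _ h.partialU₂), g3.trans (congrArg _ h.partialV₂)⟩
    · exact absurd (by decide) he
    · obtain ⟨g1, g2, g3⟩ := h.front₀.comp_sector (hl0 4 (by omega)) (hl0 3 (by omega)) (hne' 4)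
        (hne 3) (a := S.us) (b := S.vs) (r' := fun x => ψ (τ.symm (sectorPoint α 3 x)))
        (N' := fun x => N (τ.symm (sectorPoint α 3 x))) fun x hx => by
          obtain ⟨p, hp, e⟩ := (key x hx).point
          have e' : affineMap S.us S.vs (-(κ 4)⁻¹) (κ 3)⁻¹ x = p.1 := by
            rw [hp]; simp [affineMap, div_eq_inv_mul, sub_eq_add_neg]
          rw [e', ← e]
          exact ⟨p.2.1, hg.incs p⟩
      exact ⟨g1, g2.trans ((neg_smul _ _).trans (smul_neg _ _).symm), g3⟩
    · exact absurd (by decide) he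
    · obtain ⟨g1, g2, g3⟩ := h.front₀.comp_sector (hl0 6 (by omega)) (hl0 5 (by omega)) (hne 6)
        (hne' 5) (a := S.us) (b := S.vs) (r' := fun x => ψ (τ.symm (sectorPoint α 5 x)))
        (N' := fun x => N (τ.symm (sectorPoint α 5 x))) fun x hx => by
          obtain ⟨p, hp, e⟩ := (key x hx).point
          have e' : affineMap S.us S.vs (κ 6)⁻¹ (-(κ 5)⁻¹) x = p.1 := by
            rw [hp]; simp [affineMap, div_eq_inv_mul, sub_eq_add_neg]
          rw [e', ← e]
          exact ⟨p.2.1, hg.incs p⟩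
      exact ⟨g1, g2, g3.trans ((neg_smul _ _).trans (smul_neg _ _).symm)⟩

theorem IsSurgery.isImmersedSaddleAt (h : S.IsSurgery r₀ N₀ eᵤ eᵥ r₁ r₂ r₃ N₁ N₂ N₃)
    (hg : IsGluedFront r₀ r₁ r₂ r₃ N₀ N₁ N₂ N₃ ψ N) (hκ : ∀ i, 0 < κ i)
    (hl : ∀ i ≤ 6, l i = κ i * S.len i)
    (hτ : ∀ i < 6, ∀ c d x, S.InSector i c d x →
      τ.symm (rayPoint α i (κ i * c) (κ (i + 1) * d)) = x)
    (hc : IsStarChart ψ N S.center 3 α l τ) {e₁ e₂ : E3} (ho : Orthonormal ℝ ![e₁, e₂, N S.center])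
    (ht : ∀ k ≤ 6, (κ k)⁻¹ • S.tangent r₀ eᵤ eᵥ k = planeEmb e₁ e₂ (rayDir α k)) :
    IsImmersedSaddleAt ψ N S.center 3 := by
  obtain ⟨hgraph, hF⟩ := hc.isLocalC11Graph hg.continuous_map hg.continuous_normal ho
    (fun i hi => by
      rw [(h.isPSFrontWith_sector hg hκ hl hτ hi).2.1, ht _ (by split_ifs <;> omega)]
      simp only [sectorPoint]
      split_ifs <;> simp)
    (fun i hi => by
      rw [(h.isPSFrontWith_sector hg hκ hl hτ hi).2.2, ht _ (by split_ifs <;> omega)]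
      simp only [sectorPoint]
      split_ifs <;> simp)
  refine ⟨α, l, τ, e₁, e₂, hc, ho, fun i hi => ⟨1, one_pos, ?_⟩, hgraph⟩
  rw [one_smul, ← planeEmb_rayDir]
  have hline : HasDerivAt (fun t : ℝ => t • rayDir α i) (rayDir α i) 0 := by
    simpa using (hasDerivAt_id (0 : ℝ)).smul_const (rayDir α i)
  have hF' : HasFDerivAt (fun x => ψ (τ.symm x)) (planeEmb e₁ e₂) ((0 : ℝ) • rayDir α i) := by
    rwa [zero_smul]
  exact (hF'.comp_hasDerivAt (0 : ℝ) hline).hasDerivWithinAt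

end Chart

theorem cross_partials_ne_zero (h₀ : IsPSFrontWith S.Ω₀ r₀ N₀)
    (h : cross (partialU S.Ω₀ N₀ S.pt) (partialV S.Ω₀ N₀ S.pt) ≠ 0) :
    cross (partialU S.Ω₀ r₀ S.pt) (partialV S.Ω₀ r₀ S.pt) ≠ 0 := by
  have hp := S.pt_mem_Ω₀
  have hn : ⟪N₀ S.pt, N₀ S.pt⟫ = 1 := by
    rw [real_inner_self_eq_norm_sq, h₀.harmonic.norm_eq_one _ hp, one_pow]
  have hu : ⟪N₀ S.pt, partialU S.Ω₀ N₀ S.pt⟫ = 0 :=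
    inner_deriv_eq_zero_of_norm_eq_one (S.us_pos.trans S.us_lt) (f := fun t => N₀ (t, S.vs))
      (f' := fun t => partialU S.Ω₀ N₀ (t, S.vs))
      (fun t ht => hasDerivWithinAt_partialU h₀.harmonic.c1m.hasPartialU (p := (t, S.vs)) ⟨ht, hp.2⟩)
      (fun t ht => h₀.harmonic.norm_eq_one _ ⟨ht, hp.2⟩) hp.1
  have hv : ⟪N₀ S.pt, partialV S.Ω₀ N₀ S.pt⟫ = 0 :=
    inner_deriv_eq_zero_of_norm_eq_one (S.vs_pos.trans S.vs_lt) (f := fun t => N₀ (S.us, t))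
      (f' := fun t => partialV S.Ω₀ N₀ (S.us, t))
      (fun t ht => hasDerivWithinAt_partialV h₀.harmonic.c1m.hasPartialV (p := (S.us, t)) ⟨hp.1, ht⟩)
      (fun t ht => h₀.harmonic.norm_eq_one _ ⟨hp.1, ht⟩) hp.2
  rw [h₀.lelieuvreU _ hp, h₀.lelieuvreV _ hp]
  generalize N₀ S.pt = n at *
  generalize partialU S.Ω₀ N₀ S.pt = x at *
  generalize partialV S.Ω₀ N₀ S.pt = y at *
  intro h0
  rw [cross_neg_right, neg_eq_zero, cross_cross, inner_cross_self_right, zero_smul, sub_zero,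
    inner_cross_cyclic] at h0
  have hn0 : n ≠ 0 := by
    rintro rfl
    simp at hn
  have h1 : ⟪n, cross x y⟫ = 0 := by
    rw [real_inner_comm]
    exact (smul_eq_zero.1 h0).resolve_right hn0
  have h2 : cross n (cross x y) = 0 := by
    rw [cross_cross_right, hu, hv]; simp
  have h3 := inner_cross_cross n (cross x y) n (cross x y)
  rw [h2, hn, h1, inner_zero_left, one_mul, zero_mul, sub_zero] at h3
  exact h (inner_self_eq_zero.1 h3.symm)

end SurgeryData

theorem rayAngle_starAngle (θ : ℝ) : rayAngle (starAngle θ) 0 = 0 ∧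
    rayAngle (starAngle θ) 1 = θ / 3 ∧ rayAngle (starAngle θ) 2 = 2 * (θ / 3) ∧
    rayAngle (starAngle θ) 3 = θ ∧ rayAngle (starAngle θ) 4 = Real.pi ∧
    rayAngle (starAngle θ) 5 = θ + Real.pi ∧ rayAngle (starAngle θ) 6 = 2 * Real.pi := by
  simp only [rayAngle, Finset.sum_range_succ, Finset.sum_range_zero, starAngle]
  refine ⟨trivial, ?_, ?_, ?_, ?_, ?_, ?_⟩ <;> ring

section Directions

variable {e₁ e₂ n : E3}

theorem norm_cos_smul_add_sin_smul (ho : Orthonormal ℝ ![e₁, e₂, n]) (t : ℝ) :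
    ‖Real.cos t • e₁ + Real.sin t • e₂‖ = 1 := by
  obtain ⟨⟨h1, h2, -⟩, h3, -⟩ := orthonormal_three_iff.1 ho
  rw [← sq_eq_sq₀ (norm_nonneg _) zero_le_one, ← real_inner_self_eq_norm_sq, inner_add_left,
    inner_add_right, inner_add_right]
  simp only [real_inner_smul_left, real_inner_smul_right, h1, h2, h3, real_inner_comm e₁ e₂]
  linarith [Real.cos_sq_add_sin_sq t]

theorem inner_cos_smul_add_sin_smul (ho : Orthonormal ℝ ![e₁, e₂, n]) (t : ℝ) :
    ⟪Real.cos t • e₁ + Real.sin t • e₂, n⟫ = 0 := by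
  obtain ⟨-, -, h4, h5⟩ := orthonormal_three_iff.1 ho
  rw [inner_add_left, real_inner_smul_left, real_inner_smul_left, h4, h5]
  ring

end Directions

namespace SurgeryData

variable {S : SurgeryData} {r₀ N₀ : ℝ × ℝ → E3}

theorem exists_saddle_surgery (h₀ : IsPSFrontWith S.Ω₀ r₀ N₀) :
    ∃ (r₁ r₂ r₃ N₁ N₂ N₃ : ℝ × ℝ → E3) (eᵤ eᵥ : E3) (ψ N : S.Glued → E3),
      S.IsSurgery r₀ N₀ eᵤ eᵥ r₁ r₂ r₃ N₁ N₂ N₃ ∧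
      IsGluedFront r₀ r₁ r₂ r₃ N₀ N₁ N₂ N₃ ψ N ∧ HasSaddleStructureAt ψ N S.center 3 ∧
      (cross (partialU S.Ω₀ N₀ S.pt) (partialV S.Ω₀ N₀ S.pt) ≠ 0 →
        IsImmersedSaddleAt ψ N S.center 3) := by
  have hp := S.pt_mem_Ω₀
  set x := partialU S.Ω₀ r₀ S.pt with hx
  set y := partialV S.Ω₀ r₀ S.pt with hy
  have hx0 : 0 < ‖x‖ := norm_pos_iff.2 (ne_zero_of_inner_self_pos (h₀.regularU _ hp))
  have hy0 : 0 < ‖y‖ := norm_pos_iff.2 (ne_zero_of_inner_self_pos (h₀.regularV _ hp))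
  have hxn : ⟪x, N₀ S.pt⟫ = 0 := by
    rw [hx, h₀.lelieuvreU _ hp, real_inner_comm, inner_cross_self_right]
  have hyn : ⟪y, N₀ S.pt⟫ = 0 := by
    rw [hy, h₀.lelieuvreV _ hp, real_inner_comm, inner_neg_right, inner_cross_self_right, neg_zero]
  have hunit {w : E3} (hw : 0 < ‖w‖) : ‖‖w‖⁻¹ • w‖ = 1 := by
    rw [norm_smul, norm_inv, norm_norm, inv_mul_cancel₀ hw.ne']
  obtain ⟨e₂, θ, hθ, hθ', ho, hfg⟩ := exists_orthonormal_frame (hunit hx0) (hunit hy0)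
    (h₀.harmonic.norm_eq_one _ hp) (by rw [real_inner_smul_left, hxn, mul_zero])
    (by rw [real_inner_smul_left, hyn, mul_zero])
  obtain ⟨r₁, r₂, r₃, N₁, N₂, N₃, h⟩ := exists_isSurgery h₀
    (norm_cos_smul_add_sin_smul ho (2 * (θ / 3))) (norm_cos_smul_add_sin_smul ho (θ / 3))
    (inner_cos_smul_add_sin_smul ho _) (inner_cos_smul_add_sin_smul ho _)
  obtain ⟨ψ, N, hg⟩ := h.exists_isGluedFront
  have hstar := isStar_starAngle hθ hθ' hx0 hy0 S
  have hκ := starScale_pos hx0 hy0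
  obtain ⟨τ, hτs, hτ0, hτt, hτ⟩ := exists_star_chart hstar hκ rfl fun _ _ => rfl
  have hchart : IsStarChart ψ N S.center 3 (starAngle θ) (fun i => starScale ‖x‖ ‖y‖ i * S.len i) τ :=
    ⟨hstar, hτs, hτ0, hτt,
      fun i hi => (h.isPSFrontWith_sector hg hκ (fun _ _ => rfl) hτ hi).1⟩
  refine ⟨r₁, r₂, r₃, N₁, N₂, N₃, _, _, ψ, N, h, hg, ⟨_, _, _, hchart⟩, fun himm => ?_⟩
  have hNc : N S.center = N₀ S.pt := (hg.incs _).2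
  rw [← hNc] at ho
  have hg' : ‖y‖⁻¹ • y = Real.cos θ • ‖x‖⁻¹ • x + Real.sin θ • e₂ := by
    refine hfg ?_
    rw [cross_smul_left, cross_smul_right]
    exact smul_ne_zero (inv_ne_zero hx0.ne') (smul_ne_zero (inv_ne_zero hy0.ne')
      (cross_partials_ne_zero h₀ himm))
  refine h.isImmersedSaddleAt hg hκ (fun _ _ => rfl) hτ hchart ho fun k hk => ?_
  obtain ⟨a0, a1, a2, a3, a4, a5, a6⟩ := rayAngle_starAngle θ
  rw [planeEmb_rayDir]
  interval_cases k <;> simp only [a0, a1, a2, a3, a4, a5, a6, tangent, starScale, ← hx, ← hy]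
  · simp
  · rw [inv_one, one_smul]
  · rw [inv_one, one_smul]
  · exact hg'
  · simp
  · rw [Real.cos_add_pi, Real.sin_add_pi, smul_neg, hg', neg_smul, neg_smul, neg_add]
  · simp

end SurgeryData

end PSF

theorem mainTheorem5 (S : PSF.SurgeryData) (r₀ N₀ : ℝ × ℝ → PSF.E3)
    (h₀ : PSF.IsPSFrontWith S.Ω₀ r₀ N₀) :
    ∃ (r₁ r₂ r₃ N₁ N₂ N₃ : ℝ × ℝ → PSF.E3) (eᵤ eᵥ : PSF.E3) (ψ N : S.Glued → PSF.E3),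
      -- the three new patches; the second one is an Amsler patch
      PSF.IsPSFrontWith S.Ω₁ r₁ N₁ ∧ PSF.IsPSFrontWith S.Ω₂ r₂ N₂ ∧
      PSF.IsPSFrontWith S.Ω₃ r₃ N₃ ∧
      PSF.HasAmslerData S.ut S.vt r₂ N₂ (r₀ S.pt) (N₀ S.pt) eᵤ eᵥ ∧
      -- the four pieces and their normal fields fit together on the glued space
      Continuous ψ ∧ Continuous N ∧
      (∀ p : S.Ωs, ψ (S.incs p) = r₀ p ∧ N (S.incs p) = N₀ p) ∧
      (∀ p : S.Ω₁, ψ (S.inc₁ p) = r₁ p ∧ N (S.inc₁ p) = N₁ p) ∧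
      (∀ p : S.Ω₂, ψ (S.inc₂ p) = r₂ p ∧ N (S.inc₂ p) = N₂ p) ∧
      (∀ p : S.Ω₃, ψ (S.inc₃ p) = r₃ p ∧ N (S.inc₃ p) = N₃ p) ∧
      -- the result is a branched PS-front on the glued asymptotic complex
      S.faces.IsBranchedPSFront ψ ∧
      -- with a branch point of order three at the given point, where six faces meet
      {k | S.center ∈ S.faces.face k}.ncard = 2 * 3 ∧
      PSF.HasSaddleStructureAt ψ N S.center 3 ∧
      -- which is an immersed monkey saddle if the given front is immersed there
      (PSF.cross (PSF.partialU S.Ω₀ N₀ S.pt) (PSF.partialV S.Ω₀ N₀ S.pt) ≠ 0 →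
        PSF.IsImmersedSaddleAt ψ N S.center 3) := by
  obtain ⟨r₁, r₂, r₃, N₁, N₂, N₃, eᵤ, eᵥ, ψ, N, h, hg, hs, hi⟩ :=
    PSF.SurgeryData.exists_saddle_surgery h₀
  exact ⟨r₁, r₂, r₃, N₁, N₂, N₃, eᵤ, eᵥ, ψ, N, h.front₁, h.front₂, h.front₃, h.amsler,
    hg.continuous_map, hg.continuous_normal, hg.incs, hg.inc₁, hg.inc₂, hg.inc₃,
    h.isBranchedPSFront hg, S.ncard_faces_center, hs, hi⟩
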